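/- **Setting.** Let $\lambda$ be Lebesgue measure, $\mathcal Y$ a measurable space whose diagonal is measurable, and $\mathcal H$ a nonempty set of measurable functions $\mathbb R\to\mathcal Y$ such that $\lambda(\{x:h(x)=h'(x)\})=0$ for all distinct $h,h'\in\mathcal H$. Let $d$ be the graph dimension of $\mathcal H$, i.e. the VC dimension of $\{\{(x,h(x)):x\in\mathbb R\}:h\in\mathcal H\}$, and suppose $0<d<\infty$. Assume the usual measurability convention for possibly uncountable classes: for every measurable $f:\mathbb R\to\mathcal Y$, every $n$ and every $J\subseteq\{1,\dots,n\}$, the set of $(x_1,\dots,x_n)\in\mathbb R^n$ for which some $h\in\mathcal H$ satisfies $\{j:h(x_j)=f(x_j)\}=J$ is Lebesgue measurable. For $k\in\mathbb N$, $F_k(\mathcal H)$ is the set of functions $f$ for which there are $h_1,\dots,h_k\in\mathcal H$ and reals $t_1\le\dots\le t_{k-1}$ with $f(x)=h_i(x)$ whenever $t_{i-1}<x\le t_i$ (where $t_0=-\infty$, $t_k=\infty$). An *$s$-sample $q$-query $\varepsilon$-tester for $F$ under a distribution $P$* is a randomized algorithm that draws $s$ points iid from $P$, sequentially (and possibly adaptively)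 queries the value of an unknown measurable $f:\mathbb R\to\mathcal Y$ at no more than $q$ of them, and then accepts with probability at least $2/3$ if $f\in F$, and rejects with probability at least $2/3$ if $\inf_{g\in F}P(\{x:f(x)\ne g(x)\})\ge\varepsilon$. **The procedure.** Given $\varepsilon\in(0,1/2)$, $k$, and numerical constants $c,c',c''\ge1$, put $$\delta=\frac{\varepsilon^2}{32k},\quad m=\Big\lceil\frac{c}{\varepsilon^4}\Big\rceil,\quad \ell=\Big\lceil\frac{c'd}{\varepsilon^4}\ln\frac{c''}{\varepsilon}\Big\rceil,\quad s=m+\Big\lceil\max\Big\{\frac{2\ell}{\delta},\frac8\delta\ln(12m)\Big\}\Big\rceil .$$ Draw $x''_1,\dots,x''_s$ iid from $\mathrm{Uniform}(0,1)$, and for $i\le m$ let $x_i=x''_i$ and let $x'_{i1},\dots,x'_{i\ell}$ be the first $\ell$ points, in order of index, among $x''_{m+1},\dots,x''_s$ that lie in $(x_i-\delta,x_i+\delta)$. If for some $i$ there are fewer than $\ell$ such points, return any response. Otherwise query $f$ at the $m(\ell+1)$ points $x_i,x'_{ij}$; for each $i\le m$ let $$\widehat{\mathrm{NS}}_\delta(f,x_i;\mathcal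 H)=\min_{h\in\mathcal H,\;h(x_i)=f(x_i)}\frac1\ell\sum_{j=1}^{\ell}\mathbf 1[h(x'_{ij})\ne f(x'_{ij})]$$ (and $1$ if no $h\in\mathcal H$ has $h(x_i)=f(x_i)$), and accept if and only if $$\frac1m\sum_{i=1}^m\widehat{\mathrm{NS}}_\delta(f,x_i;\mathcal H)\le(k-1)\frac\delta2\Big(1+\frac\varepsilon8\Big).$$ **Theorem 3.** There are numerical constants $c,c',c''\ge1$ (independent of $\mathcal Y,\mathcal H,d,\varepsilon,k$) such that for all such $\mathcal Y$, $\mathcal H$, all $\varepsilon\in(0,1/2)$ and all $k\ge80/\varepsilon$, this procedure is an $s$-sample, $m(\ell+1)$-query $\varepsilon$-tester for $F_k(\mathcal H)$ under $\mathrm{Uniform}(0,1)$, whatever its response in the failure case. -/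

import Mathlib

open MeasureTheory Set
open scoped ENNReal

universe u v

noncomputable section

/-! ### Piecewise classes, zero-measure crossings, graph dimension -/

/-- The class of `k`-piecewise functions with pieces in `H`: there are `h₀, …, h_{k-1} ∈ H` and
real breakpoints `t₀ ≤ … ≤ t_{k-2}` such that `f = hᵢ` on `(t_{i-1}, tᵢ]`, where the first interval
has no lower end and the last interval has no upper end. -/
def piecewiseClass {Y : Type u} (k : ℕ) (H : Set (ℝ → Y)) : Set (ℝ → Y) :=
  {f | ∃ (h : Fin k → ℝ → Y) (t : Fin (k - 1) → ℝ), (∀ i, h i ∈ H) ∧ Monotone t ∧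
    ∀ (i : Fin k) (x : ℝ),
      (∀ j : Fin (k - 1), (j : ℕ) + 1 = i → t j < x) →
      (∀ j : Fin (k - 1), (j : ℕ) = i → x ≤ t j) →
      f x = h i x}

/-- Any two distinct members of `H` agree only on a Lebesgue-null set. -/
def ZeroMeasureCrossings {Y : Type u} (H : Set (ℝ → Y)) : Prop :=
  ∀ h ∈ H, ∀ h' ∈ H, h ≠ h' → volume {x : ℝ | h x = h' x} = 0

/-- The collection `C` of subsets of `Z` shatters the finite set `A`. -/
def SetShatters {Z : Type u} (C : Set (Set Z)) (A : Finset Z) : Prop :=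
  ∀ B : Set Z, B ⊆ (A : Set Z) → ∃ S ∈ C, S ∩ (A : Set Z) = B

/-- The VC dimension of a collection of sets. -/
def setVCDim {Z : Type u} (C : Set (Set Z)) : ℕ∞ :=
  ⨆ (A : Finset Z) (_ : SetShatters C A), (A.card : ℕ∞)

/-- The graph dimension of `H`: the VC dimension of the collection of graphs of members of `H`. -/
def graphDim {Y : Type u} (H : Set (ℝ → Y)) : ℕ∞ :=
  setVCDim ((fun h : ℝ → Y => {p : ℝ × Y | p.2 = h p.1}) '' H)

/-- The measurability convention of empirical process theory for the (possibly uncountable)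
class `H`: for every measurable `f`, the event that some `h ∈ H` agrees with `f` at the sample
points with index in `J`, and at no other sample point, is Lebesgue measurable. -/
def EmpiricallyMeasurable {Y : Type u} [MeasurableSpace Y] (H : Set (ℝ → Y)) : Prop :=
  ∀ f : ℝ → Y, Measurable f → ∀ (n : ℕ) (J : Set (Fin n)),
    NullMeasurableSet {x : Fin n → ℝ | ∃ h ∈ H, ∀ j, h (x j) = f (x j) ↔ j ∈ J} volume

/-! ### Query algorithms and testers -/

/-- An interactive algorithm with access to the values of the target at `s` sample points. It
either halts with a decision (`true` is accept, `false` is reject), or queries the value at the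
sample point with a given index and continues depending on the answer. -/
inductive QueryAlg (s : ℕ) (Y : Type u) : Type u
  | halt (decision : Bool) : QueryAlg s Y
  | query (i : Fin s) (next : Y → QueryAlg s Y) : QueryAlg s Y

/-- The decision reached when the query for index `i` is answered by `a i`. -/
def QueryAlg.run {s : ℕ} {Y : Type u} : QueryAlg s Y → (Fin s → Y) → Bool
  | .halt b, _ => b
  | .query i next, a => (next (a i)).run a

/-- The number of queries made when the query for index `i` is answered by `a i`. -/
def QueryAlg.numQueries {s : ℕ} {Y : Type u} : QueryAlg s Y → (Fin s → Y) → ℕ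
  | .halt _, _ => 0
  | .query i next, a => (next (a i)).numQueries a + 1

/-- Query the indices `idx 0, …, idx (n-1)` in this order, then decide by `D` from the answers. -/
def QueryAlg.batch {s : ℕ} {Y : Type u} :
    (n : ℕ) → (Fin n → Fin s) → ((Fin n → Y) → Bool) → QueryAlg s Y
  | 0, _, D => .halt (D Fin.elim0)
  | n + 1, idx, D =>
      .query (idx 0) fun y => QueryAlg.batch n (fun j => idx j.succ) fun a => D (Fin.cons y a)

/-- The distance of `f` from the class `F`, for the pseudo-distance `P {x | f x ≠ g x}`. -/
def distToClass {Y : Type u} (P : Measure ℝ) (f : ℝ → Y) (F : Set (ℝ → Y)) : ℝ≥0∞ :=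
  ⨅ g ∈ F, P {x | f x ≠ g x}

/-- The event `S` has (inner) probability at least `p`. For a measurable `S` this is `p ≤ μ S`. -/
def ProbAtLeast {Ω : Type*} [MeasurableSpace Ω] (μ : Measure Ω) (p : ℝ≥0∞) (S : Set Ω) : Prop :=
  ∃ E ⊆ S, MeasurableSet E ∧ p ≤ μ E

/-- `A` is an `s`-sample `q`-query `ε`-tester for `F` under `P`. The algorithm has a random seed
`r` with law `ρ` and an independent iid sample `x` of size `s` from `P`; from these (and not from
the target) it determines an interactive query algorithm, which is then run on the target. -/
structure IsTester {Y : Type u} [MeasurableSpace Y] (P : Measure ℝ) (F : Set (ℝ → Y)) (ε : ℝ)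
    (s q : ℕ) {R : Type v} [MeasurableSpace R] (ρ : Measure R)
    (A : R → (Fin s → ℝ) → QueryAlg s Y) : Prop where
  queries_le : ∀ r x a, (A r x).numQueries a ≤ q
  accepts : ∀ f : ℝ → Y, Measurable f → f ∈ F →
    ProbAtLeast (ρ.prod (Measure.pi fun _ : Fin s => P)) (2 / 3)
      {ω | (A ω.1 ω.2).run (fun i => f (ω.2 i)) = true}
  rejects : ∀ f : ℝ → Y, Measurable f → ENNReal.ofReal ε ≤ distToClass P f F →
    ProbAtLeast (ρ.prod (Measure.pi fun _ : Fin s => P)) (2 / 3)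
      {ω | (A ω.1 ω.2).run (fun i => f (ω.2 i)) = false}

/-- The distribution `Uniform(0,1)` on the real line. -/
def uniform01 : Measure ℝ := volume.restrict (Icc 0 1)

/-! ### The testing procedure -/

open Classical in
/-- The empirical instantaneous noise sensitivity at `x` with value `y`, from the points `x' j` with
values `y' j`: the minimum over the `h ∈ H` with `h x = y` of the fraction of `j` with
`h (x' j) ≠ y' j`, and `1` if there is no such `h`. -/
def empNSAt {Y : Type u} (H : Set (ℝ → Y)) {l : ℕ} (x : ℝ) (y : Y)
    (x' : Fin l → ℝ) (y' : Fin l → Y) : ℝ :=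
  if ∃ h ∈ H, h x = y then
    sInf ((fun h : ℝ → Y => (1 / (l : ℝ)) * ∑ j, if h (x' j) ≠ y' j then (1 : ℝ) else 0) ''
      {h | h ∈ H ∧ h x = y})
  else 1

/-- The empirical noise sensitivity: the average of `empNSAt` over `m` centres. The `i`-th centre
is `pts i 0`, with the nearby points `pts i 1, …, pts i l`; `vals` are the target values there. -/
def empNS {Y : Type u} (H : Set (ℝ → Y)) {m l : ℕ} (pts : Fin m → Fin (l + 1) → ℝ)
    (vals : Fin m → Fin (l + 1) → Y) : ℝ :=
  (1 / (m : ℝ)) * ∑ i, empNSAt H (pts i 0) (vals i 0)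
    (fun j => pts i j.succ) (fun j => vals i j.succ)

open Classical in
/-- Among the last `N` of the `m + N` sample points, those that lie within `δ` of the `i`-th of the
first `m` sample points. -/
def hits {m N : ℕ} (δ : ℝ) (x : Fin (m + N) → ℝ) (i : Fin m) : Finset (Fin N) :=
  Finset.univ.filter fun t =>
    x (Fin.natAdd m t) ∈ Ioo (x (Fin.castAdd N i) - δ) (x (Fin.castAdd N i) + δ)

/-- The sample indices used for the `i`-th centre, when there are at least `l` hits: the centre
itself, followed by the first `l` hits in the order of the sample. -/
def usedIndex {m N l : ℕ} (δ : ℝ) (x : Fin (m + N) → ℝ)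
    (hx : ∀ i, l ≤ (hits δ x i).card) (i : Fin m) : Fin (l + 1) → Fin (m + N) :=
  Fin.cons (Fin.castAdd N i) fun j => Fin.natAdd m ((hits δ x i).orderEmbOfCardLe (hx i) j)

open Classical in
/-- The noise sensitivity tester on the sample `x` of size `m + N`. If for each of the first `m`
sample points there are `l` others within `δ` among the last `N`, query these `m * (l + 1)` points
and accept iff the empirical noise sensitivity is at most `θ`; otherwise respond `fail`. -/
def nsTester {Y : Type u} (H : Set (ℝ → Y)) (m l N : ℕ) (δ θ : ℝ) (fail : Bool)
    (x : Fin (m + N) → ℝ) : QueryAlg (m + N) Y :=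
  if hx : ∀ i, l ≤ (hits δ x i).card then
    QueryAlg.batch (m * (l + 1))
      (fun p => usedIndex δ x hx (finProdFinEquiv.symm p).1 (finProdFinEquiv.symm p).2)
      (fun a => decide (empNS H (fun i j => x (usedIndex δ x hx i j))
        (fun i j => a (finProdFinEquiv (i, j))) ≤ θ))
  else QueryAlg.halt fail

end

noncomputable section

/-! The noise sensitivity of f at scale δ is the mean, over a uniform centre x, of the least
frequency with which a member of `H` passing through (x, f x) disagrees with f within δ of x. For a
k-piecewise f it is at most about (k-1)δ/2: the piece at x is a candidate, a breakpoint t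
contributes the tent max(0, δ-|x-t|)/(2δ), whose integral is at most δ/2, and the two ends of the
unit interval cost at most 2δ (`integral_otherPieceProb_le`).

Conversely, noise sensitivity at most (k-1)(δ/2)(1+ε/6) forces f to be ε-close to the class
(`exists_close_of_integral_lowerNS_le`). Where the local value is below τ = ε/8, some label L x in
`H` agrees with f near x up to a fraction τ. Distinct labels cross on null sets, so their agreement
sets compete for length. Take x < y with different labels and let F be the cumulative length of
agreement with L x. The quotient (2F(z)-F(z-δ)-F(z+δ))/(2δ) is a lower bound for the local
sensitivity at z, whichever member realises it. Its integral from x, where F has slope nearly 1, to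
y, where the slope is nearly 0, telescopes to at least (δ/2)(1-4τ). These costs add up along a chain
of label changes, so there are at most (k-1)(1+ε/6)/(1-ε/2) changes. Keeping the k heaviest runs of
constant label loses at most 2ε/3, and Markov's inequality bounds the unlabelled set.

The acceptance threshold, with 1+ε/8, separates the two cases. It is of order ε² and the gaps are of
order ε³, so variance-sensitive bounds need about ε²/(ε³)² = ε⁻⁴ samples. Chebyshev's inequality
handles the centres. For acceptance the local samples are tested against one fixed candidate, and a
second moment suffices. For rejection the minimum over `H` requires a one-sided relative uniform
deviation bound (`exists_exceptionalSet`), obtained from a ghost sample, random signs and the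
Sauer–Shelah lemma for the graph dimension. Given the centre and the set of nearby indices, the
nearby points are iid (`lintegral_onFirstNear_le`); a Chernoff bound supplies enough of them. -/

/-! ### Averages and conditioning under product measures. -/

theorem lintegral_sq_average_sub_le {X : Type*} [MeasurableSpace X] (ν : Measure X)
    [IsProbabilityMeasure ν] {g : X → ℝ} (hg : Measurable g) (h0 : ∀ x, 0 ≤ g x)
    (h1 : ∀ x, g x ≤ 1) {n : ℕ} (hn : 0 < n) :
    ∫⁻ y : Fin n → X, ENNReal.ofReal (((1 / (n : ℝ)) * ∑ j, g (y j) - ∫ x, g x ∂ν) ^ 2)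
      ∂(Measure.pi fun _ => ν) ≤ ENNReal.ofReal ((∫ x, g x ∂ν) / n) := by
  have hn' : (0 : ℝ) < n := by exact_mod_cast hn
  have hint : Integrable g ν := Integrable.of_bound hg.aestronglyMeasurable 1
    (Filter.Eventually.of_forall fun x => by rw [Real.norm_of_nonneg (h0 x)]; exact h1 x)
  have hLp : MemLp g 2 ν := MemLp.of_bound hg.aestronglyMeasurable 1
    (Filter.Eventually.of_forall fun x => by rw [Real.norm_of_nonneg (h0 x)]; exact h1 x)
  have hvar := ProbabilityTheory.variance_sum_pi (ι := Fin n) (μ := fun _ => ν)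
    (X := fun _ => g) (fun _ => hLp)
  -- Since g² ≤ g on [0,1], the variance is at most the mean. A small mean therefore improves the
  -- bound, which keeps the sample sizes at order ε⁻⁴.
  have hv1 : ProbabilityTheory.variance g ν ≤ ∫ x, g x ∂ν := by
    refine (ProbabilityTheory.variance_le_expectation_sq hg.aestronglyMeasurable).trans ?_
    refine integral_mono hLp.integrable_sq hint fun x => ?_
    have := h0 x; have := h1 x
    simp only [Pi.pow_apply]; nlinarith
  set Z : (Fin n → X) → ℝ := ∑ i, fun y : Fin n → X => g (y i) with hZ
  have hZm : Measurable Z := by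
    have : Z = fun y => ∑ i, g (y i) := by ext; simp [hZ]
    rw [this]; fun_prop
  have hZL : MemLp Z 2 (Measure.pi fun _ : Fin n => ν) := by
    refine MemLp.of_bound hZm.aestronglyMeasurable n (Filter.Eventually.of_forall fun y => ?_)
    simp only [hZ, Finset.sum_apply]
    rw [Real.norm_of_nonneg (Finset.sum_nonneg fun i _ => h0 _)]
    calc _ ≤ ∑ i : Fin n, (1 : ℝ) := Finset.sum_le_sum fun i _ => h1 _
      _ = n := by simp
  have hmean : ∫ y, Z y ∂(Measure.pi fun _ : Fin n => ν) = n * ∫ x, g x ∂ν := by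
    have : Z = fun y => ∑ i, g (y i) := by ext; simp [hZ]
    rw [this, integral_finsetSum _ fun i _ => integrable_comp_eval hint]
    simp_rw [integral_comp_eval (μ := fun _ : Fin n => ν) (f := g) hg.aestronglyMeasurable]
    simp
  have e : ∀ y : Fin n → X, ENNReal.ofReal (((1 / (n : ℝ)) * ∑ j, g (y j) - ∫ x, g x ∂ν) ^ 2)
      = ENNReal.ofReal (1 / (n : ℝ) ^ 2) *
        ENNReal.ofReal ((Z y - ∫ y, Z y ∂(Measure.pi fun _ : Fin n => ν)) ^ 2) := by
    intro y
    rw [← ENNReal.ofReal_mul (by positivity), hmean]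
    congr 1
    simp only [hZ, Finset.sum_apply]
    field_simp
  simp_rw [e]
  rw [lintegral_const_mul _ (by fun_prop)]
  have e2 : ∫⁻ y, ENNReal.ofReal ((Z y - ∫ y, Z y ∂(Measure.pi fun _ : Fin n => ν)) ^ 2)
      ∂(Measure.pi fun _ : Fin n => ν)
      = ENNReal.ofReal (ProbabilityTheory.variance Z (Measure.pi fun _ : Fin n => ν)) := by
    rw [hZL.ofReal_variance_eq, ProbabilityTheory.evariance_eq_lintegral_ofReal]
  rw [e2, ← ENNReal.ofReal_mul (by positivity), hvar]
  apply ENNReal.ofReal_le_ofReal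
  simp only [Finset.sum_const, Finset.card_univ, Fintype.card_fin, nsmul_eq_mul]
  rw [div_mul_eq_mul_div, one_mul, pow_two, mul_div_mul_left _ _ hn'.ne']
  gcongr

theorem pi_average_sub_ge_le {X : Type*} [MeasurableSpace X] (ν : Measure X)
    [IsProbabilityMeasure ν] {g : X → ℝ} (hg : Measurable g) (h0 : ∀ x, 0 ≤ g x)
    (h1 : ∀ x, g x ≤ 1) {n : ℕ} (hn : 0 < n) {c : ℝ} (hc : 0 < c) :
    (Measure.pi fun _ => ν) {y : Fin n → X | c ≤ |(1 / (n : ℝ)) * ∑ j, g (y j) - ∫ x, g x ∂ν|}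
      ≤ ENNReal.ofReal ((∫ x, g x ∂ν) / (n * c ^ 2)) := by
  have hn' : (0 : ℝ) < n := by exact_mod_cast hn
  have h := meas_ge_le_lintegral_div (μ := Measure.pi fun _ : Fin n => ν)
    (f := fun y : Fin n → X =>
      ENNReal.ofReal (((1 / (n : ℝ)) * ∑ j, g (y j) - ∫ x, g x ∂ν) ^ 2))
    (Measurable.aemeasurable (by fun_prop)) (ε := ENNReal.ofReal (c ^ 2))
    (by simp [hc.ne']) ENNReal.ofReal_ne_top
  refine (measure_mono fun y hy => ?_).trans (h.trans ?_)
  · simp only [mem_ofPred_eq] at hy ⊢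
    apply ENNReal.ofReal_le_ofReal
    rw [← sq_abs (_ - _)]
    gcongr
  · refine (ENNReal.div_le_div_right (lintegral_sq_average_sub_le ν hg h0 h1 hn) _).trans ?_
    rw [← ENNReal.ofReal_div_of_pos (by positivity), div_div]

/-- For a product measure, on a rectangle that restricts the coordinates in the range of `s` to
`I`, these coordinates are independent with the conditional law given `I`. -/
theorem setLIntegral_pi_comp_embedding {X : Type*} [MeasurableSpace X] (μ : Measure X)
    [IsProbabilityMeasure μ] {N l : ℕ} (hl : 0 < l) {A : Fin N → Set X} (hA : ∀ t, MeasurableSet (A t))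
    {I : Set X} {s : Fin l → Fin N} (hs : Function.Injective s) (hI : ∀ j, A (s j) = I)
    {g : (Fin l → X) → ℝ≥0∞} (hg : Measurable g) :
    ∫⁻ y in univ.pi A, g (y ∘ s) ∂(Measure.pi fun _ => μ) =
      (Measure.pi fun _ => μ) (univ.pi A) *
        ∫⁻ z, g z ∂(Measure.pi fun _ => ProbabilityTheory.cond μ I) := by
  classical
  have hsm : Measurable fun y : Fin N → X => y ∘ s := by
    apply measurable_pi_lambda; intro j; exact measurable_pi_apply _
  set c := (Measure.pi fun _ => μ) (univ.pi A) with hc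
  have hctop : c ≠ ⊤ := measure_ne_top _ _
  rcases eq_or_ne c 0 with h0 | h0
  · rw [h0, zero_mul, Measure.restrict_eq_zero.2 h0]; simp
  have hprod : c = ∏ t, μ (A t) := by rw [hc, Measure.pi_pi]
  have hAt : ∀ t, μ (A t) ≠ 0 := fun t ht => h0 (by rw [hprod]; exact Finset.prod_eq_zero (Finset.mem_univ t) ht)
  have hIm : ∀ j : Fin l, IsProbabilityMeasure (ProbabilityTheory.cond μ I) := fun j =>
    ProbabilityTheory.cond_isProbabilityMeasure (by rw [← hI j]; exact hAt _)
  have key : ((Measure.pi fun _ => μ).restrict (univ.pi A)).map (fun y => y ∘ s)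
      = c • Measure.pi fun _ : Fin l => ProbabilityTheory.cond μ I := by
    have : Measure.pi (fun _ : Fin l => ProbabilityTheory.cond μ I) =
        c⁻¹ • ((Measure.pi fun _ => μ).restrict (univ.pi A)).map (fun y => y ∘ s) := by
      have : ∀ j : Fin l, SigmaFinite (ProbabilityTheory.cond μ I) := fun j => by
        have := hIm j; infer_instance
      have := hIm ⟨0, hl⟩
      apply Measure.pi_eq
      intro E hE
      rw [Measure.smul_apply, Measure.map_apply hsm (MeasurableSet.univ_pi hE),
        Measure.restrict_apply (hsm (MeasurableSet.univ_pi hE))]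
      have hset : (fun y : Fin N → X => y ∘ s) ⁻¹' univ.pi E ∩ univ.pi A
          = univ.pi fun t => A t ∩ ⋂ (j) (_ : s j = t), E j := by
        ext y
        simp only [mem_inter_iff, mem_preimage, mem_univ_pi, Function.comp, mem_iInter]
        constructor
        · rintro ⟨h1, h2⟩ t
          exact ⟨h2 t, fun j hj => hj ▸ h1 j⟩
        · intro h
          exact ⟨fun j => (h (s j)).2 j rfl, fun t => (h t).1⟩
      rw [hset, Measure.pi_pi]
      -- Injectivity of `s` leaves at most one constraint `E j` on each coordinate; a coordinate
      -- outside the range carries none, matching an empty product.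
      have hfac : ∀ t, μ (A t ∩ ⋂ (j) (_ : s j = t), E j)
          = μ (A t) * ∏ j with s j = t, ProbabilityTheory.cond μ I (E j) := by
        intro t
        by_cases ht : ∃ j, s j = t
        · obtain ⟨j, rfl⟩ := ht
          have : (Finset.univ.filter fun i => s i = s j) = {j} := by
            ext i; simp [hs.eq_iff]
          rw [this, Finset.prod_singleton, ProbabilityTheory.cond_apply (hI j ▸ hA _), hI j,
            ← mul_assoc, ENNReal.mul_inv_cancel (hI j ▸ hAt _) (measure_ne_top _ _), one_mul]
          congr 2
          ext x; simp [hs.eq_iff]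
        · push Not at ht
          have : (Finset.univ.filter fun i => s i = t) = ∅ := by
            ext i; simp [ht i]
          rw [this, Finset.prod_empty, mul_one]
          congr 1
          ext x; simp [ht]
      simp_rw [hfac]
      rw [Finset.prod_mul_distrib, ← hprod, Finset.prod_fiberwise, smul_eq_mul, ← mul_assoc,
        ENNReal.inv_mul_cancel h0 hctop, one_mul]
    rw [this, smul_smul, ENNReal.mul_inv_cancel h0 hctop, one_smul]
  rw [← lintegral_map hg hsm, key, lintegral_smul_measure, smul_eq_mul]

/-! ### Symmetrization with random signs. -/

/-- Chernoff's method with exponent α/3. By cosh u ≤ exp(u²/2) the moment factor is at most exp(α² ∑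
v / 18), exactly cancelled by the α part of the threshold; the β part leaves exp(-αβl/18). -/
theorem card_sign_sum_gt_le {l : ℕ} {α β : ℝ} (hα : 0 ≤ α) (b v : Fin l → ℝ)
    (hb : ∀ j, b j ^ 2 ≤ v j) :
    ((Finset.univ.filter fun σ : Fin l → Bool =>
      (1 / 6) * (α * ∑ j, v j + β * l) < ∑ j, (if σ j then b j else -b j)).card : ℝ)
      ≤ 2 ^ l * Real.exp (-(α * β * l / 18)) := by
  set t := (1 / 6) * (α * ∑ j, v j + β * l) with ht
  have h1 : ((Finset.univ.filter fun σ : Fin l → Bool =>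
      t < ∑ j, (if σ j then b j else -b j)).card : ℝ) ≤
      ∑ σ : Fin l → Bool, Real.exp (α / 3 * (∑ j, (if σ j then b j else -b j)) - α / 3 * t) := by
    rw [Finset.card_eq_sum_ones, Nat.cast_sum, Finset.sum_filter]
    refine Finset.sum_le_sum fun σ _ => ?_
    split_ifs with h
    · rw [Nat.cast_one, Real.one_le_exp_iff]
      have : 0 ≤ α / 3 * (∑ j, (if σ j then b j else -b j) - t) :=
        mul_nonneg (by positivity) (by linarith)
      linarith
    · positivity
  have h2 : ∑ σ : Fin l → Bool, Real.exp (α / 3 * (∑ j, (if σ j then b j else -b j)) - α / 3 * t)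
      = (∏ j, (2 * Real.cosh (α / 3 * b j))) * Real.exp (-(α / 3 * t)) := by
    have h3 : ∀ j, 2 * Real.cosh (α / 3 * b j)
        = ∑ s : Bool, Real.exp (α / 3 * (if s then b j else -b j)) := by
      intro j
      rw [Real.cosh_eq]; simp; ring
    simp_rw [h3]
    rw [Finset.prod_univ_sum, Fintype.piFinset_univ, Finset.sum_mul]
    refine Finset.sum_congr rfl fun σ _ => ?_
    rw [← Real.exp_sum, ← Real.exp_add, Finset.mul_sum, sub_eq_add_neg]
  have h4 : ∏ j, (2 * Real.cosh (α / 3 * b j)) ≤ 2 ^ l * Real.exp (α ^ 2 / 18 * ∑ j, v j) := by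
    rw [Finset.mul_sum, Real.exp_sum, Finset.prod_mul_distrib]
    simp only [Finset.prod_const, Finset.card_univ, Fintype.card_fin]
    gcongr with j
    refine (Real.cosh_le_exp_half_sq _).trans (Real.exp_le_exp.2 ?_)
    have := mul_le_mul_of_nonneg_left (hb j) (sq_nonneg α)
    nlinarith
  refine h1.trans (h2.trans_le ?_)
  calc _ ≤ 2 ^ l * Real.exp (α ^ 2 / 18 * ∑ j, v j) * Real.exp (-(α / 3 * t)) := by gcongr
    _ = _ := by
      rw [mul_assoc, ← Real.exp_add]
      congr 2
      rw [ht]; ring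

theorem measurePreserving_append {X : Type*} [MeasurableSpace X] (ν : Measure X)
    [SigmaFinite ν] (m n : ℕ) :
    MeasurePreserving (fun p : (Fin m → X) × (Fin n → X) => (Fin.append p.1 p.2 : Fin (m + n) → X))
      ((Measure.pi fun _ => ν).prod (Measure.pi fun _ => ν)) (Measure.pi fun _ => ν) := by
  have h1 := measurePreserving_sumPiEquivProdPi_symm (X := fun _ : Fin m ⊕ Fin n => X)
    (fun _ => ν)
  have h2 := measurePreserving_piCongrLeft (fun _ : Fin (m + n) => ν) finSumFinEquiv
  convert h2.comp h1 using 1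
  ext p i
  refine Fin.addCases (fun j => ?_) (fun j => ?_) i
  · simp only [Fin.append_left, Function.comp]
    rw [← finSumFinEquiv_apply_left, MeasurableEquiv.piCongrLeft_apply_apply]
    rfl
  · simp only [Fin.append_right, Function.comp]
    rw [← finSumFinEquiv_apply_right, MeasurableEquiv.piCongrLeft_apply_apply]
    rfl

/-- The pairs of samples for which some set in `𝒟` has many more points of the second sample than
of the first. -/
def excessSet {X : Type*} (𝒟 : Set (Set X)) (α β : ℝ) (l : ℕ) :
    Set ((Fin l → X) × (Fin l → X)) :=
  {p | ∃ D ∈ 𝒟, (1 / 6) * (α * ∑ j, (D.indicator 1 (p.1 j) + D.indicator 1 (p.2 j)) + β * l)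
    < ∑ j, (D.indicator (1 : X → ℝ) (p.2 j) - D.indicator 1 (p.1 j))}

/-- The index sets cut out of the sample `z` by members of `𝒟`. -/
def traceSet {X : Type*} (𝒟 : Set (Set X)) {n : ℕ} (z : Fin n → X) : Set (Finset (Fin n)) :=
  {J | ∃ D ∈ 𝒟, ∀ j, z j ∈ D ↔ j ∈ J}

/-- Membership depends only on the trace cut out of the joined sample, so the possibly uncountable
union over `𝒟` is a finite union over traces. -/
theorem nullMeasurableSet_excessSet {X : Type*} [MeasurableSpace X] (ν : Measure X)
    [SigmaFinite ν] (𝒟 : Set (Set X)) (α β : ℝ) (l : ℕ)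
    (h𝒟 : ∀ J : Finset (Fin (l + l)), NullMeasurableSet {z | J ∈ traceSet 𝒟 z}
      (Measure.pi fun _ => ν)) :
    NullMeasurableSet (excessSet 𝒟 α β l)
      ((Measure.pi fun _ => ν).prod (Measure.pi fun _ => ν)) := by
  classical
  set a : Finset (Fin (l + l)) → Fin (l + l) → ℝ := fun J i => if i ∈ J then 1 else 0 with ha
  have : excessSet 𝒟 α β l = ⋃ J ∈ {J : Finset (Fin (l + l)) |
      (1 / 6) * (α * ∑ j : Fin l, (a J (Fin.castAdd l j) + a J (Fin.natAdd l j)) + β * l)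
        < ∑ j : Fin l, (a J (Fin.natAdd l j) - a J (Fin.castAdd l j))},
      (fun p : (Fin l → X) × (Fin l → X) => (Fin.append p.1 p.2 : Fin (l + l) → X)) ⁻¹'
        {z | J ∈ traceSet 𝒟 z} := by
    ext p
    simp only [excessSet, traceSet, mem_ofPred_eq, mem_iUnion, mem_preimage, exists_prop]
    constructor
    · rintro ⟨D, hD, h⟩
      refine ⟨Finset.univ.filter fun i => Fin.append p.1 p.2 i ∈ D, ?_, D, hD, by simp⟩
      simpa only [ha, indicator_apply, Finset.mem_filter, Finset.mem_univ, true_and,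
        Fin.append_left, Fin.append_right, Pi.one_apply] using h
    · rintro ⟨J, h, D, hD, hJ⟩
      refine ⟨D, hD, ?_⟩
      have e1 : ∀ j : Fin l, a J (Fin.castAdd l j) = D.indicator 1 (p.1 j) := by
        intro j
        have := hJ (Fin.castAdd l j)
        simp only [Fin.append_left] at this
        simp [ha, indicator_apply, this]
      have e2 : ∀ j : Fin l, a J (Fin.natAdd l j) = D.indicator 1 (p.2 j) := by
        intro j
        have := hJ (Fin.natAdd l j)
        simp only [Fin.append_right] at this
        simp [ha, indicator_apply, this]
      simpa only [e1, e2] using h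
  rw [this]
  refine NullMeasurableSet.biUnion (Set.to_countable _) fun J _ => ?_
  exact (h𝒟 J).preimage (measurePreserving_append ν l l).quasiMeasurePreserving

open Classical in
-- Swapping within pairs changes only the signs of the differences and leaves the sums over pairs
-- unchanged. Hence the at most `K` traces on one joined sample serve all sign patterns, and a union
-- bound applies.
theorem card_swap_mem_excessSet_le {X : Type*} (𝒟 : Set (Set X)) {α β : ℝ} (hα : 0 ≤ α)
    {l : ℕ} {K : ℕ} (hK : ∀ z : Fin (l + l) → X, (traceSet 𝒟 z).ncard ≤ K)
    (w : Fin l → X × X) :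
    ((Finset.univ.filter fun σ : Fin l → Bool =>
      ((fun j => (if σ j then w j else (w j).swap).1),
        fun j => (if σ j then w j else (w j).swap).2) ∈ excessSet 𝒟 α β l).card : ℝ)
      ≤ K * (2 ^ l * Real.exp (-(α * β * l / 18))) := by
  set z : Fin (l + l) → X := Fin.append (fun j => (w j).1) (fun j => (w j).2) with hz
  set a : Finset (Fin (l + l)) → Fin (l + l) → ℝ := fun J i => if i ∈ J then 1 else 0 with ha
  have hsub : (Finset.univ.filter fun σ : Fin l → Bool =>
      ((fun j => (if σ j then w j else (w j).swap).1),
        fun j => (if σ j then w j else (w j).swap).2) ∈ excessSet 𝒟 α β l) ⊆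
      (traceSet 𝒟 z).toFinset.biUnion fun J => Finset.univ.filter fun σ : Fin l → Bool =>
        (1 / 6) * (α * ∑ j : Fin l, (a J (Fin.castAdd l j) + a J (Fin.natAdd l j)) + β * l) <
          ∑ j, (if σ j then (a J (Fin.natAdd l j) - a J (Fin.castAdd l j))
            else -(a J (Fin.natAdd l j) - a J (Fin.castAdd l j))) := by
    intro σ hσ
    simp only [Finset.mem_filter, Finset.mem_univ, true_and, excessSet, mem_ofPred_eq] at hσ
    obtain ⟨D, hD, h⟩ := hσ
    simp only [Finset.mem_biUnion, mem_toFinset, Finset.mem_filter, Finset.mem_univ, true_and]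
    refine ⟨Finset.univ.filter fun i => z i ∈ D, ⟨D, hD, by simp⟩, ?_⟩
    convert h using 1
    · congr 3
      refine Finset.sum_congr rfl fun j _ => ?_
      simp only [ha, hz, Finset.mem_filter, Finset.mem_univ, true_and, Fin.append_left,
        Fin.append_right]
      by_cases hs : σ j <;> simp [hs, indicator_apply, add_comm]
    · refine Finset.sum_congr rfl fun j _ => ?_
      simp only [ha, hz, Finset.mem_filter, Finset.mem_univ, true_and, Fin.append_left,
        Fin.append_right]
      by_cases hs : σ j <;> simp [hs, indicator_apply]
  have hcard : (traceSet 𝒟 z).toFinset.card ≤ K := by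
    rw [← Set.ncard_eq_toFinset_card']; exact hK z
  calc _ ≤ (((traceSet 𝒟 z).toFinset.biUnion fun J => Finset.univ.filter fun σ : Fin l → Bool =>
        (1 / 6) * (α * ∑ j : Fin l, (a J (Fin.castAdd l j) + a J (Fin.natAdd l j)) + β * l) <
          ∑ j, (if σ j then (a J (Fin.natAdd l j) - a J (Fin.castAdd l j))
            else -(a J (Fin.natAdd l j) - a J (Fin.castAdd l j)))).card : ℝ) := by
        exact_mod_cast Finset.card_le_card hsub
    _ ≤ ∑ J ∈ (traceSet 𝒟 z).toFinset, ((Finset.univ.filter fun σ : Fin l → Bool =>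
        (1 / 6) * (α * ∑ j : Fin l, (a J (Fin.castAdd l j) + a J (Fin.natAdd l j)) + β * l) <
          ∑ j, (if σ j then (a J (Fin.natAdd l j) - a J (Fin.castAdd l j))
            else -(a J (Fin.natAdd l j) - a J (Fin.castAdd l j)))).card : ℝ) := by
        exact_mod_cast Finset.card_biUnion_le
    _ ≤ ∑ J ∈ (traceSet 𝒟 z).toFinset, (2 ^ l * Real.exp (-(α * β * l / 18))) := by
        refine Finset.sum_le_sum fun J _ => card_sign_sum_gt_le hα _ _ fun j => ?_
        simp only [ha]
        split_ifs <;> norm_num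
    _ ≤ _ := by
        rw [Finset.sum_const, nsmul_eq_mul]
        gcongr

/-- One-sided relative uniform deviation bound for two independent samples. -/
theorem measure_excessSet_le {X : Type*} [MeasurableSpace X] (ν : Measure X)
    [IsProbabilityMeasure ν] (𝒟 : Set (Set X)) {α β : ℝ} (hα : 0 ≤ α) {l : ℕ}
    (h𝒟 : ∀ J : Finset (Fin (l + l)), NullMeasurableSet {z | J ∈ traceSet 𝒟 z}
      (Measure.pi fun _ => ν))
    {K : ℕ} (hK : ∀ z : Fin (l + l) → X, (traceSet 𝒟 z).ncard ≤ K) :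
    ((Measure.pi fun _ => ν).prod (Measure.pi fun _ => ν)) (excessSet 𝒟 α β l)
      ≤ ENNReal.ofReal (K * Real.exp (-(α * β * l / 18))) := by
  classical
  have hnull := nullMeasurableSet_excessSet ν 𝒟 α β l h𝒟
  have harr := measurePreserving_arrowProdEquivProdArrow X X (Fin l) (fun _ => ν) (fun _ => ν)
  set μ' : Measure (Fin l → X × X) := Measure.pi fun _ => ν.prod ν with hμ'
  set T : (Fin l → Bool) → (Fin l → X × X) → (Fin l → X) × (Fin l → X) := fun σ w =>
      ((fun j => (if σ j then w j else (w j).swap).1),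
        fun j => (if σ j then w j else (w j).swap).2) with hT
  have hTm : ∀ σ, MeasurePreserving (T σ) μ'
      ((Measure.pi fun _ => ν).prod (Measure.pi fun _ => ν)) := by
    intro σ
    have h1 : MeasurePreserving (fun (w : Fin l → X × X) j => (if σ j then id else Prod.swap) (w j))
        μ' μ' := by
      refine measurePreserving_pi (fun _ => ν.prod ν) (fun _ => ν.prod ν)
        (f := fun j => if σ j then id else Prod.swap) fun j => ?_
      by_cases h : σ j
      · simpa [h] using MeasurePreserving.id (ν.prod ν)
      · simpa [h] using Measure.measurePreserving_swap (μ := ν) (ν := ν)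
    convert harr.comp h1 using 1
    ext w j <;> by_cases h : σ j <;> simp [hT, h, MeasurableEquiv.arrowProdEquivProdArrow,
      Equiv.arrowProdEquivProdArrow]
  set B := excessSet 𝒟 α β l with hB
  -- Every swap pattern preserves the product law, so averaging over all patterns turns the
  -- probability into a count of signs for fixed pairs.
  have hpre : ∀ σ, ((Measure.pi fun _ => ν).prod (Measure.pi fun _ => ν)) B
      = ∫⁻ w, (T σ ⁻¹' B).indicator 1 w ∂μ' := by
    intro σ
    rw [lintegral_indicator_one₀ (hnull.preimage (hTm σ).quasiMeasurePreserving),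
      (hTm σ).measure_preimage hnull]
  have hsum : (2 : ℝ≥0∞) ^ l * ((Measure.pi fun _ => ν).prod (Measure.pi fun _ => ν)) B
      = ∫⁻ w, ∑ σ, (T σ ⁻¹' B).indicator 1 w ∂μ' := by
    rw [lintegral_finsetSum']
    · simp_rw [← hpre]
      simp
    · intro σ _
      exact aemeasurable_one.indicator₀ (hnull.preimage (hTm σ).quasiMeasurePreserving)
  have hle : ∫⁻ w, ∑ σ, (T σ ⁻¹' B).indicator 1 w ∂μ' ≤
      ENNReal.ofReal (K * (2 ^ l * Real.exp (-(α * β * l / 18)))) := by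
    calc _ ≤ ∫⁻ w, ENNReal.ofReal (K * (2 ^ l * Real.exp (-(α * β * l / 18)))) ∂μ' := by
          refine lintegral_mono fun w => ?_
          refine le_trans (le_of_eq ?_) (ENNReal.ofReal_le_ofReal
            (card_swap_mem_excessSet_le 𝒟 hα hK w))
          rw [ENNReal.ofReal_natCast, Finset.card_eq_sum_ones, Finset.sum_filter, Nat.cast_sum]
          refine Finset.sum_congr rfl fun σ _ => ?_
          simp only [indicator_apply, mem_preimage, hT]
          split_ifs <;> simp_all
      _ = _ := by rw [lintegral_const]; simp
  rw [← hsum] at hle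
  have h2 : (2 : ℝ≥0∞) ^ l ≠ 0 := by simp
  have h2' : (2 : ℝ≥0∞) ^ l ≠ ⊤ := by simp
  rw [mul_left_comm, ENNReal.ofReal_mul (by positivity), ENNReal.ofReal_pow (by norm_num)] at hle
  rw [show ENNReal.ofReal 2 = 2 by simp] at hle
  exact (ENNReal.mul_le_mul_iff_right h2 h2').1 hle

/-- With R the true mass and c = (αR+β)/2, the observed frequency q is below R-2c, while Chebyshev
puts the ghost frequency q' within c of R with probability at least 1/2. Then q'-q > c, whereas
α(q+q')+β ≤ 6c; this is the origin of the factor 1/6. -/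
theorem half_le_measure_excessSet {X : Type*} [MeasurableSpace X] (ν : Measure X)
    [IsProbabilityMeasure ν] {𝒟 : Set (Set X)} {D : Set X} (hD : D ∈ 𝒟) (hDm : MeasurableSet D)
    {α β : ℝ} (hα : 0 < α) (hα1 : α ≤ 1) (hβ : 0 < β) {l : ℕ} (hl : 2 ≤ α * β * l)
    {y : Fin l → X} (hy : (1 / (l : ℝ)) * ∑ j, D.indicator 1 (y j) < (1 - α) * ν.real D - β) :
    1 / 2 ≤ (Measure.pi fun _ => ν) {y' | (y, y') ∈ excessSet 𝒟 α β l} := by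
  have hl0 : 0 < l := by
    rcases Nat.eq_zero_or_pos l with h | h
    · subst h; norm_num at hl
    · exact h
  have hl' : (0 : ℝ) < l := by exact_mod_cast hl0
  set R := ν.real D with hR
  set c := (α * R + β) / 2 with hc
  have hr0 : 0 ≤ (1 / (l : ℝ)) * ∑ j, D.indicator (1 : X → ℝ) (y j) :=
    mul_nonneg (by positivity) (Finset.sum_nonneg fun j _ => indicator_nonneg (by simp) _)
  have hR0 : 0 ≤ R := measureReal_nonneg
  have hRpos : 0 < R := by
    by_contra h
    have : R = 0 := le_antisymm (not_lt.1 h) hR0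
    rw [this] at hy; linarith
  have hcpos : 0 < c := by positivity
  have hgm : Measurable (D.indicator (1 : X → ℝ)) := measurable_one.indicator hDm
  have hch := pi_average_sub_ge_le ν (g := D.indicator 1) hgm
    (fun x => indicator_nonneg (by simp) _)
    (fun x => indicator_le_self' (by simp) x) hl0 hcpos
  rw [integral_indicator_one hDm] at hch
  have hbound : ENNReal.ofReal (R / (l * c ^ 2)) ≤ 1 / 2 := by
    rw [show (1 / 2 : ℝ≥0∞) = ENNReal.ofReal (1 / 2) by
      rw [ENNReal.ofReal_div_of_pos (by norm_num)]; simp]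
    apply ENNReal.ofReal_le_ofReal
    rw [div_le_iff₀ (by positivity)]
    -- The arithmetic-geometric mean inequality; together with αβl ≥ 2 it bounds the Chebyshev
    -- quotient R/(lc²) by 1/2.
    have h1 : α * β * R ≤ c ^ 2 := by rw [hc]; nlinarith [sq_nonneg (α * R - β)]
    have h2 : l * (α * β * R) ≤ l * c ^ 2 := by gcongr
    nlinarith
  set S := {y' : Fin l → X | c ≤ |(1 / (l : ℝ)) * ∑ j, D.indicator 1 (y' j) - R|} with hS
  have hSm : MeasurableSet S := by
    apply measurableSet_le measurable_const
    fun_prop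
  have hle : (Measure.pi fun _ => ν) S ≤ 1 / 2 := hch.trans hbound
  have hcompl : 1 / 2 ≤ (Measure.pi fun _ => ν) Sᶜ := by
    rw [prob_compl_eq_one_sub hSm]
    calc (1 / 2 : ℝ≥0∞) = 1 - 1 / 2 := by simp
      _ ≤ _ := tsub_le_tsub_left hle 1
  refine hcompl.trans (measure_mono fun y' hy' => ?_)
  simp only [hS, mem_compl_iff, mem_ofPred_eq, not_le, abs_lt] at hy'
  refine ⟨D, hD, ?_⟩
  rw [Finset.sum_add_distrib, Finset.sum_sub_distrib]
  set r := ∑ j, D.indicator (1 : X → ℝ) (y j) with hr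
  set r' := ∑ j, D.indicator (1 : X → ℝ) (y' j) with hr'
  have e1 : r = l * (1 / (l : ℝ) * r) := by field_simp
  have e2 : r' = l * (1 / (l : ℝ) * r') := by field_simp
  set q := 1 / (l : ℝ) * r
  set q' := 1 / (l : ℝ) * r'
  rw [e1, e2]
  have hq : (1 / 6) * (α * (q + q') + β) < q' - q := by
    have h1 : q < R - 2 * c := by rw [hc]; linarith
    have h2 : q' < R + c := by linarith [hy'.2]
    have h3 : R - c < q' := by linarith [hy'.1]
    have h4 : α * (q + q') ≤ α * (2 * (R + c)) := by gcongr; linarith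
    have h5 : α * (2 * c) ≤ 1 * (2 * c) := by gcongr
    have h6 : 2 * c = α * R + β := by rw [hc]; ring
    nlinarith
  nlinarith

/-! ### Graph dimension and the growth function. -/

theorem card_le_of_setShatters_of_graphDim {Y : Type u} {H : Set (ℝ → Y)} {d : ℕ}
    (hd : graphDim H = (d : ℕ∞)) {A : Finset (ℝ × Y)}
    (hA : SetShatters ((fun h : ℝ → Y => {p : ℝ × Y | p.2 = h p.1}) '' H) A) : A.card ≤ d := by
  have : (A.card : ℕ∞) ≤ graphDim H := by
    unfold graphDim setVCDim
    exact le_iSup₂_of_le A hA le_rfl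
  rw [hd] at this
  exact_mod_cast this

/-- The sets on which members of `H` disagree with `f`. -/
def disagreementSets {Y : Type u} (H : Set (ℝ → Y)) (f : ℝ → Y) : Set (Set ℝ) :=
  (fun h : ℝ → Y => {x | h x ≠ f x}) '' H

open Classical in
-- A member disagrees with f at x exactly when (x, f x) is off its graph. Traces of disagreement
-- sets are thus complements of graph traces on the points (z j, f (z j)); complementation preserves
-- shattering, and the Sauer–Shelah lemma applies.
theorem ncard_traceSet_le {Y : Type u} {H : Set (ℝ → Y)} {d : ℕ}
    (hd : graphDim H = (d : ℕ∞)) (f : ℝ → Y) {n : ℕ} (z : Fin n → ℝ) :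
    (traceSet (disagreementSets H f) z).ncard ≤ ∑ i ∈ Finset.Iic d, n.choose i := by
  rw [Set.ncard_eq_toFinset_card']
  set 𝒜 := (traceSet (disagreementSets H f) z).toFinset with h𝒜
  have hmem : ∀ J, J ∈ 𝒜 ↔ ∃ h ∈ H, ∀ j, h (z j) ≠ f (z j) ↔ j ∈ J := by
    intro J
    rw [h𝒜, mem_toFinset]
    simp only [traceSet, disagreementSets, mem_ofPred_eq, exists_mem_image]
  have hvc : 𝒜.vcDim ≤ d := by
    refine Finset.sup_le fun s hs => ?_
    rw [Finset.mem_shatterer] at hs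
    -- Coinciding sample points always lie in the same traces, so a shattered index set contains no
    -- repetition.
    have hinj : Set.InjOn (fun j => (z j, f (z j))) (s : Set (Fin n)) := by
      intro j hj j' hj' e
      by_contra hne
      obtain ⟨u, hu, hus⟩ := hs (t := {j}) (by simpa using hj)
      obtain ⟨h, -, hh⟩ := (hmem u).1 hu
      have h1 : j ∈ u := by
        have : j ∈ s ∩ u := by rw [hus]; simp
        exact (Finset.mem_inter.1 this).2
      have h2 : j' ∉ u := by
        intro h3
        have : j' ∈ s ∩ u := Finset.mem_inter.2 ⟨hj', h3⟩
        rw [hus, Finset.mem_singleton] at this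
        exact hne this.symm
      simp only [Prod.mk.injEq] at e
      rw [← hh] at h1 h2
      rw [e.1] at h1
      exact h2 h1
    rw [← Finset.card_image_of_injOn hinj]
    apply card_le_of_setShatters_of_graphDim hd
    intro B hB
    obtain ⟨u, hu, hus⟩ := hs (t := s.filter fun j => (z j, f (z j)) ∉ B) (Finset.filter_subset _ _)
    obtain ⟨h, hhH, hh⟩ := (hmem u).1 hu
    refine ⟨_, ⟨h, hhH, rfl⟩, ?_⟩
    have key : ∀ j ∈ s, (f (z j) = h (z j) ↔ (z j, f (z j)) ∈ B) := by
      intro j hj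
      have h1 : j ∈ u ↔ (z j, f (z j)) ∉ B := by
        have : j ∈ s ∩ u ↔ j ∈ s.filter fun j => (z j, f (z j)) ∉ B := by rw [hus]
        simpa [hj] using this
      have h2 := hh j
      rw [h1] at h2
      rw [eq_comm]
      exact not_iff_not.1 h2
    ext p
    simp only [Finset.coe_image, mem_inter_iff, mem_ofPred_eq, mem_image, Finset.mem_coe]
    constructor
    · rintro ⟨h1, j, hj, rfl⟩
      exact (key j hj).1 h1
    · intro hp
      have := hB hp
      simp only [Finset.coe_image, mem_image, Finset.mem_coe] at this
      obtain ⟨j, hj, rfl⟩ := this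
      exact ⟨(key j hj).2 hp, j, hj, rfl⟩
  calc 𝒜.card ≤ 𝒜.shatterer.card := 𝒜.card_le_card_shatterer
    _ ≤ ∑ i ∈ Finset.Iic 𝒜.vcDim, (Fintype.card (Fin n)).choose i :=
        Finset.card_shatterer_le_sum_vcDim
    _ ≤ ∑ i ∈ Finset.Iic d, n.choose i := by
        rw [Fintype.card_fin]
        exact Finset.sum_le_sum_of_subset (Finset.Iic_subset_Iic.2 hvc)

/-- For i ≤ d one has (d/n)^d ≤ (d/n)^i, so the sum weighted by (d/n)^d is bounded by the binomial
expansion of (1+d/n)^n ≤ e^d. -/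
theorem sum_choose_le_pow {n d : ℕ} (hd : 0 < d) (hdn : d ≤ n) :
    ((∑ i ∈ Finset.Iic d, n.choose i : ℕ) : ℝ) ≤ (Real.exp 1 * n / d) ^ d := by
  have hd' : (0 : ℝ) < d := by exact_mod_cast hd
  have hdn' : (d : ℝ) ≤ n := by exact_mod_cast hdn
  have hn' : (0 : ℝ) < n := hd'.trans_le hdn'
  have hq0 : (0 : ℝ) < d / n := by positivity
  have hq1 : (d : ℝ) / n ≤ 1 := by rw [div_le_one hn']; exact hdn'
  have h1 : ((∑ i ∈ Finset.Iic d, n.choose i : ℕ) : ℝ) * (d / n : ℝ) ^ d ≤ Real.exp d := by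
    calc ((∑ i ∈ Finset.Iic d, n.choose i : ℕ) : ℝ) * (d / n : ℝ) ^ d
        = ∑ i ∈ Finset.Iic d, (n.choose i : ℝ) * (d / n : ℝ) ^ d := by
          push_cast; rw [Finset.sum_mul]
      _ ≤ ∑ i ∈ Finset.Iic d, (d / n : ℝ) ^ i * (n.choose i : ℝ) := by
          refine Finset.sum_le_sum fun i hi => ?_
          rw [mul_comm]
          have := pow_le_pow_of_le_one hq0.le hq1 (Finset.mem_Iic.1 hi)
          gcongr
      _ ≤ ∑ i ∈ Finset.range (n + 1), (d / n : ℝ) ^ i * (n.choose i : ℝ) := by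
          refine Finset.sum_le_sum_of_subset_of_nonneg ?_ fun i _ _ => by positivity
          intro i hi
          simp only [Finset.mem_Iic, Finset.mem_range] at hi ⊢
          omega
      _ = (d / n + 1 : ℝ) ^ n := by rw [add_pow]; simp
      _ ≤ (Real.exp (d / n)) ^ n := by
          gcongr
          exact Real.add_one_le_exp _
      _ = Real.exp d := by
          rw [← Real.exp_nat_mul]; congr 1; field_simp
  have h2 : (Real.exp 1 * n / d) ^ d * (d / n : ℝ) ^ d = Real.exp d := by
    rw [← mul_pow, ← Real.exp_one_pow]
    congr 1
    field_simp
  exact le_of_mul_le_mul_right (h1.trans h2.ge) (by positivity)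

/-! ### The uniform law and its restriction near a centre. -/

instance isProbabilityMeasure_uniform01 : IsProbabilityMeasure uniform01 :=
  ⟨by simp [uniform01]⟩

/-- The half of the interval that points from x towards 1/2 stays inside the unit interval. -/
theorem ofReal_le_uniform01_Ioo {δ x : ℝ} (hδ : δ ≤ 1 / 2) (hx : x ∈ Icc (0 : ℝ) 1) :
    ENNReal.ofReal δ ≤ uniform01 (Ioo (x - δ) (x + δ)) := by
  rw [uniform01, Measure.restrict_apply measurableSet_Ioo]
  rcases le_total x (1 / 2) with h | h
  · calc ENNReal.ofReal δ = volume (Ioo x (x + δ)) := by rw [Real.volume_Ioo]; congr 1; ring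
      _ ≤ _ := measure_mono fun w hw => by
        obtain ⟨h1, h2⟩ := hw
        exact ⟨⟨by linarith [hx.1], h2⟩, by linarith [hx.1], by linarith⟩
  · calc ENNReal.ofReal δ = volume (Ioo (x - δ) x) := by rw [Real.volume_Ioo]; congr 1; ring
      _ ≤ _ := measure_mono fun w hw => by
        obtain ⟨h1, h2⟩ := hw
        exact ⟨⟨h1, by linarith⟩, by linarith, by linarith [hx.2]⟩

/-- The law of a uniform point of `(0,1)`, given that it lies within `δ` of `x`. -/
def nearLaw (δ x : ℝ) : Measure ℝ := ProbabilityTheory.cond uniform01 (Ioo (x - δ) (x + δ))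

theorem isProbabilityMeasure_nearLaw {δ x : ℝ} (hδ0 : 0 < δ) (hδ : δ ≤ 1 / 2)
    (hx : x ∈ Icc (0 : ℝ) 1) : IsProbabilityMeasure (nearLaw δ x) := by
  apply ProbabilityTheory.cond_isProbabilityMeasure
  have := ofReal_le_uniform01_Ioo hδ hx
  intro h
  rw [h] at this
  simp at this
  linarith

theorem nearLaw_absolutelyContinuous (δ x : ℝ) : nearLaw δ x ≪ volume :=
  (ProbabilityTheory.cond_absolutelyContinuous).trans Measure.absolutelyContinuous_restrict

theorem nearLaw_real_of_mem {δ x : ℝ} (hx : x ∈ Icc δ (1 - δ)) {S : Set ℝ} :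
    (nearLaw δ x).real S = volume.real (S ∩ Ioo (x - δ) (x + δ)) / (2 * δ) := by
  have hsub : Ioo (x - δ) (x + δ) ⊆ Icc 0 1 := fun w hw =>
    ⟨by linarith [hw.1, hx.1], by linarith [hw.2, hx.2]⟩
  have e : uniform01.real (Ioo (x - δ) (x + δ)) = max (2 * δ) 0 := by
    rw [uniform01, measureReal_restrict_apply measurableSet_Ioo, inter_eq_left.2 hsub,
      Real.volume_real_Ioo]
    congr 1; ring
  rw [nearLaw, measureReal_def, ProbabilityTheory.cond_apply measurableSet_Ioo, ENNReal.toReal_mul,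
    ENNReal.toReal_inv, ← measureReal_def, ← measureReal_def, e, inter_comm, uniform01,
    measureReal_restrict_apply' measurableSet_Icc, inter_assoc, inter_eq_left.2 hsub]
  rcases le_total 0 (2 * δ) with h | h
  · rw [max_eq_left h]; field_simp
  · have : Ioo (x - δ) (x + δ) = ∅ := Ioo_eq_empty (by linarith)
    simp [this]

/-! ### The first sample points near a centre. -/

open Classical in
/-- The indices of the points of `y` within `δ` of `c`. -/
def nearIndices {N : ℕ} (δ c : ℝ) (y : Fin N → ℝ) : Finset (Fin N) :=
  Finset.univ.filter fun t => y t ∈ Ioo (c - δ) (c + δ)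

theorem nearIndices_eq_iff {N : ℕ} {δ c : ℝ} {y : Fin N → ℝ} {S : Finset (Fin N)} :
    nearIndices δ c y = S ↔ ∀ t, y t ∈ Ioo (c - δ) (c + δ) ↔ t ∈ S := by
  simp [Finset.ext_iff, nearIndices]

theorem measurableSet_nearIndices_eq {N : ℕ} (δ : ℝ) (S : Finset (Fin N)) :
    MeasurableSet {p : ℝ × (Fin N → ℝ) | nearIndices δ p.1 p.2 = S} := by
  simp only [nearIndices_eq_iff, ofPred_forall]
  refine MeasurableSet.iInter fun t => ?_
  refine MeasurableSet.iff ?_ (MeasurableSet.const _)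
  have h1 : MeasurableSet {p : ℝ × (Fin N → ℝ) | p.1 - δ < p.2 t} :=
    measurableSet_lt (by fun_prop) (by fun_prop)
  have h2 : MeasurableSet {p : ℝ × (Fin N → ℝ) | p.2 t < p.1 + δ} :=
    measurableSet_lt (by fun_prop) (by fun_prop)
  exact h1.inter h2

open Classical in
/-- Apply `g` to the first `l` points of `y` within `δ` of `c`, if there are so many. -/
def onFirstNear {N l : ℕ} (δ : ℝ) (g : ℝ × (Fin l → ℝ) → ℝ≥0∞) (p : ℝ × (Fin N → ℝ)) : ℝ≥0∞ :=
  if h : l ≤ (nearIndices δ p.1 p.2).card then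
    g (p.1, p.2 ∘ (nearIndices δ p.1 p.2).orderEmbOfCardLe h) else 0

open Classical in
theorem onFirstNear_eq_sum {N l : ℕ} (δ : ℝ) (g : ℝ × (Fin l → ℝ) → ℝ≥0∞)
    (p : ℝ × (Fin N → ℝ)) :
    onFirstNear δ g p = ∑ S : Finset (Fin N), {p : ℝ × (Fin N → ℝ) | nearIndices δ p.1 p.2 = S}.indicator
      (fun p => if h : l ≤ S.card then g (p.1, p.2 ∘ S.orderEmbOfCardLe h) else 0) p := by
  rw [Finset.sum_eq_single (nearIndices δ p.1 p.2)]
  · rw [indicator_of_mem (by simp)]; rfl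
  · intro S _ hS
    rw [indicator_of_notMem]
    simpa using hS.symm
  · simp

open Classical in
theorem measurable_onFirstNear_summand {N l : ℕ} (δ : ℝ) {g : ℝ × (Fin l → ℝ) → ℝ≥0∞}
    (hg : Measurable g) (S : Finset (Fin N)) :
    Measurable ({p : ℝ × (Fin N → ℝ) | nearIndices δ p.1 p.2 = S}.indicator
      (fun p => if h : l ≤ S.card then g (p.1, p.2 ∘ S.orderEmbOfCardLe h) else 0)) := by
  refine Measurable.indicator ?_ (measurableSet_nearIndices_eq δ S)
  split_ifs with h
  · refine hg.comp (Measurable.prodMk measurable_fst ?_)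
    refine measurable_pi_lambda _ fun j => ?_
    exact (measurable_pi_apply _).comp measurable_snd
  · exact measurable_const

theorem measurable_onFirstNear {N l : ℕ} (δ : ℝ) {g : ℝ × (Fin l → ℝ) → ℝ≥0∞}
    (hg : Measurable g) : Measurable (onFirstNear (N := N) δ g) := by
  classical
  have : onFirstNear (N := N) δ g = fun p => ∑ S : Finset (Fin N),
      {p : ℝ × (Fin N → ℝ) | nearIndices δ p.1 p.2 = S}.indicator
      (fun p => if h : l ≤ S.card then g (p.1, p.2 ∘ S.orderEmbOfCardLe h) else 0) p :=
    funext fun p => onFirstNear_eq_sum δ g p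
  rw [this]
  exact Finset.measurable_fun_sum _ fun S _ => measurable_onFirstNear_summand δ hg S

/-- The event that the near indices form exactly `S` is a rectangle, on which the first `l` near
indices are fixed; these coordinates are then iid with the near law. Summing over `S` gives an
inequality because samples with fewer than `l` hits contribute 0. -/
theorem lintegral_onFirstNear_le {N l : ℕ} (hl : 0 < l) (δ c : ℝ)
    {g : ℝ × (Fin l → ℝ) → ℝ≥0∞} (hg : Measurable g) :
    ∫⁻ y : Fin N → ℝ, onFirstNear δ g (c, y) ∂(Measure.pi fun _ => uniform01)
      ≤ ∫⁻ z, g (c, z) ∂(Measure.pi fun _ => nearLaw δ c) := by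
  classical
  have hsec : ∀ S : Finset (Fin N), MeasurableSet {y : Fin N → ℝ | nearIndices δ c y = S} :=
    fun S => (measurableSet_nearIndices_eq δ S).preimage measurable_prodMk_left
  have hgc : Measurable fun z => g (c, z) := hg.comp measurable_prodMk_left
  set μN : Measure (Fin N → ℝ) := Measure.pi fun _ => uniform01 with hμN
  simp_rw [onFirstNear_eq_sum]
  rw [lintegral_finsetSum]
  swap
  · intro S _
    exact (measurable_onFirstNear_summand δ hg S).comp measurable_prodMk_left
  have hS : ∀ S : Finset (Fin N), ∫⁻ y, {p : ℝ × (Fin N → ℝ) | nearIndices δ p.1 p.2 = S}.indicator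
      (fun p => if h : l ≤ S.card then g (p.1, p.2 ∘ S.orderEmbOfCardLe h) else 0) (c, y) ∂μN
      ≤ μN {y | nearIndices δ c y = S} * ∫⁻ z, g (c, z) ∂(Measure.pi fun _ => nearLaw δ c) := by
    intro S
    have e : ∀ y : Fin N → ℝ, {p : ℝ × (Fin N → ℝ) | nearIndices δ p.1 p.2 = S}.indicator
      (fun p => if h : l ≤ S.card then g (p.1, p.2 ∘ S.orderEmbOfCardLe h) else 0) (c, y)
      = {y : Fin N → ℝ | nearIndices δ c y = S}.indicator
      (fun y => if h : l ≤ S.card then g (c, y ∘ S.orderEmbOfCardLe h) else 0) y := by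
      intro y
      simp only [indicator_apply, mem_ofPred_eq]
    simp_rw [e]
    rw [lintegral_indicator (hsec S)]
    split_ifs with h
    · have hrect : {y : Fin N → ℝ | nearIndices δ c y = S} = univ.pi fun t =>
          if t ∈ S then Ioo (c - δ) (c + δ) else (Ioo (c - δ) (c + δ))ᶜ := by
        ext y
        simp only [mem_ofPred_eq, nearIndices_eq_iff, mem_univ_pi]
        refine forall_congr' fun t => ?_
        split_ifs with ht <;> simp [ht]
      rw [hrect]
      refine le_of_eq (setLIntegral_pi_comp_embedding uniform01 hl ?_
        (S.orderEmbOfCardLe h).injective ?_ hgc)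
      · intro t
        split_ifs
        · exact measurableSet_Ioo
        · exact measurableSet_Ioo.compl
      · intro j
        rw [if_pos (Finset.orderEmbOfCardLe_mem S h j)]
    · simp
  refine (Finset.sum_le_sum fun S _ => hS S).trans ?_
  rw [← Finset.sum_mul]
  have : ∑ S : Finset (Fin N), μN {y | nearIndices δ c y = S} ≤ 1 := by
    rw [← measure_biUnion_finset (fun S _ S' _ hne => ?_) fun S _ => hsec S]
    · exact prob_le_one
    · rw [Function.onFun, Set.disjoint_left]
      intro y hy hy'
      exact hne (hy.symm.trans hy')
  calc _ ≤ 1 * ∫⁻ z, g (c, z) ∂(Measure.pi fun _ => nearLaw δ c) := by gcongr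
    _ = _ := one_mul _

/-- Markov's inequality for 2^(-count), whose mean is at most exp(-Nδ/2). The price 2^l is
affordable because l ≤ Nδ/2 and log 2 < 3/4. -/
theorem measure_card_nearIndices_lt_le {N l : ℕ} {δ c : ℝ} (hδ0 : 0 < δ) (hδ : δ ≤ 1 / 2)
    (hc : c ∈ Icc (0 : ℝ) 1) (hN : 2 * (l : ℝ) ≤ N * δ) :
    (Measure.pi fun _ => uniform01) {y : Fin N → ℝ | (nearIndices δ c y).card < l}
      ≤ ENNReal.ofReal (Real.exp (-(N * δ / 8))) := by
  classical
  set I := Ioo (c - δ) (c + δ) with hI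
  set φ : ℝ → ℝ := fun w => 1 - I.indicator (fun _ => (1 / 2 : ℝ)) w with hφ
  have hφ2 : ∀ w, φ w = if w ∈ I then 1 / 2 else 1 := by
    intro w; simp only [hφ, indicator_apply]; split_ifs <;> norm_num
  have hφm : Measurable φ := measurable_const.sub (measurable_const.indicator measurableSet_Ioo)
  have hprod : ∀ y : Fin N → ℝ, ∏ t, φ (y t) = (1 / 2 : ℝ) ^ (nearIndices δ c y).card := by
    intro y
    simp_rw [hφ2]
    rw [Finset.prod_ite]
    simp [nearIndices, hI]
  have hq : δ ≤ uniform01.real I := by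
    have := ofReal_le_uniform01_Ioo hδ hc
    rw [measureReal_def]
    exact (ENNReal.ofReal_le_iff_le_toReal (measure_ne_top _ _)).1 this
  have hint : ∫ w, φ w ∂uniform01 = 1 - uniform01.real I / 2 := by
    rw [hφ, integral_sub (integrable_const _)
      ((integrable_const _).indicator measurableSet_Ioo), integral_indicator measurableSet_Ioo]
    simp; ring
  have hq1 : uniform01.real I ≤ 1 := measureReal_le_one
  have hE : ∫ y : Fin N → ℝ, (1 / 2 : ℝ) ^ (nearIndices δ c y).card
      ∂(Measure.pi fun _ => uniform01) ≤ Real.exp (-(N * δ / 2)) := by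
    simp_rw [← hprod]
    rw [integral_fintype_prod_eq_prod (fun _ => φ), hint, Finset.prod_const, Finset.card_univ,
      Fintype.card_fin]
    calc (1 - uniform01.real I / 2) ^ N ≤ (Real.exp (-(δ / 2))) ^ N := by
          apply pow_le_pow_left₀ (by linarith)
          have := Real.add_one_le_exp (-(δ / 2))
          linarith
      _ = _ := by rw [← Real.exp_nat_mul]; congr 1; ring
  have hbd : Integrable (fun y : Fin N → ℝ => (1 / 2 : ℝ) ^ (nearIndices δ c y).card)
      (Measure.pi fun _ => uniform01) := by
    simp_rw [← hprod]
    refine Integrable.of_bound (Measurable.aestronglyMeasurable ?_) 1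
      (Filter.Eventually.of_forall fun y => ?_)
    · exact Finset.measurable_fun_prod _ fun t _ => hφm.comp (measurable_pi_apply t)
    · rw [hprod, Real.norm_of_nonneg (by positivity)]
      exact pow_le_one₀ (by norm_num) (by norm_num)
  have hM := mul_meas_ge_le_integral_of_nonneg (μ := Measure.pi fun _ : Fin N => uniform01)
    (Filter.Eventually.of_forall fun y => by positivity) hbd ((1 / 2 : ℝ) ^ l)
  have hM2 := hM.trans hE
  set E := {y : Fin N → ℝ | (1 / 2 : ℝ) ^ l ≤ (1 / 2 : ℝ) ^ (nearIndices δ c y).card} with hEdef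
  have hsub : {y : Fin N → ℝ | (nearIndices δ c y).card < l} ⊆ E := by
    intro y hy
    exact pow_le_pow_of_le_one (a := (1 / 2 : ℝ)) (by norm_num) (by norm_num) (le_of_lt hy)
  refine (measure_mono hsub).trans ?_
  rw [← ENNReal.ofReal_toReal (measure_ne_top _ E), ← measureReal_def]
  apply ENNReal.ofReal_le_ofReal
  have h2 : (Measure.pi fun _ => uniform01).real E ≤ 2 ^ l * Real.exp (-(N * δ / 2)) := by
    have : (2 : ℝ) ^ l * ((1 / 2 : ℝ) ^ l * (Measure.pi fun _ => uniform01).real E)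
        ≤ 2 ^ l * Real.exp (-(N * δ / 2)) := by gcongr
    rwa [← mul_assoc, ← mul_pow, show (2 : ℝ) * (1 / 2) = 1 by norm_num, one_pow, one_mul] at this
  refine h2.trans ?_
  have e2 : (2 : ℝ) ^ l = Real.exp (l * Real.log 2) := by
    rw [Real.exp_nat_mul, Real.exp_log (by norm_num)]
  rw [e2, ← Real.exp_add, Real.exp_le_exp]
  have := Real.log_two_lt_d9
  have hl0 : (0 : ℝ) ≤ l := by positivity
  have := mul_le_mul_of_nonneg_left this.le hl0
  nlinarith

/-! ### Uniform lower deviations near a centre. -/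

theorem nullMeasurableSet_traceSet {Y : Type u} [MeasurableSpace Y] {H : Set (ℝ → Y)}
    (hH : EmpiricallyMeasurable H) {f : ℝ → Y} (hf : Measurable f) {n : ℕ}
    (J : Finset (Fin n)) :
    NullMeasurableSet {z | J ∈ traceSet (disagreementSets H f) z} volume := by
  -- The measurability convention records agreement and the traces record disagreement, hence the
  -- complement.
  have := hH f hf n (J : Set (Fin n))ᶜ
  convert this using 1
  ext z
  simp only [traceSet, disagreementSets, mem_ofPred_eq, exists_mem_image]
  refine exists_congr fun h => and_congr_right fun _ => forall_congr' fun j => ?_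
  simp only [mem_compl_iff, Finset.mem_coe]
  tauto

theorem pi_absolutelyContinuous {X : Type*} [MeasurableSpace X] {μ ν : Measure X}
    [SigmaFinite ν] [SigmaFinite μ] (h : ν ≪ μ) (n : ℕ) :
    Measure.pi (fun _ : Fin n => ν) ≪ Measure.pi (fun _ : Fin n => μ) := by
  induction n with
  | zero => rw [Measure.pi_of_empty, Measure.pi_of_empty]
  | succ n ih =>
    rw [← (measurePreserving_piFinSuccAbove (fun _ : Fin (n + 1) => ν) 0).symm.map_eq,
      ← (measurePreserving_piFinSuccAbove (fun _ : Fin (n + 1) => μ) 0).symm.map_eq]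
    exact (h.prod ih).map (MeasurableEquiv.measurable _)

/-- Outside an exceptional set of small conditional probability, the empirical disagreement with
`f` of every member of `H` is at least about its true value. -/
theorem exists_exceptionalSet {Y : Type u} [MeasurableSpace Y] [MeasurableEq Y] {H : Set (ℝ → Y)}
    (hHm : ∀ h ∈ H, Measurable h) (hH : EmpiricallyMeasurable H) {f : ℝ → Y} (hf : Measurable f)
    {d : ℕ} (hd : graphDim H = (d : ℕ∞)) {δ α β : ℝ} (hδ0 : 0 < δ) (hδ : δ ≤ 1 / 2)
    (hα : 0 < α) (hα1 : α ≤ 1) (hβ : 0 < β) {l : ℕ} (hl : 2 ≤ α * β * l) :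
    ∃ E : Set (ℝ × (Fin l → ℝ)), MeasurableSet E ∧
      (∀ x ∈ Icc (0 : ℝ) 1, ∀ y, (x, y) ∉ E → ∀ h ∈ H,
        (1 - α) * (nearLaw δ x).real {w | h w ≠ f w} - β ≤
          (1 / (l : ℝ)) * ∑ j, {w | h w ≠ f w}.indicator (1 : ℝ → ℝ) (y j)) ∧
      ∀ x ∈ Icc (0 : ℝ) 1, (Measure.pi fun _ => nearLaw δ x) {y | (x, y) ∈ E} ≤
        ENNReal.ofReal (2 * ((∑ i ∈ Finset.Iic d, (l + l).choose i : ℕ) *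
          Real.exp (-(α * β * l / 18)))) := by
  have hl0 : 0 < l := by
    rcases Nat.eq_zero_or_pos l with h | h
    · subst h; norm_num at hl
    · exact h
  set 𝒟 := disagreementSets H f with h𝒟
  have h𝒟m : ∀ D ∈ 𝒟, MeasurableSet D := by
    rintro D ⟨h, hh, rfl⟩
    exact (measurableSet_eq_fun (hHm h hh) hf).compl
  set V : Measure ((Fin l → ℝ) × (Fin l → ℝ)) :=
    (Measure.pi fun _ => volume).prod (Measure.pi fun _ => volume) with hV
  set B := excessSet 𝒟 α β l with hB
  have hBnull : NullMeasurableSet B V := nullMeasurableSet_excessSet volume 𝒟 α β l fun J =>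
    nullMeasurableSet_traceSet hH hf J
  -- A single measurable hull, taken for Lebesgue measure, serves all centres at once, since every
  -- near law is absolutely continuous.
  set B' := toMeasurable V B with hB'
  have hB'm : MeasurableSet B' := measurableSet_toMeasurable _ _
  have hBB' : B ⊆ B' := subset_toMeasurable _ _
  have hae : B' =ᵐ[V] B := hBnull.toMeasurable_ae_eq
  set I : ℝ → Set ℝ := fun x => Ioo (x - δ) (x + δ) with hI
  set W : Set ((ℝ × (Fin l → ℝ)) × (Fin l → ℝ)) :=
    {q | (∀ j, q.2 j ∈ I q.1.1) ∧ (q.1.2, q.2) ∈ B'} with hW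
  set W₀ : Set (ℝ × (Fin l → ℝ)) := {q | ∀ j, q.2 j ∈ I q.1} with hW₀
  have hW₀m : MeasurableSet W₀ := by
    simp only [hW₀, hI, mem_Ioo, ofPred_forall]
    refine MeasurableSet.iInter fun j => ?_
    have h1 : MeasurableSet {p : ℝ × (Fin l → ℝ) | p.1 - δ < p.2 j} :=
      measurableSet_lt (by fun_prop) (by fun_prop)
    have h2 : MeasurableSet {p : ℝ × (Fin l → ℝ) | p.2 j < p.1 + δ} :=
      measurableSet_lt (by fun_prop) (by fun_prop)
    exact h1.inter h2
  have hWm : MeasurableSet W := by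
    have h1 : MeasurableSet {q : (ℝ × (Fin l → ℝ)) × (Fin l → ℝ) | (q.1.1, q.2) ∈ W₀} :=
      hW₀m.preimage (by fun_prop)
    have h2 : MeasurableSet {q : (ℝ × (Fin l → ℝ)) × (Fin l → ℝ) | (q.1.2, q.2) ∈ B'} :=
      hB'm.preimage (by fun_prop)
    exact h1.inter h2
  set μl : Measure (Fin l → ℝ) := Measure.pi fun _ => uniform01 with hμl
  have hsec : ∀ x ∈ Icc (0 : ℝ) 1, ∀ y : Fin l → ℝ,
      μl {y' | (x, y') ∈ W₀} ≠ 0 ∧ μl {y' | ((x, y), y') ∈ W} = μl {y' | (x, y') ∈ W₀} *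
        (Measure.pi fun _ => nearLaw δ x) {y' | (y, y') ∈ B'} := by
    intro x hx y
    have hpi : {y' : Fin l → ℝ | (x, y') ∈ W₀} = univ.pi fun _ => I x := by
      ext y'; simp [hW₀]
    constructor
    · rw [hpi, hμl, Measure.pi_pi, Finset.prod_const]
      apply pow_ne_zero
      have := ofReal_le_uniform01_Ioo hδ hx
      intro h
      rw [hI] at h
      simp only [h] at this
      simp at this
      linarith
    · have hBy : MeasurableSet {y' : Fin l → ℝ | (y, y') ∈ B'} :=
        hB'm.preimage measurable_prodMk_left
      have := setLIntegral_pi_comp_embedding uniform01 hl0 (A := fun _ : Fin l => I x)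
        (fun _ => measurableSet_Ioo) (I := I x) (s := id) Function.injective_id (fun _ => rfl)
        (g := {y' : Fin l → ℝ | (y, y') ∈ B'}.indicator 1) (measurable_one.indicator hBy)
      simp only [Function.comp_id] at this
      rw [lintegral_indicator_one hBy, lintegral_indicator_one hBy,
        Measure.restrict_apply hBy, ← hpi] at this
      rw [nearLaw, ← this]
      congr 1
      ext y'
      simp only [hW, hW₀, mem_ofPred_eq, mem_inter_iff]
      tauto
  -- A pair (x, y) is exceptional if a ghost sample near x lands in `B'` together with y with
  -- conditional probability at least 1/2. Writing this through the unconditioned uniform law,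
  -- without division, makes it jointly measurable in (x, y), and no union over `H` has to be
  -- measured.
  refine ⟨{q | μl {y' | (q.1, y') ∈ W₀} * (1 / 2) ≤ μl {y' | (q, y') ∈ W}}, ?_, ?_, ?_⟩
  · refine measurableSet_le ?_ (measurable_measure_prodMk_left hWm)
    exact ((measurable_measure_prodMk_left hW₀m).comp measurable_fst).mul_const _
  · intro x hx y hy h hh
    have := isProbabilityMeasure_nearLaw hδ0 hδ hx
    by_contra hlt
    rw [not_le] at hlt
    apply hy
    simp only [mem_ofPred_eq]
    rw [(hsec x hx y).2]
    gcongr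
    have hD : {w | h w ≠ f w} ∈ 𝒟 := ⟨h, hh, rfl⟩
    exact (half_le_measure_excessSet (nearLaw δ x) hD (h𝒟m _ hD) hα hα1 hβ hl hlt).trans
      (measure_mono fun y' hy' => hBB' hy')
  · intro x hx
    have := isProbabilityMeasure_nearLaw hδ0 hδ hx
    have hac : Measure.pi (fun _ : Fin l => nearLaw δ x) ≪ Measure.pi (fun _ => volume) :=
      pi_absolutelyContinuous (nearLaw_absolutelyContinuous δ x) l
    have hac2 : (Measure.pi fun _ : Fin l => nearLaw δ x).prod
        (Measure.pi fun _ : Fin l => nearLaw δ x) ≪ V := hac.prod hac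
    have hE : {y : Fin l → ℝ | (x, y) ∈ {q : ℝ × (Fin l → ℝ) |
        μl {y' | (q.1, y') ∈ W₀} * (1 / 2) ≤ μl {y' | (q, y') ∈ W}}} =
        {y | 1 / 2 ≤ (Measure.pi fun _ => nearLaw δ x) {y' | (y, y') ∈ B'}} := by
      ext y
      simp only [mem_ofPred_eq]
      rw [(hsec x hx y).2, ENNReal.mul_le_mul_iff_right (hsec x hx y).1 (measure_ne_top _ _)]
    rw [hE]
    -- Markov's inequality at level 1/2; it produces the factor 2 in the final bound.
    have hM := mul_meas_ge_le_lintegral (μ := Measure.pi fun _ : Fin l => nearLaw δ x)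
      (measurable_measure_prodMk_left (ν := Measure.pi fun _ : Fin l => nearLaw δ x) hB'm) (1 / 2)
    have hprod : ∫⁻ y, (Measure.pi fun _ : Fin l => nearLaw δ x) (Prod.mk y ⁻¹' B')
        ∂(Measure.pi fun _ : Fin l => nearLaw δ x) ≤
        ENNReal.ofReal ((∑ i ∈ Finset.Iic d, (l + l).choose i : ℕ) *
          Real.exp (-(α * β * l / 18))) := by
      rw [← Measure.prod_apply hB'm, measure_congr (hac2.ae_eq hae)]
      refine measure_excessSet_le (nearLaw δ x) 𝒟 hα.le (fun J => ?_)
        (fun z => ncard_traceSet_le hd f z)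
      exact (nullMeasurableSet_traceSet hH hf J).mono_ac
        (pi_absolutelyContinuous (nearLaw_absolutelyContinuous δ x) (l + l))
    have h3 := hM.trans hprod
    rw [ENNReal.ofReal_mul (by norm_num)]
    calc (Measure.pi fun _ => nearLaw δ x)
          {y | 1 / 2 ≤ (Measure.pi fun _ => nearLaw δ x) {y' | (y, y') ∈ B'}}
        = 2 * (1 / 2 * (Measure.pi fun _ => nearLaw δ x)
          {y | 1 / 2 ≤ (Measure.pi fun _ => nearLaw δ x) {y' | (y, y') ∈ B'}}) := by
          rw [← mul_assoc, one_div, ENNReal.mul_inv_cancel (by simp) (by simp), one_mul]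
      _ ≤ _ := by
          rw [show ENNReal.ofReal 2 = 2 by simp]
          gcongr
          exact h3

/-! ### Piece indices of piecewise functions. -/

open Classical in
/-- The number of breakpoints `t j` to the left of `x`. -/
def pieceIndex {n : ℕ} (t : Fin n → ℝ) (x : ℝ) : ℕ :=
  (Finset.univ.filter fun j => t j < x).card

theorem pieceIndex_le {n : ℕ} (t : Fin n → ℝ) (x : ℝ) : pieceIndex t x ≤ n := by
  classical
  exact (Finset.card_le_univ _).trans (by simp)

theorem pieceIndex_mono {n : ℕ} (t : Fin n → ℝ) : Monotone (pieceIndex t) := by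
  classical
  intro x y hxy
  refine Finset.card_le_card fun j => ?_
  simp only [Finset.mem_filter, Finset.mem_univ, true_and]
  exact fun h => h.trans_le hxy

theorem pieceIndex_eq_of_iff {n : ℕ} {t : Fin n → ℝ} {x : ℝ} {i : ℕ} (hi : i ≤ n)
    (h : ∀ j, t j < x ↔ (j : ℕ) < i) : pieceIndex t x = i := by
  classical
  unfold pieceIndex
  simp_rw [h]
  rw [Fin.card_filter_val_lt]
  exact min_eq_right hi

/-- The strict inequality in the count assigns a breakpoint to the piece on its left, as the
half-open intervals require. Repeated breakpoints only make some pieces empty, so the index remains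
single-valued. -/
theorem pieceIndex_eq_iff {n : ℕ} {t : Fin n → ℝ} (ht : Monotone t) {x : ℝ} {i : ℕ}
    (hi : i ≤ n) : pieceIndex t x = i ↔
      (∀ j : Fin n, (j : ℕ) + 1 = i → t j < x) ∧ (∀ j : Fin n, (j : ℕ) = i → x ≤ t j) := by
  classical
  constructor
  · intro h
    constructor
    · intro j hj
      by_contra hx
      rw [not_lt] at hx
      have : pieceIndex t x ≤ j := by
        unfold pieceIndex
        calc _ ≤ (Finset.univ.filter fun j' : Fin n => (j' : ℕ) < j).card := by
              refine Finset.card_le_card fun j' => ?_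
              simp only [Finset.mem_filter, Finset.mem_univ, true_and]
              intro h'
              by_contra hle
              exact absurd (ht (show j ≤ j' from not_lt.1 hle)) (not_le.2 (h'.trans_le hx))
          _ ≤ j := by rw [Fin.card_filter_val_lt]; exact min_le_right _ _
      omega
    · intro j hj
      by_contra hx
      rw [not_le] at hx
      have : (j : ℕ) + 1 ≤ pieceIndex t x := by
        unfold pieceIndex
        calc (j : ℕ) + 1 = (Finset.univ.filter fun j' : Fin n => (j' : ℕ) < j + 1).card := by
              rw [Fin.card_filter_val_lt, min_eq_right]; omega
          _ ≤ _ := by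
              refine Finset.card_le_card fun j' => ?_
              simp only [Finset.mem_filter, Finset.mem_univ, true_and]
              intro h'
              exact (ht (show j' ≤ j from Nat.lt_succ_iff.1 h')).trans_lt hx
      omega
  · rintro ⟨h1, h2⟩
    refine pieceIndex_eq_of_iff hi fun j => ⟨fun h => ?_, fun h => ?_⟩
    · by_contra hle
      rw [not_lt] at hle
      have := h2 ⟨i, hle.trans_lt j.2⟩ rfl
      exact absurd (this.trans (ht (show (⟨i, _⟩ : Fin n) ≤ j from hle))) (not_le.2 h)
    · have := h1 ⟨i - 1, by omega⟩ (by simp; omega)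
      exact (ht (show j ≤ (⟨i - 1, _⟩ : Fin n) from by
        rw [Fin.le_def]; simp; omega)).trans_lt this

theorem mem_piecewiseClass_iff {Y : Type u} {k : ℕ} {H : Set (ℝ → Y)} {f : ℝ → Y} (hk : 0 < k) :
    f ∈ piecewiseClass k H ↔ ∃ (h : Fin k → ℝ → Y) (t : Fin (k - 1) → ℝ), (∀ i, h i ∈ H) ∧
      Monotone t ∧ ∀ x, f x = h ⟨pieceIndex t x, (pieceIndex_le t x).trans_lt (by omega)⟩ x := by
  refine exists_congr fun h => exists_congr fun t => and_congr_right fun _ =>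
    and_congr_right fun ht => ⟨fun H x => ?_, fun H i x h1 h2 => ?_⟩
  · have := (pieceIndex_eq_iff ht (pieceIndex_le t x)).1 rfl
    exact H _ x this.1 this.2
  · have : (⟨pieceIndex t x, (pieceIndex_le t x).trans_lt (by omega)⟩ : Fin k) = i :=
      Fin.ext ((pieceIndex_eq_iff ht (by omega)).2 ⟨h1, h2⟩)
    rw [H x, this]

/-! ### Label changes and selection of the heaviest runs. -/

/-- Greedy choice: the lightest remaining index weighs at most the average of what remains, so the
mean weight of `R` never exceeds that of `T`. -/
theorem exists_light_subset {ι : Type*} (w : ι → ℝ) (T : Finset ι)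
    (r : ℕ) (hr : r ≤ T.card) :
    ∃ R ⊆ T, R.card = r ∧ (T.card : ℝ) * ∑ j ∈ R, w j ≤ r * ∑ j ∈ T, w j := by
  classical
  induction r with
  | zero => exact ⟨∅, by simp, by simp, by simp⟩
  | succ r ih =>
    obtain ⟨R, hRT, hRc, hR⟩ := ih (by omega)
    have hne : (T \ R).Nonempty := by
      rw [← Finset.card_pos, Finset.card_sdiff_of_subset hRT]; omega
    obtain ⟨e, he, hmin⟩ := (T \ R).exists_min_image w hne
    rw [Finset.mem_sdiff] at he
    refine ⟨insert e R, Finset.insert_subset he.1 hRT, by rw [Finset.card_insert_of_notMem he.2, hRc], ?_⟩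
    rw [Finset.sum_insert he.2]
    have h1 : ((T.card : ℝ) - r) * w e ≤ ∑ j ∈ T, w j - ∑ j ∈ R, w j := by
      have h2 := Finset.card_nsmul_le_sum (T \ R) w (w e) hmin
      rw [Finset.sum_sdiff_eq_sub hRT, Finset.card_sdiff_of_subset hRT, hRc, nsmul_eq_mul,
        Nat.cast_sub (by omega)] at h2
      exact h2
    have hlt : (r : ℝ) + 1 ≤ T.card := by exact_mod_cast hr
    have hpos : (0 : ℝ) < (T.card : ℝ) - r := by linarith
    refine le_of_mul_le_mul_left ?_ hpos
    push_cast
    have h3 := mul_le_mul_of_nonneg_left h1 (show (0 : ℝ) ≤ T.card by positivity)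
    have h4 := mul_le_mul_of_nonneg_left hR (show (0 : ℝ) ≤ T.card - r - 1 by linarith)
    nlinarith

theorem exists_heavy_finset (w : ℕ → ℝ) {n k : ℕ} (hn : 0 < n)
    (hw : ∑ j ∈ Finset.range n, w j ≤ 1) :
    ∃ S : Finset ℕ, S.card = k ∧
      ∑ j ∈ Finset.range n \ S, w j ≤ max 0 (((n : ℝ) - k) / n) := by
  rcases le_or_gt n k with h | h
  · refine ⟨Finset.range k, by simp, ?_⟩
    rw [Finset.sdiff_eq_empty_iff_subset.2 (Finset.range_subset_range.2 h)]
    simp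
  · obtain ⟨R, hR, hRc, hRw⟩ := exists_light_subset w (Finset.range n) (n - k) (by simp)
    refine ⟨Finset.range n \ R, ?_, ?_⟩
    · rw [Finset.card_sdiff_of_subset hR, hRc, Finset.card_range]; omega
    · rw [Finset.sdiff_sdiff_eq_self hR]
      refine le_max_of_le_right ?_
      rw [Finset.card_range, Nat.cast_sub h.le] at hRw
      have hn' : (0 : ℝ) < n := by exact_mod_cast hn
      have hk' : (k : ℝ) < n := by exact_mod_cast h
      rw [le_div_iff₀ hn', mul_comm]
      refine hRw.trans ?_
      have := mul_le_mul_of_nonneg_left hw (show (0 : ℝ) ≤ n - k by linarith)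
      linarith

/-- `LabelChanges U L n u`: some increasing sequence in `U` ending at `u` changes its label `n`
times. -/
def LabelChanges {Λ : Type*} (U : Set ℝ) (L : ℝ → Λ) : ℕ → ℝ → Prop
  | 0, u => u ∈ U
  | n + 1, u => u ∈ U ∧ ∃ v < u, LabelChanges U L n v ∧ L v ≠ L u

theorem LabelChanges.mem {Λ : Type*} {U : Set ℝ} {L : ℝ → Λ} {n : ℕ} {u : ℝ}
    (h : LabelChanges U L n u) : u ∈ U := by
  cases n with
  | zero => exact h
  | succ n => exact h.1

theorem LabelChanges.mul_le {Λ : Type*} {U : Set ℝ} {L : ℝ → Λ} {Φ : ℝ → ℝ} {w : ℝ}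
    (h0 : ∀ u ∈ U, 0 ≤ Φ u) (hΦ : ∀ x ∈ U, ∀ y ∈ U, x < y → L x ≠ L y → w ≤ Φ y - Φ x)
    {n : ℕ} : ∀ {u : ℝ}, LabelChanges U L n u → n * w ≤ Φ u := by
  induction n with
  | zero => intro u h; simpa using h0 u h
  | succ n ih =>
    rintro u ⟨hu, v, hvu, hv, hne⟩
    have h1 := ih hv
    have h2 := hΦ v hv.mem u hu hvu hne
    push_cast; linarith

/-- If each change of label costs at least `w` of a budget `M`, then the label is a function of a
monotone counter with at most `M / w + 1` values. -/
theorem exists_monotone_counter {Λ : Type*} {U : Set ℝ} {L : ℝ → Λ} {Φ : ℝ → ℝ} {w M : ℝ}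
    (hw : 0 < w) (h0 : ∀ u ∈ U, 0 ≤ Φ u) (hM : ∀ u ∈ U, Φ u ≤ M)
    (hΦ : ∀ x ∈ U, ∀ y ∈ U, x < y → L x ≠ L y → w ≤ Φ y - Φ x) :
    ∃ c : ℝ → ℕ, Monotone c ∧ (∀ x, c x ≤ ⌊M / w⌋₊) ∧
      ∀ u ∈ U, ∀ u' ∈ U, c u = c u' → L u = L u' := by
  classical
  set K := ⌊M / w⌋₊ with hK
  have hbound : ∀ n u, LabelChanges U L n u → n ≤ K := by
    intro n u h
    apply Nat.le_floor
    rw [le_div_iff₀ hw]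
    exact (h.mul_le h0 hΦ).trans (hM u h.mem)
  set P : ℝ → ℕ → Prop := fun x n => ∃ v ≤ x, LabelChanges U L n v with hP
  -- The counter is the greatest number of label changes along a chain in `U` ending at or before x.
  -- If it agrees at u < u', both labels equal the last label of an optimal chain for u, since
  -- otherwise that chain could be extended.
  refine ⟨fun x => Nat.findGreatest (P x) K, ?_, fun x => Nat.findGreatest_le K, ?_⟩
  · intro x y hxy
    refine Nat.findGreatest_mono_left (fun n => ?_) K
    rintro ⟨v, hv, h⟩
    exact ⟨v, hv.trans hxy, h⟩
  · have key : ∀ u ∈ U, ∀ u' ∈ U, u < u' →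
        Nat.findGreatest (P u) K = Nat.findGreatest (P u') K → L u = L u' := by
      intro u hu u' hu' hlt heq
      have hspec : P u (Nat.findGreatest (P u) K) :=
        Nat.findGreatest_spec (Nat.zero_le _) ⟨u, le_rfl, hu⟩
      set n := Nat.findGreatest (P u) K with hn
      obtain ⟨v, hvu, hv⟩ := hspec
      have hmax : ∀ x, Nat.findGreatest (P x) K = n → ¬ P x (n + 1) := by
        intro x hx hPx
        have hle : n + 1 ≤ K := by
          obtain ⟨v', _, hv'⟩ := hPx
          exact hbound _ _ hv'
        have := Nat.le_findGreatest hle hPx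
        omega
      have hLv : L v = L u := by
        by_contra hne
        have hvu' : v < u := lt_of_le_of_ne hvu fun h => hne (by rw [h])
        exact hmax u hn.symm ⟨u, le_rfl, hu, v, hvu', hv, hne⟩
      by_contra hne
      exact hmax u' heq.symm ⟨u', le_rfl, hu', v, hvu.trans_lt hlt, hv, by rwa [hLv]⟩
    intro u hu u' hu' h
    rcases lt_trichotomy u u' with hlt | rfl | hlt
    · exact key u hu u' hu' hlt h
    · rfl
    · exact (key u' hu' u hu hlt h.symm).symm

/-- If `f` follows on `U` a member of `H` that depends only on a monotone counter with at most
`K + 1` values, then `f` is close to a `k`-piecewise function. -/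
theorem exists_mem_piecewiseClass_of_counter {Y : Type u} {H : Set (ℝ → Y)} (hH : H.Nonempty)
    {f : ℝ → Y} {U : Set ℝ} (hU : MeasurableSet U) (hU01 : U ⊆ Icc 0 1) {L : ℝ → ℝ → Y}
    (hLH : ∀ u ∈ U, L u ∈ H) (hLf : ∀ u ∈ U, f u = L u u) {c : ℝ → ℕ} (hc : Monotone c) {K : ℕ}
    (hcK : ∀ x, c x ≤ K) (hcL : ∀ u ∈ U, ∀ u' ∈ U, c u = c u' → L u = L u') {k : ℕ}
    (hk : 0 < k) :
    ∃ g ∈ piecewiseClass k H, uniform01 {x | f x ≠ g x} ≤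
      uniform01 Uᶜ + ENNReal.ofReal (max 0 (((K : ℝ) + 1 - k) / (K + 1))) := by
  classical
  obtain ⟨h₀, hh₀⟩ := hH
  set V : ℕ → Set ℝ := fun j => U ∩ c ⁻¹' {j} with hV
  have hVm : ∀ j, MeasurableSet (V j) := fun j =>
    hU.inter (hc.measurable (measurableSet_singleton j))
  have hVd : Pairwise (Function.onFun Disjoint V) := by
    intro i j hij
    rw [Function.onFun, Set.disjoint_left]
    rintro x ⟨_, hx⟩ ⟨_, hx'⟩
    exact hij (hx.symm.trans hx')
  have hsum : ∑ j ∈ Finset.range (K + 1), uniform01.real (V j) ≤ 1 := by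
    rw [← measureReal_biUnion_finset (fun i _ j _ hij => hVd hij) fun j _ => hVm j]
    exact measureReal_le_one
  obtain ⟨S, hSk, hSw⟩ := exists_heavy_finset (fun j => uniform01.real (V j)) (k := k)
    (Nat.succ_pos K) hsum
  set s := S.orderEmbOfFin hSk with hs
  -- The place where the counter passes j; the inserted 0 keeps the set nonempty, so that the
  -- supremum is meaningful and monotone in j.
  set T : ℕ → ℝ := fun j => sSup (insert 0 {x ∈ Icc (0 : ℝ) 1 | c x ≤ j}) with hT
  have hbdd : ∀ j, BddAbove (insert 0 {x ∈ Icc (0 : ℝ) 1 | c x ≤ j}) := by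
    intro j
    refine ⟨1, ?_⟩
    rintro x (rfl | hx)
    · exact zero_le_one
    · exact hx.1.2
  have hTmono : Monotone T := by
    intro i j hij
    refine csSup_le_csSup (hbdd j) ⟨0, mem_insert _ _⟩ (insert_subset_insert ?_)
    exact fun x hx => ⟨hx.1, hx.2.trans hij⟩
  have hTlt : ∀ x ∈ Icc (0 : ℝ) 1, ∀ j, x ≠ T j → (T j < x ↔ j < c x) := by
    intro x hx j hne
    constructor
    · intro h
      by_contra hle
      exact absurd (le_csSup (hbdd j) (mem_insert_of_mem _ ⟨hx, not_lt.1 hle⟩)) (not_le.2 h)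
    · intro h
      refine lt_of_le_of_ne (csSup_le ⟨0, mem_insert _ _⟩ ?_) hne.symm
      rintro y (rfl | hy)
      · exact hx.1
      · by_contra hlt
        exact absurd (hc (not_le.1 hlt).le) (not_le.2 (hy.2.trans_lt h))
  -- The breakpoint is put just before the kept run `s (i + 1)`, so discarded runs between two kept
  -- ones go to the piece on the left. Index 0 is skipped because the first piece has no left end.
  set t : Fin (k - 1) → ℝ := fun i => T (s ⟨i + 1, by omega⟩ - 1) with ht
  have htmono : Monotone t := by
    intro i j hij
    refine hTmono (Nat.sub_le_sub_right (s.monotone ?_) 1)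
    rw [Fin.le_def]
    exact Nat.add_le_add_right hij 1
  set h : Fin k → ℝ → Y := fun i => if hu : ∃ u ∈ U, c u = s i then L hu.choose else h₀ with hh
  have hhH : ∀ i, h i ∈ H := by
    intro i
    simp only [hh]
    split_ifs with hu
    · exact hLH _ hu.choose_spec.1
    · exact hh₀
  refine ⟨fun x => h ⟨pieceIndex t x, (pieceIndex_le t x).trans_lt (by omega)⟩ x,
    (mem_piecewiseClass_iff hk).2 ⟨h, t, hhH, htmono, fun x => rfl⟩, ?_⟩
  have hsub : {x | f x ≠ h ⟨pieceIndex t x, (pieceIndex_le t x).trans_lt (by omega)⟩ x} ⊆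
      (Uᶜ ∪ range t) ∪ ⋃ j ∈ Finset.range (K + 1) \ S, V j := by
    intro x hx
    by_contra hnot
    simp only [mem_union, mem_compl_iff, not_or, not_not, mem_iUnion, not_exists] at hnot
    obtain ⟨⟨hxU, hxt⟩, hxV⟩ := hnot
    have hcS : c x ∈ S := by
      by_contra hcS
      refine hxV (c x) ?_ ⟨hxU, rfl⟩
      rw [Finset.mem_sdiff, Finset.mem_range]
      exact ⟨Nat.lt_succ_iff.2 (hcK x), hcS⟩
    obtain ⟨i, hi⟩ : ∃ i, s i = c x := by
      have : c x ∈ Set.range s := by rw [hs, Finset.range_orderEmbOfFin]; exact hcS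
      exact this
    have hidx : pieceIndex t x = i := by
      refine pieceIndex_eq_of_iff (by omega) fun j => ?_
      have hne : x ≠ t j := fun h => hxt ⟨j, h.symm⟩
      rw [ht] at hne ⊢
      simp only at hne ⊢
      rw [hTlt x (hU01 hxU) _ hne, ← hi]
      have h1 : s ⟨j, by omega⟩ < s ⟨j + 1, by omega⟩ :=
        s.strictMono (by rw [Fin.lt_def]; simp)
      have h2 : s ⟨j + 1, by omega⟩ ≤ s i ↔ (j : ℕ) + 1 ≤ i := by
        rw [s.le_iff_le, Fin.le_def]
      omega
    apply hx
    have e : (⟨pieceIndex t x, (pieceIndex_le t x).trans_lt (by omega)⟩ : Fin k) = i :=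
      Fin.ext hidx
    have hu : ∃ u ∈ U, c u = s i := ⟨x, hxU, hi.symm⟩
    rw [e, hLf x hxU]
    simp only [hh]
    rw [dif_pos hu, hcL x hxU _ hu.choose_spec.1 (hi.symm.trans hu.choose_spec.2.symm)]
  refine (measure_mono hsub).trans ((measure_union_le _ _).trans ?_)
  have hnull : uniform01 (range t) = 0 :=
    Measure.absolutelyContinuous_restrict ((finite_range t).measure_zero volume)
  refine add_le_add ((measure_union_le _ _).trans (by rw [hnull, add_zero])) ?_
  refine (measure_biUnion_finset_le _ _).trans ?_
  have : ∑ j ∈ Finset.range (K + 1) \ S, uniform01 (V j)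
      = ENNReal.ofReal (∑ j ∈ Finset.range (K + 1) \ S, uniform01.real (V j)) := by
    rw [ENNReal.ofReal_sum_of_nonneg fun j _ => measureReal_nonneg]
    exact Finset.sum_congr rfl fun j _ => (ofReal_measureReal (measure_ne_top _ _)).symm
  rw [this]
  apply ENNReal.ofReal_le_ofReal
  push_cast at hSw
  exact hSw

/-! ### Small noise sensitivity implies closeness to the class. -/

/-- The second difference of a 1-Lipschitz monotone `F` at scale `δ` has a large integral between
a point near which `F` has slope about one and a point near which it has slope about zero. -/
theorem half_mul_le_integral_of_slope_change {F N : ℝ → ℝ} (hFc : Continuous F) (hFm : Monotone F)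
    (hFl : ∀ a b, a ≤ b → F b - F a ≤ b - a) {δ τ x y : ℝ} (hδ : 0 < δ) (hxy : x ≤ y)
    (hx : (1 - τ) * (2 * δ) ≤ F (x + δ) - F (x - δ)) (hy : F (y + δ) - F (y - δ) ≤ τ * (2 * δ))
    (hN : IntervalIntegrable N volume x y)
    (hNF : ∀ z ∈ Icc x y, (2 * F z - F (z - δ) - F (z + δ)) / (2 * δ) ≤ N z) :
    δ / 2 * (1 - 4 * τ) ≤ ∫ z in x..y, N z := by
  set φ : ℝ → ℝ := fun w => F w - F (w - δ) with hφ
  have hφc : Continuous φ := by fun_prop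
  have hφi : ∀ a b, IntervalIntegrable φ volume a b := fun a b => hφc.intervalIntegrable a b
  -- The second difference is φ(z) - φ(z+δ), so its integral telescopes to one window of length δ
  -- after x minus one after y.
  have h1 : ∫ z in x..y, (φ z - φ (z + δ)) / (2 * δ) ≤ ∫ z in x..y, N z := by
    refine intervalIntegral.integral_mono_on hxy
      (Continuous.intervalIntegrable (by fun_prop) _ _) hN fun z hz => ?_
    refine le_trans (le_of_eq ?_) (hNF z hz)
    simp only [hφ, add_sub_cancel_right]
    ring
  have h2 : ∫ z in x..y, (φ z - φ (z + δ)) / (2 * δ)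
      = ((∫ z in x..(x + δ), φ z) - ∫ z in y..(y + δ), φ z) / (2 * δ) := by
    rw [intervalIntegral.integral_div, intervalIntegral.integral_sub (hφi _ _)
      (Continuous.intervalIntegrable (by fun_prop) _ _),
      intervalIntegral.integral_comp_add_right φ δ]
    congr 1
    exact intervalIntegral.integral_interval_sub_interval_comm (hφi _ _) (hφi _ _) (hφi _ _)
  -- For z in [x, x+δ] the interval [z-δ, z] lies in [x-δ, x+δ], where F falls short of full slope
  -- by at most 2δτ in total.
  have h3 : (δ - 2 * δ * τ) * δ ≤ ∫ z in x..(x + δ), φ z := by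
    have := intervalIntegral.integral_mono_on (show x ≤ x + δ by linarith)
      (intervalIntegrable_const (c := δ - 2 * δ * τ)) (hφi x (x + δ)) fun z hz => ?_
    · rw [intervalIntegral.integral_const, smul_eq_mul] at this
      linarith
    · have e1 := hFl z (x + δ) hz.2
      have e2 := hFl (x - δ) (z - δ) (by linarith [hz.1])
      simp only [hφ]
      linarith
  have h4 : ∫ z in y..(y + δ), φ z ≤ (2 * δ * τ) * δ := by
    have := intervalIntegral.integral_mono_on (show y ≤ y + δ by linarith)
      (hφi y (y + δ)) (intervalIntegrable_const (c := 2 * δ * τ)) fun z hz => ?_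
    · rw [intervalIntegral.integral_const, smul_eq_mul] at this
      linarith
    · have e1 := hFm hz.2
      have e2 := hFm (show y - δ ≤ z - δ by linarith [hz.1])
      simp only [hφ]
      linarith
  refine le_trans ?_ (h2.symm.le.trans h1)
  rw [le_div_iff₀ (by positivity)]
  nlinarith

/-- The signed length of `A` between `0` and `z`. -/
def lengthUpTo (A : Set ℝ) (z : ℝ) : ℝ := ∫ w in (0 : ℝ)..z, A.indicator (1 : ℝ → ℝ) w

theorem lengthUpTo_sub {A : Set ℝ} (hA : MeasurableSet A) {a b : ℝ} (hab : a ≤ b) :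
    lengthUpTo A b - lengthUpTo A a = volume.real (A ∩ Ioo a b) := by
  have hi : ∀ a b : ℝ, IntervalIntegrable (A.indicator (1 : ℝ → ℝ)) volume a b := fun a b =>
    (intervalIntegrable_const (c := (1 : ℝ))).mono_fun
      ((measurable_one.indicator hA).aestronglyMeasurable) (Filter.Eventually.of_forall fun x => by
        by_cases hx : x ∈ A <;> simp [hx])
  rw [lengthUpTo, lengthUpTo, intervalIntegral.integral_interval_sub_left (hi _ _) (hi _ _),
    intervalIntegral.integral_of_le hab, integral_Ioc_eq_integral_Ioo, integral_indicator_one hA,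
    measureReal_restrict_apply hA]

theorem lengthUpTo_mono {A : Set ℝ} (hA : MeasurableSet A) : Monotone (lengthUpTo A) := by
  intro a b hab
  have := lengthUpTo_sub hA hab
  have := measureReal_nonneg (μ := volume) (s := A ∩ Ioo a b)
  linarith

theorem lengthUpTo_sub_le {A : Set ℝ} (hA : MeasurableSet A) (a b : ℝ) (hab : a ≤ b) :
    lengthUpTo A b - lengthUpTo A a ≤ b - a := by
  rw [lengthUpTo_sub hA hab]
  calc _ ≤ volume.real (Ioo a b) := measureReal_mono inter_subset_right (by simp)
    _ = b - a := by rw [Real.volume_real_Ioo_of_le hab]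

theorem continuous_lengthUpTo {A : Set ℝ} (hA : MeasurableSet A) : Continuous (lengthUpTo A) := by
  refine LipschitzWith.continuous (K := 1) (LipschitzWith.of_dist_le_mul fun x y => ?_)
  rw [Real.dist_eq, Real.dist_eq, NNReal.coe_one, one_mul]
  rcases le_total x y with h | h
  · rw [abs_sub_comm, abs_sub_comm x y, abs_of_nonneg (sub_nonneg.2 (lengthUpTo_mono hA h)),
      abs_of_nonneg (sub_nonneg.2 h)]
    exact lengthUpTo_sub_le hA _ _ h
  · rw [abs_of_nonneg (sub_nonneg.2 (lengthUpTo_mono hA h)), abs_of_nonneg (sub_nonneg.2 h)]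
    exact lengthUpTo_sub_le hA _ _ h

/-- The set on which `f` and `h` agree. -/
def agreeSet {Y : Type u} (f h : ℝ → Y) : Set ℝ := {w | f w = h w}

theorem measurableSet_agreeSet {Y : Type u} [MeasurableSpace Y] [MeasurableEq Y] {f h : ℝ → Y}
    (hf : Measurable f) (hh : Measurable h) : MeasurableSet (agreeSet f h) :=
  measurableSet_eq_fun hf hh

/-- The agreement sets of distinct members with f are almost disjoint in a probability space, so
only countably many have positive mass. Passing to `G` makes the infimum in `lowerNS` measurable;
the extra `h₀` keeps `G` nonempty. -/
theorem exists_countable_subset_agree {Y : Type u} [MeasurableSpace Y] [MeasurableEq Y]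
    {H : Set (ℝ → Y)} (hH : H.Nonempty) (hHm : ∀ h ∈ H, Measurable h)
    (hcross : ZeroMeasureCrossings H) {f : ℝ → Y} (hf : Measurable f) :
    ∃ G ⊆ H, G.Countable ∧ G.Nonempty ∧ ∀ h ∈ H, h ∉ G → uniform01 (agreeSet f h) = 0 := by
  obtain ⟨h₀, hh₀⟩ := hH
  have hcount := Measure.countable_meas_pos_of_disjoint_iUnion₀ (μ := uniform01)
    (As := fun h : H => agreeSet f h)
    (fun h => (measurableSet_agreeSet hf (hHm h h.2)).nullMeasurableSet) (by
      intro h h' hne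
      refine measure_mono_null (t := {x | h.1 x = h'.1 x}) ?_
        (Measure.absolutelyContinuous_restrict (hcross h h.2 h' h'.2 fun e => hne (Subtype.ext e)))
      rintro x ⟨h1, h2⟩
      exact (show f x = h.1 x from h1).symm.trans h2)
  refine ⟨insert h₀ (Subtype.val '' {h : H | 0 < uniform01 (agreeSet f h)}), ?_,
    (hcount.image _).insert _, ⟨h₀, mem_insert _ _⟩, ?_⟩
  · rintro h (rfl | ⟨h, -, rfl⟩)
    · exact hh₀
    · exact h.2
  · intro h hh hnot
    by_contra hpos
    exact hnot (mem_insert_of_mem _ ⟨⟨h, hh⟩, pos_iff_ne_zero.2 hpos, rfl⟩)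

open Classical in
/-- The noise sensitivity of `f` at `x` relative to the class `G`, set to zero near the ends of the
unit interval. -/
def lowerNS {Y : Type u} (G : Set (ℝ → Y)) (f : ℝ → Y) (δ x : ℝ) : ℝ :=
  (Icc δ (1 - δ)).indicator (fun x => ⨅ h : G, if f x = h.1 x then
    1 - volume.real (agreeSet f h.1 ∩ Ioo (x - δ) (x + δ)) / (2 * δ) else 1) x

theorem volume_real_inter_Ioo_le {A : Set ℝ} {δ x : ℝ} (hδ : 0 < δ) :
    volume.real (A ∩ Ioo (x - δ) (x + δ)) ≤ 2 * δ := by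
  calc _ ≤ volume.real (Ioo (x - δ) (x + δ)) := measureReal_mono inter_subset_right (by simp)
    _ = 2 * δ := by rw [Real.volume_real_Ioo_of_le (by linarith)]; ring

open Classical in
theorem localNS_mem_Icc {Y : Type u} (f h : ℝ → Y) {δ x : ℝ} (hδ : 0 < δ) :
    (if f x = h x then 1 - volume.real (agreeSet f h ∩ Ioo (x - δ) (x + δ)) / (2 * δ) else 1)
      ∈ Icc (0 : ℝ) 1 := by
  split_ifs
  · have h1 := volume_real_inter_Ioo_le (A := agreeSet f h) (x := x) hδ
    have h2 : 0 ≤ volume.real (agreeSet f h ∩ Ioo (x - δ) (x + δ)) / (2 * δ) := by positivity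
    have h3 : volume.real (agreeSet f h ∩ Ioo (x - δ) (x + δ)) / (2 * δ) ≤ 1 := by
      rw [div_le_one (by positivity)]; exact h1
    constructor <;> linarith
  · simp

open Classical in
theorem bddBelow_localNS {Y : Type u} (G : Set (ℝ → Y)) (f : ℝ → Y) {δ : ℝ} (x : ℝ) (hδ : 0 < δ) :
    BddBelow (range fun h : G => if f x = h.1 x then
      1 - volume.real (agreeSet f h.1 ∩ Ioo (x - δ) (x + δ)) / (2 * δ) else 1) := by
  refine ⟨0, ?_⟩
  rintro _ ⟨h, rfl⟩
  exact (localNS_mem_Icc f h.1 hδ).1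

theorem lowerNS_nonneg {Y : Type u} (G : Set (ℝ → Y)) (f : ℝ → Y) {δ : ℝ} (hδ : 0 < δ) (x : ℝ) :
    0 ≤ lowerNS G f δ x := by
  classical
  refine indicator_nonneg (fun x _ => Real.iInf_nonneg fun h => (localNS_mem_Icc f h.1 hδ).1) x

theorem lowerNS_le_one {Y : Type u} {G : Set (ℝ → Y)} (hG : G.Nonempty) (f : ℝ → Y) {δ : ℝ}
    (hδ : 0 < δ) (x : ℝ) : lowerNS G f δ x ≤ 1 := by
  classical
  obtain ⟨h, hh⟩ := hG
  unfold lowerNS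
  refine indicator_le' (fun x _ => ?_) (fun _ _ => zero_le_one) x
  exact (ciInf_le (bddBelow_localNS G f x hδ) ⟨h, hh⟩).trans (localNS_mem_Icc f h hδ).2

theorem measurable_lowerNS {Y : Type u} [MeasurableSpace Y] [MeasurableEq Y] {G : Set (ℝ → Y)}
    (hGm : ∀ h ∈ G, Measurable h) (hGc : G.Countable) {f : ℝ → Y} (hf : Measurable f) {δ : ℝ}
    (hδ : 0 < δ) : Measurable (lowerNS G f δ) := by
  classical
  have := hGc.to_subtype
  refine Measurable.indicator (Measurable.iInf fun h => ?_) measurableSet_Icc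
  have hA := measurableSet_agreeSet hf (hGm h.1 h.2)
  refine Measurable.ite hA ?_ measurable_const
  refine measurable_const.sub (Measurable.div_const ?_ _)
  have e : (fun x => volume.real (agreeSet f h.1 ∩ Ioo (x - δ) (x + δ)))
      = fun x => lengthUpTo (agreeSet f h.1) (x + δ) - lengthUpTo (agreeSet f h.1) (x - δ) := by
    ext x
    rw [lengthUpTo_sub hA (by linarith)]
  rw [e]
  have hc := continuous_lengthUpTo hA
  exact Continuous.measurable (by fun_prop)

/-- Members outside `G` disagree with f almost surely, so omitting them cannot raise the infimum
above their value 1; near the ends `lowerNS` is 0. -/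
theorem lowerNS_le_nearLaw {Y : Type u} [MeasurableSpace Y] [MeasurableEq Y] {H G : Set (ℝ → Y)}
    (hHm : ∀ h ∈ H, Measurable h) (hG : G.Nonempty) {f : ℝ → Y} (hf : Measurable f)
    (hGH : ∀ h ∈ H, h ∉ G → uniform01 (agreeSet f h) = 0) {δ : ℝ} (hδ0 : 0 < δ) (hδ : δ ≤ 1 / 2)
    {x : ℝ} (hx : x ∈ Icc (0 : ℝ) 1) {h : ℝ → Y} (hh : h ∈ H) (hfx : f x = h x) :
    lowerNS G f δ x ≤ (nearLaw δ x).real {w | h w ≠ f w} := by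
  classical
  have hprob := isProbabilityMeasure_nearLaw hδ0 hδ hx
  have hA := measurableSet_agreeSet hf (hHm h hh)
  have hc : {w | h w ≠ f w} = (agreeSet f h)ᶜ := by
    ext w; simp [agreeSet, eq_comm]
  rw [hc, probReal_compl_eq_one_sub hA]
  by_cases hmem : h ∈ G
  · by_cases hxi : x ∈ Icc δ (1 - δ)
    · rw [nearLaw_real_of_mem hxi, lowerNS, indicator_of_mem hxi]
      refine (ciInf_le (bddBelow_localNS G f x hδ0) ⟨h, hmem⟩).trans ?_
      rw [if_pos hfx]
    · rw [lowerNS, indicator_of_notMem hxi, sub_nonneg]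
      exact measureReal_le_one
  · have : nearLaw δ x (agreeSet f h) = 0 :=
      ProbabilityTheory.cond_absolutelyContinuous (hGH h hh hmem)
    rw [measureReal_def, this]
    simpa using lowerNS_le_one hG f hδ0 x

theorem volume_agree_add_agree_le {Y : Type u} [MeasurableSpace Y] [MeasurableEq Y]
    {H : Set (ℝ → Y)} (hHm : ∀ h ∈ H, Measurable h) (hcross : ZeroMeasureCrossings H) {f : ℝ → Y}
    (hf : Measurable f) {h h' : ℝ → Y} (hh : h ∈ H) (hh' : h' ∈ H) (hne : h ≠ h') {δ x : ℝ}
    (hδ : 0 < δ) :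
    volume.real (agreeSet f h ∩ Ioo (x - δ) (x + δ)) +
      volume.real (agreeSet f h' ∩ Ioo (x - δ) (x + δ)) ≤ 2 * δ := by
  have hA' := (measurableSet_agreeSet hf (hHm h' hh')).inter
    (measurableSet_Ioo (a := x - δ) (b := x + δ))
  have hd : AEDisjoint volume (agreeSet f h ∩ Ioo (x - δ) (x + δ))
      (agreeSet f h' ∩ Ioo (x - δ) (x + δ)) := by
    refine measure_mono_null ?_ (hcross h hh h' hh' hne)
    rintro w ⟨⟨h1, -⟩, h2, -⟩
    exact (show f w = h w from h1).symm.trans h2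
  have hfin : ∀ A : Set ℝ, volume (A ∩ Ioo (x - δ) (x + δ)) ≠ ⊤ := fun A =>
    measure_ne_top_of_subset inter_subset_right (by simp)
  rw [← measureReal_union₀ hA'.nullMeasurableSet hd (hfin _) (hfin _), ← union_inter_distrib_right]
  exact volume_real_inter_Ioo_le hδ

/-- If the minimizing candidate is h itself, its disagreement near z is at least the bound because F
is 1-Lipschitz. Any other candidate must disagree with f wherever h agrees, up to a null set, so its
disagreement is at least the whole agreement of h near z. -/
theorem secondDifference_le_lowerNS {Y : Type u} [MeasurableSpace Y] [MeasurableEq Y]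
    {H G : Set (ℝ → Y)} (hHm : ∀ h ∈ H, Measurable h) (hcross : ZeroMeasureCrossings H)
    (hGH : G ⊆ H) (hG : G.Nonempty) {f : ℝ → Y} (hf : Measurable f) {h : ℝ → Y} (hh : h ∈ H)
    {δ z : ℝ} (hδ : 0 < δ) (hz : z ∈ Icc δ (1 - δ)) :
    (2 * lengthUpTo (agreeSet f h) z - lengthUpTo (agreeSet f h) (z - δ)
      - lengthUpTo (agreeSet f h) (z + δ)) / (2 * δ) ≤ lowerNS G f δ z := by
  classical
  have := hG.to_subtype
  have hA := measurableSet_agreeSet hf (hHm h hh)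
  rw [lowerNS, indicator_of_mem hz]
  refine le_ciInf fun h' => ?_
  have e := lengthUpTo_sub hA (show z - δ ≤ z + δ by linarith)
  have e1 := lengthUpTo_sub_le hA (z - δ) z (by linarith)
  have e2 := lengthUpTo_mono hA (show z ≤ z + δ by linarith)
  rw [div_le_iff₀ (by positivity)]
  split_ifs with hfz
  · rw [sub_mul, div_mul_cancel₀ _ (by positivity)]
    by_cases hne : h = h'.1
    · rw [← hne]; linarith
    · have := volume_agree_add_agree_le hHm hcross hf hh (hGH h'.2) hne (x := z) hδ
      linarith
  · linarith

theorem exists_of_lowerNS_lt {Y : Type u} {G : Set (ℝ → Y)} (hG : G.Nonempty) {f : ℝ → Y}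
    {δ τ x : ℝ} (hδ : 0 < δ) (hτ : τ ≤ 1) (hx : x ∈ Icc δ (1 - δ)) (hlt : lowerNS G f δ x < τ) :
    ∃ h ∈ G, f x = h x ∧ (1 - τ) * (2 * δ) ≤ volume.real (agreeSet f h ∩ Ioo (x - δ) (x + δ)) := by
  classical
  have := hG.to_subtype
  rw [lowerNS, indicator_of_mem hx] at hlt
  obtain ⟨h, hlt⟩ := exists_lt_of_ciInf_lt hlt
  split_ifs at hlt with hfx
  · refine ⟨h, h.2, hfx, ?_⟩
    rw [← le_div_iff₀ (by positivity)]
    linarith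
  · linarith

/-- Multiplying by 1-ε/6 gives K(1-2ε/3) ≤ k-1; the loss 2/3 is 1/2 from the cost of a change plus
1/6 from the budget. -/
theorem piece_count_arith {ε K k : ℝ} (hε0 : 0 < ε) (hε : ε < 1 / 2) (hK0 : 0 ≤ K)
    (hK : K * (1 - ε / 2) ≤ (k - 1) * (1 + ε / 6)) :
    max 0 ((K + 1 - k) / (K + 1)) ≤ 2 / 3 * ε := by
  refine max_le (by positivity) ?_
  rw [div_le_iff₀ (by positivity)]
  have h1 : K * (1 - ε / 2) * (1 - ε / 6) ≤ (k - 1) * (1 + ε / 6) * (1 - ε / 6) :=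
    mul_le_mul_of_nonneg_right hK (by linarith)
  have h2 : 0 ≤ K * (ε * ε) := by positivity
  by_contra hcon
  push Not at hcon
  have hk1 : 0 ≤ k - 1 := by
    by_contra hneg
    have : (k - 1) * (1 + ε / 6) < 0 := mul_neg_of_neg_of_pos (by linarith) (by linarith)
    have : 0 ≤ K * (1 - ε / 2) := mul_nonneg hK0 (by linarith)
    linarith
  have h3 : 0 ≤ (k - 1) * (ε * ε) := by positivity
  nlinarith

theorem measure_compl_sublevel_le {N : ℝ → ℝ} (hN0 : ∀ x, 0 ≤ N x)
    (hNi : Integrable N uniform01) {δ τ : ℝ} (hδ : 0 ≤ δ) (hτ : 0 < τ) :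
    uniform01 {x | x ∈ Icc δ (1 - δ) ∧ N x < τ}ᶜ ≤
      ENNReal.ofReal (2 * δ + (∫ x, N x ∂uniform01) / τ) := by
  have hsub : {x | x ∈ Icc δ (1 - δ) ∧ N x < τ}ᶜ ⊆ (Icc δ (1 - δ))ᶜ ∪ {x | τ ≤ N x} := by
    intro x hx
    simp only [mem_compl_iff, mem_ofPred_eq, not_and, not_lt] at hx
    by_cases h : x ∈ Icc δ (1 - δ)
    · exact Or.inr (hx h)
    · exact Or.inl h
  have h1 : uniform01 (Icc δ (1 - δ))ᶜ ≤ ENNReal.ofReal (2 * δ) := by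
    rw [uniform01, Measure.restrict_apply measurableSet_Icc.compl]
    calc _ ≤ volume (Ico 0 δ ∪ Ioc (1 - δ) 1) := measure_mono fun x hx => by
          obtain ⟨h1, h2, h3⟩ := hx
          rw [mem_compl_iff, mem_Icc, not_and_or, not_le, not_le] at h1
          rcases h1 with h1 | h1
          · exact Or.inl ⟨h2, h1⟩
          · exact Or.inr ⟨h1, h3⟩
      _ ≤ _ := measure_union_le _ _
      _ = _ := by
          rw [Real.volume_Ico, Real.volume_Ioc, ← ENNReal.ofReal_add (by linarith) (by linarith)]
          congr 1; ring
  have h2 : uniform01 {x | τ ≤ N x} ≤ ENNReal.ofReal ((∫ x, N x ∂uniform01) / τ) := by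
    rw [← ofReal_measureReal (measure_ne_top _ _)]
    apply ENNReal.ofReal_le_ofReal
    rw [le_div_iff₀ hτ, mul_comm]
    exact mul_meas_ge_le_integral_of_nonneg (Filter.Eventually.of_forall hN0) hNi τ
  refine (measure_mono hsub).trans ((measure_union_le _ _).trans ?_)
  rw [ENNReal.ofReal_add (by linarith) (div_nonneg (integral_nonneg hN0) hτ.le)]
  exact add_le_add h1 h2

/-- A function with small noise sensitivity is close to a `k`-piecewise function. -/
theorem exists_close_of_integral_lowerNS_le {Y : Type u} [MeasurableSpace Y] [MeasurableEq Y]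
    {H G : Set (ℝ → Y)} (hHm : ∀ h ∈ H, Measurable h) (hcross : ZeroMeasureCrossings H)
    (hGH : G ⊆ H) (hG : G.Nonempty) (hGc : G.Countable) {f : ℝ → Y} (hf : Measurable f)
    {ε δ : ℝ} {k : ℕ} (hε0 : 0 < ε) (hε : ε < 1 / 2) (hk : 80 / ε ≤ k)
    (hδ : δ = ε ^ 2 / (32 * k))
    (hint : ∫ x, lowerNS G f δ x ∂uniform01 ≤ ((k : ℝ) - 1) * (δ / 2) * (1 + ε / 6)) :
    ∃ g ∈ piecewiseClass k H, uniform01 {x | f x ≠ g x} < ENNReal.ofReal ε := by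
  classical
  have hk160 : (160 : ℝ) < k := by
    refine lt_of_lt_of_le ?_ hk
    rw [lt_div_iff₀ hε0]; linarith
  have hk0 : 0 < k := by
    have : (0 : ℝ) < k := by linarith
    exact_mod_cast this
  have hkε : 80 ≤ k * ε := by rwa [div_le_iff₀ hε0] at hk
  have hδ0 : 0 < δ := by rw [hδ]; positivity
  have hδk : δ * k = ε ^ 2 / 32 := by rw [hδ]; field_simp
  have hδε : δ ≤ ε / 10000 := by
    have h1 : δ * 160 ≤ δ * k := by gcongr
    nlinarith
  set N := lowerNS G f δ with hN
  have hNm : Measurable N := measurable_lowerNS (fun h hh => hHm h (hGH hh)) hGc hf hδ0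
  have hN0 : ∀ x, 0 ≤ N x := lowerNS_nonneg G f hδ0
  have hN1 : ∀ x, N x ≤ 1 := lowerNS_le_one hG f hδ0
  have hNi : Integrable N uniform01 := Integrable.of_bound hNm.aestronglyMeasurable 1
    (Filter.Eventually.of_forall fun x => by rw [Real.norm_of_nonneg (hN0 x)]; exact hN1 x)
  have hNii : ∀ a b, IntervalIntegrable N volume a b := fun a b =>
    (intervalIntegrable_const (c := (1 : ℝ))).mono_fun hNm.aestronglyMeasurable
      (Filter.Eventually.of_forall fun x => by
        simpa [abs_of_nonneg (hN0 x)] using hN1 x)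
  -- This choice makes a label change cost w = (δ/2)(1-ε/2), while the Markov bound M/τ for the
  -- unlabelled points stays below ε/7.
  set τ := ε / 8 with hτ
  set M := ((k : ℝ) - 1) * (δ / 2) * (1 + ε / 6) with hM
  set w := δ / 2 * (1 - 4 * τ) with hw
  have hw0 : 0 < w := by rw [hw, hτ]; exact mul_pos (by positivity) (by linarith)
  set U := {x | x ∈ Icc δ (1 - δ) ∧ N x < τ} with hU
  have hUm : MeasurableSet U := measurableSet_Icc.inter (measurableSet_lt hNm measurable_const)
  have hU01 : U ⊆ Icc 0 1 := fun x hx => ⟨by linarith [hx.1.1], by linarith [hx.1.2]⟩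
  have hex : ∀ x, ∃ h : ℝ → Y, x ∈ U → h ∈ G ∧ f x = h x ∧
      (1 - τ) * (2 * δ) ≤ volume.real (agreeSet f h ∩ Ioo (x - δ) (x + δ)) := by
    intro x
    by_cases hx : x ∈ U
    · obtain ⟨h, h1, h2⟩ := exists_of_lowerNS_lt hG hδ0 (by linarith) hx.1 hx.2
      exact ⟨h, fun _ => ⟨h1, h2⟩⟩
    · exact ⟨hG.some, fun h => absurd h hx⟩
  choose L hL using hex
  set Φ : ℝ → ℝ := fun u => ∫ z in δ..u, N z with hΦ
  have hΦ0 : ∀ u ∈ U, 0 ≤ Φ u := fun u hu =>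
    intervalIntegral.integral_nonneg hu.1.1 fun z _ => hN0 z
  have hΦM : ∀ u ∈ U, Φ u ≤ M := by
    intro u hu
    refine le_trans ?_ hint
    simp only [hΦ]
    rw [intervalIntegral.integral_of_le hu.1.1, uniform01]
    refine setIntegral_mono_set hNi (Filter.Eventually.of_forall hN0)
      (LE.le.eventuallyLE (show Ioc δ u ≤ Icc 0 1 from fun z hz => ?_))
    exact ⟨by linarith [hz.1], hz.2.trans (hU01 hu).2⟩
  have hΦw : ∀ x ∈ U, ∀ y ∈ U, x < y → L x ≠ L y → w ≤ Φ y - Φ x := by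
    intro x hx y hy hxy hne
    have hLx := hGH (hL x hx).1
    have hLy := hGH (hL y hy).1
    have hA := measurableSet_agreeSet hf (hHm _ hLx)
    rw [hΦ]
    simp only
    rw [intervalIntegral.integral_interval_sub_left (hNii _ _) (hNii _ _)]
    refine half_mul_le_integral_of_slope_change (continuous_lengthUpTo hA) (lengthUpTo_mono hA)
      (lengthUpTo_sub_le hA) hδ0 hxy.le ?_ ?_ (hNii _ _) fun z hz => ?_
    · rw [lengthUpTo_sub hA (by linarith)]
      exact (hL x hx).2.2
    · rw [lengthUpTo_sub hA (by linarith)]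
      have h1 := (hL y hy).2.2
      have h2 := volume_agree_add_agree_le hHm hcross hf hLx hLy hne (x := y) hδ0
      linarith
    · exact secondDifference_le_lowerNS hHm hcross hGH hG hf hLx hδ0
        ⟨hx.1.1.trans hz.1, hz.2.trans hy.1.2⟩
  obtain ⟨c, hc, hcK, hcL⟩ := exists_monotone_counter hw0 hΦ0 hΦM hΦw
  obtain ⟨g, hg, hgd⟩ := exists_mem_piecewiseClass_of_counter (hG.mono hGH) hUm hU01
    (fun u hu => hGH (hL u hu).1) (fun u hu => (hL u hu).2.1) hc hcK hcL hk0
  refine ⟨g, hg, hgd.trans_lt ?_⟩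
  have h1 := measure_compl_sublevel_le hN0 hNi hδ0.le (show 0 < τ by positivity)
  refine (add_le_add_left h1 _).trans_lt ?_
  have hI0 : 0 ≤ ∫ x, N x ∂uniform01 := integral_nonneg hN0
  have hM0 : 0 ≤ M := hI0.trans hint
  set K := ⌊M / w⌋₊ with hK
  have hKw : (K : ℝ) * w ≤ M := by
    rw [← le_div_iff₀ hw0]
    exact Nat.floor_le (by positivity)
  have hKk : (K : ℝ) * (1 - ε / 2) ≤ ((k : ℝ) - 1) * (1 + ε / 6) := by
    have e1 : (K : ℝ) * w = (δ / 2) * (K * (1 - ε / 2)) := by rw [hw, hτ]; ring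
    have e2 : M = (δ / 2) * (((k : ℝ) - 1) * (1 + ε / 6)) := by rw [hM]; ring
    rw [e1, e2] at hKw
    exact le_of_mul_le_mul_left hKw (by positivity)
  have h2 := piece_count_arith hε0 hε (Nat.cast_nonneg K) hKk
  have h3 : (∫ x, N x ∂uniform01) / τ ≤ ε / 7 := by
    rw [div_le_iff₀ (by positivity)]
    refine hint.trans ?_
    have e : M ≤ k * (δ / 2) * (1 + ε / 6) := by rw [hM]; gcongr; linarith
    have e2 : k * (δ / 2) * (1 + ε / 6) = (ε ^ 2 / 64) * (1 + ε / 6) := by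
      rw [show (k : ℝ) * (δ / 2) = δ * k / 2 by ring, hδk]; ring
    rw [e2] at e
    rw [hτ]
    nlinarith [mul_pos hε0 hε0]
  rw [← ENNReal.ofReal_add (by positivity) (le_max_left _ _)]
  rw [ENNReal.ofReal_lt_ofReal_iff hε0]
  -- The three losses are 2δ at the ends, ε/7 from Markov's inequality and 2ε/3 from discarded runs.
  linarith

/-! ### Noise sensitivity of piecewise functions. -/

theorem measurable_pieceIndex {n : ℕ} (t : Fin n → ℝ) : Measurable (pieceIndex t) :=
  (pieceIndex_mono t).measurable

theorem measurableSet_ne_pieceIndex {n : ℕ} (t : Fin n → ℝ) :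
    MeasurableSet {q : ℝ × ℝ | pieceIndex t q.2 ≠ pieceIndex t q.1} :=
  (measurableSet_eq_fun ((measurable_pieceIndex t).comp measurable_snd)
    ((measurable_pieceIndex t).comp measurable_fst)).compl

/-- The probability that a point near `x` lies in another piece than `x`. -/
def otherPieceProb {n : ℕ} (t : Fin n → ℝ) (δ x : ℝ) : ℝ :=
  (nearLaw δ x).real {w | pieceIndex t w ≠ pieceIndex t x}

theorem measurable_otherPieceProb {n : ℕ} (t : Fin n → ℝ) (δ : ℝ) :
    Measurable (otherPieceProb t δ) := by
  have hI : MeasurableSet {q : ℝ × ℝ | q.2 ∈ Ioo (q.1 - δ) (q.1 + δ)} := by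
    have h1 : MeasurableSet {p : ℝ × ℝ | p.1 - δ < p.2} :=
      measurableSet_lt (by fun_prop) (by fun_prop)
    have h2 : MeasurableSet {p : ℝ × ℝ | p.2 < p.1 + δ} :=
      measurableSet_lt (by fun_prop) (by fun_prop)
    exact h1.inter h2
  have e : otherPieceProb t δ = fun x =>
      ((uniform01 (Prod.mk x ⁻¹' {q : ℝ × ℝ | q.2 ∈ Ioo (q.1 - δ) (q.1 + δ)}))⁻¹ *
        uniform01 (Prod.mk x ⁻¹' ({q : ℝ × ℝ | q.2 ∈ Ioo (q.1 - δ) (q.1 + δ)} ∩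
          {q : ℝ × ℝ | pieceIndex t q.2 ≠ pieceIndex t q.1}))).toReal := by
    ext x
    rw [otherPieceProb, nearLaw, measureReal_def, ProbabilityTheory.cond_apply measurableSet_Ioo]
    rfl
  rw [e]
  exact ((measurable_measure_prodMk_left hI).inv.mul
    (measurable_measure_prodMk_left (hI.inter (measurableSet_ne_pieceIndex t)))).ennreal_toReal

theorem volume_real_separated_le {δ x t : ℝ} :
    volume.real ({w | ¬(t < w ↔ t < x)} ∩ Ioo (x - δ) (x + δ)) ≤ max 0 (δ - |x - t|) := by
  rcases lt_or_ge t x with h | h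
  · rw [abs_of_pos (by linarith)]
    calc _ ≤ volume.real (Ioc (x - δ) t) := by
          refine measureReal_mono (fun w hw => ?_) (by simp)
          obtain ⟨h1, h2, h3⟩ := hw
          simp only [mem_ofPred_eq, h, iff_true, not_lt] at h1
          exact ⟨h2, h1⟩
      _ = _ := by rw [Real.volume_real_Ioc, max_comm]; congr 1; ring
  · rw [abs_of_nonpos (by linarith)]
    calc _ ≤ volume.real (Ioo t (x + δ)) := by
          refine measureReal_mono (fun w hw => ?_) (by simp)
          obtain ⟨h1, h2, h3⟩ := hw
          simp only [mem_ofPred_eq, not_lt.2 h, iff_false, not_not] at h1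
          exact ⟨h1, h3⟩
      _ = _ := by rw [Real.volume_real_Ioo, max_comm]; congr 1; ring

/-- Two points with no breakpoint separating them have the same piece index, so a union bound over
breakpoints suffices. -/
theorem otherPieceProb_le_sum {n : ℕ} (t : Fin n → ℝ) {δ x : ℝ} (hδ : 0 < δ)
    (hx : x ∈ Icc δ (1 - δ)) :
    otherPieceProb t δ x ≤ ∑ j, max 0 (δ - |x - t j|) / (2 * δ) := by
  rw [otherPieceProb, nearLaw_real_of_mem hx, ← Finset.sum_div]
  gcongr
  have hsub : {w | pieceIndex t w ≠ pieceIndex t x} ∩ Ioo (x - δ) (x + δ) ⊆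
      ⋃ j ∈ (Finset.univ : Finset (Fin n)), {w | ¬(t j < w ↔ t j < x)} ∩ Ioo (x - δ) (x + δ) := by
    rintro w ⟨h1, h2⟩
    by_contra hnot
    simp only [Finset.mem_univ, iUnion_true, mem_iUnion, not_exists, mem_inter_iff, mem_ofPred_eq,
      not_and] at hnot
    apply h1
    have : ∀ j, t j < w ↔ t j < x := fun j => by
      by_contra h; exact hnot j h h2
    classical
    unfold pieceIndex
    simp_rw [this]
  refine (measureReal_mono hsub ?_).trans ?_
  · exact ((measure_mono (iUnion₂_subset fun _ _ => inter_subset_right)).trans_lt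
      (measure_Ioo_lt_top (a := x - δ) (b := x + δ))).ne
  · refine (measureReal_biUnion_finset_le _ _).trans ?_
    exact Finset.sum_le_sum fun j _ => volume_real_separated_le

theorem integral_tent_le {δ t : ℝ} (hδ : 0 < δ) :
    ∫ x, max 0 (δ - |x - t|) ∂uniform01 ≤ δ ^ 2 := by
  have hcont : Continuous fun x : ℝ => max 0 (δ - |x - t|) := by fun_prop
  have hzero : ∀ x, x ∉ Icc (t - δ) (t + δ) → max 0 (δ - |x - t|) = 0 := by
    intro x hx
    apply max_eq_left
    rw [mem_Icc, not_and_or, not_le, not_le] at hx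
    rcases hx with hx | hx
    · have := neg_abs_le (x - t); linarith
    · have := le_abs_self (x - t); linarith
  have hI : IntegrableOn (fun x : ℝ => max 0 (δ - |x - t|)) (Icc (t - δ) (t + δ)) :=
    hcont.continuousOn.integrableOn_Icc
  have hIv : Integrable (fun x : ℝ => max 0 (δ - |x - t|)) volume := by
    rwa [integrableOn_iff_integrable_of_support_subset] at hI
    intro x hx
    by_contra h
    exact hx (hzero x h)
  calc ∫ x, max 0 (δ - |x - t|) ∂uniform01 ≤ ∫ x, max 0 (δ - |x - t|) := by
        exact setIntegral_le_integral hIv (Filter.Eventually.of_forall fun x => le_max_left _ _)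
    _ = ∫ x in Icc (t - δ) (t + δ), max 0 (δ - |x - t|) := by
        symm
        exact setIntegral_eq_integral_of_forall_compl_eq_zero hzero
    _ = ∫ x in (t - δ)..(t + δ), max 0 (δ - |x - t|) := by
        rw [intervalIntegral.integral_of_le (by linarith), integral_Icc_eq_integral_Ioc]
    _ = (∫ x in (t - δ)..t, (δ - (t - x))) + ∫ x in t..(t + δ), (δ - (x - t)) := by
        rw [← intervalIntegral.integral_add_adjacent_intervals (b := t)
          (hcont.intervalIntegrable _ _) (hcont.intervalIntegrable _ _)]
        congr 1
        · refine intervalIntegral.integral_congr fun x hx => ?_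
          rw [uIcc_of_le (by linarith)] at hx
          rw [abs_of_nonpos (by linarith [hx.2]), max_eq_right (by linarith [hx.1])]
          ring
        · refine intervalIntegral.integral_congr fun x hx => ?_
          rw [uIcc_of_le (by linarith)] at hx
          rw [abs_of_nonneg (by linarith [hx.1]), max_eq_right (by linarith [hx.2])]
    _ = δ ^ 2 := by
        have e1 : ∫ x in (t - δ)..t, (δ - (t - x)) = δ ^ 2 / 2 := by
          have : ∀ x : ℝ, δ - (t - x) = (δ - t) + x := fun x => by ring
          simp_rw [this]
          rw [intervalIntegral.integral_add (by simp) (by simp), intervalIntegral.integral_const,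
            integral_id, smul_eq_mul]
          ring
        have e2 : ∫ x in t..(t + δ), (δ - (x - t)) = δ ^ 2 / 2 := by
          have : ∀ x : ℝ, δ - (x - t) = (δ + t) - x := fun x => by ring
          simp_rw [this]
          rw [intervalIntegral.integral_sub (by simp) (by simp), intervalIntegral.integral_const,
            integral_id, smul_eq_mul]
          ring
        rw [e1, e2]; ring

theorem uniform01_real_compl_Icc_le {δ : ℝ} (hδ : 0 ≤ δ) :
    uniform01.real (Icc δ (1 - δ))ᶜ ≤ 2 * δ := by
  rw [uniform01, measureReal_restrict_apply measurableSet_Icc.compl]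
  calc _ ≤ volume.real (Ico 0 δ ∪ Ioc (1 - δ) 1) := measureReal_mono (fun x hx => by
          obtain ⟨h1, h2, h3⟩ := hx
          rw [mem_compl_iff, mem_Icc, not_and_or, not_le, not_le] at h1
          rcases h1 with h1 | h1
          · exact Or.inl ⟨h2, h1⟩
          · exact Or.inr ⟨h1, h3⟩) (by
          exact ((measure_union_lt_top (by simp) (by simp))).ne)
    _ ≤ _ := measureReal_union_le _ _
    _ = _ := by
        rw [Real.volume_real_Ico_of_le hδ, Real.volume_real_Ioc_of_le (by linarith)]
        ring

/-- The noise sensitivity of a function with `n` breakpoints is at most about `n * δ / 2`. -/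
theorem integral_otherPieceProb_le {n : ℕ} (t : Fin n → ℝ) {δ : ℝ} (hδ0 : 0 < δ)
    (hδ : δ ≤ 1 / 2) :
    ∫ x, otherPieceProb t δ x ∂uniform01 ≤ n * (δ / 2) + 2 * δ := by
  have hae : ∀ᵐ x ∂uniform01, x ∈ Icc (0 : ℝ) 1 := ae_restrict_mem measurableSet_Icc
  -- Within δ of the ends the near law has a smaller normalization than 2δ; there the trivial bound
  -- 1 is used, on a set of mass at most 2δ.
  have hbound : ∀ᵐ x ∂uniform01, otherPieceProb t δ x ≤
      ∑ j, max 0 (δ - |x - t j|) / (2 * δ) + (Icc δ (1 - δ))ᶜ.indicator 1 x := by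
    filter_upwards [hae] with x hx
    by_cases h : x ∈ Icc δ (1 - δ)
    · rw [indicator_of_notMem (by simpa using h), add_zero]
      exact otherPieceProb_le_sum t hδ0 h
    · rw [indicator_of_mem h]
      have := isProbabilityMeasure_nearLaw hδ0 hδ hx
      have h1 : otherPieceProb t δ x ≤ 1 := measureReal_le_one
      have h2 : 0 ≤ ∑ j, max 0 (δ - |x - t j|) / (2 * δ) := by positivity
      simp only [Pi.one_apply]
      linarith
  have htent : ∀ j, Integrable (fun x => max 0 (δ - |x - t j|) / (2 * δ)) uniform01 := by
    intro j
    exact (Continuous.continuousOn (by fun_prop)).integrableOn_Icc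
  have hind : Integrable ((Icc δ (1 - δ))ᶜ.indicator (1 : ℝ → ℝ)) uniform01 :=
    (integrable_const (1 : ℝ)).indicator measurableSet_Icc.compl
  have hpi : Integrable (otherPieceProb t δ) uniform01 := by
    refine Integrable.of_bound (measurable_otherPieceProb t δ).aestronglyMeasurable 1 ?_
    filter_upwards [hae] with x hx
    have := isProbabilityMeasure_nearLaw hδ0 hδ hx
    rw [otherPieceProb, Real.norm_of_nonneg measureReal_nonneg]
    exact measureReal_le_one
  refine (integral_mono_ae hpi ((integrable_finsetSum _ fun j _ => htent j).add hind)
    hbound).trans ?_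
  rw [integral_add' (integrable_finsetSum _ fun j _ => htent j) hind,
    integral_finsetSum _ fun j _ => htent j, integral_indicator_one measurableSet_Icc.compl]
  refine add_le_add ?_ (uniform01_real_compl_Icc_le hδ0.le)
  calc _ ≤ ∑ j : Fin n, δ / 2 := by
        refine Finset.sum_le_sum fun j _ => ?_
        rw [integral_div, div_le_iff₀ (by positivity)]
        have := integral_tent_le (t := t j) hδ0
        nlinarith
    _ = _ := by simp

/-! ### Runs of the tester and the law of its sample. -/

theorem QueryAlg.run_batch {s : ℕ} {Y : Type u} (a : Fin s → Y) : ∀ (n : ℕ) (idx : Fin n → Fin s)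
    (D : (Fin n → Y) → Bool), (QueryAlg.batch n idx D).run a = D fun j => a (idx j)
  | 0, idx, D => by
      simp only [QueryAlg.batch, QueryAlg.run]
      congr 1
      ext j; exact j.elim0
  | n + 1, idx, D => by
      simp only [QueryAlg.batch, QueryAlg.run]
      rw [QueryAlg.run_batch a n]
      congr 1
      ext j
      refine Fin.cases ?_ (fun j => ?_) j <;> simp

theorem QueryAlg.numQueries_batch {s : ℕ} {Y : Type u} (a : Fin s → Y) :
    ∀ (n : ℕ) (idx : Fin n → Fin s) (D : (Fin n → Y) → Bool),
      (QueryAlg.batch n idx D).numQueries a = n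
  | 0, idx, D => rfl
  | n + 1, idx, D => by
      simp only [QueryAlg.batch, QueryAlg.numQueries]
      rw [QueryAlg.numQueries_batch a n]

theorem numQueries_nsTester_le {Y : Type u} (H : Set (ℝ → Y)) (m l N : ℕ) (δ θ : ℝ) (b : Bool)
    (x : Fin (m + N) → ℝ) (a : Fin (m + N) → Y) :
    (nsTester H m l N δ θ b x).numQueries a ≤ m * (l + 1) := by
  unfold nsTester
  split_ifs
  · rw [QueryAlg.numQueries_batch]
  · exact Nat.zero_le _

/-- The first `l` points of `y` within `δ` of `c`. -/
def firstNear {N l : ℕ} (δ c : ℝ) (y : Fin N → ℝ) (h : l ≤ (nearIndices δ c y).card) :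
    Fin l → ℝ :=
  y ∘ (nearIndices δ c y).orderEmbOfCardLe h

theorem run_nsTester {Y : Type u} (H : Set (ℝ → Y)) {m l N : ℕ} {δ θ : ℝ} {b : Bool}
    {x : Fin (m + N) → ℝ} {c : Fin m → ℝ} {y : Fin N → ℝ} (hc : c = fun i => x (Fin.castAdd N i))
    (hy : y = fun t => x (Fin.natAdd m t)) (hx : ∀ i, l ≤ (nearIndices δ (c i) y).card)
    (f : ℝ → Y) :
    (nsTester H m l N δ θ b x).run (fun i => f (x i)) = decide ((1 / (m : ℝ)) *
      ∑ i, empNSAt H (c i) (f (c i)) (firstNear δ (c i) y (hx i))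
        (fun j => f (firstNear δ (c i) y (hx i) j)) ≤ θ) := by
  subst hc hy
  have hx' : ∀ i, l ≤ (hits δ x i).card := hx
  unfold nsTester
  rw [dif_pos hx', QueryAlg.run_batch]
  simp only [Equiv.symm_apply_apply]
  rfl

theorem empNSAt_le {Y : Type u} {H : Set (ℝ → Y)} {l : ℕ} {x : ℝ} {f : ℝ → Y} {x' : Fin l → ℝ}
    {h : ℝ → Y} (hh : h ∈ H) (hx : f x = h x) :
    empNSAt H x (f x) x' (fun j => f (x' j)) ≤
      (1 / (l : ℝ)) * ∑ j, {w | h w ≠ f w}.indicator (1 : ℝ → ℝ) (x' j) := by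
  classical
  unfold empNSAt
  rw [if_pos ⟨h, hh, hx.symm⟩]
  refine le_trans (csInf_le ?_ (mem_image_of_mem _ ⟨hh, hx.symm⟩)) (le_of_eq ?_)
  · refine ⟨0, ?_⟩
    rintro _ ⟨h', -, rfl⟩
    exact mul_nonneg (by positivity) (Finset.sum_nonneg fun j _ => by split_ifs <;> norm_num)
  · congr 1
    exact Finset.sum_congr rfl fun j _ => by by_cases hj : h (x' j) = f (x' j) <;> simp [hj]

/-- The bound b ≤ 1 covers the default value 1, taken when no member passes through (x, f x). -/
theorem le_empNSAt {Y : Type u} {H : Set (ℝ → Y)} {l : ℕ} {x : ℝ} {f : ℝ → Y} {x' : Fin l → ℝ}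
    {b : ℝ} (hb1 : b ≤ 1) (hb : ∀ h ∈ H, f x = h x →
      b ≤ (1 / (l : ℝ)) * ∑ j, {w | h w ≠ f w}.indicator (1 : ℝ → ℝ) (x' j)) :
    b ≤ empNSAt H x (f x) x' (fun j => f (x' j)) := by
  unfold empNSAt
  split_ifs with hex
  · obtain ⟨h, hh, hx⟩ := hex
    refine le_csInf ⟨_, h, ⟨hh, hx⟩, rfl⟩ ?_
    rintro _ ⟨h', ⟨hh', hx'⟩, rfl⟩
    refine (hb h' hh' hx'.symm).trans (le_of_eq ?_)
    congr 1
    exact Finset.sum_congr rfl fun j _ => by by_cases hj : h' (x' j) = f (x' j) <;> simp [hj]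
  · exact hb1

theorem measurePreserving_split {X : Type*} [MeasurableSpace X] (ν : Measure X)
    [SigmaFinite ν] (m n : ℕ) :
    MeasurePreserving (fun x : Fin (m + n) → X =>
      ((fun i => x (Fin.castAdd n i)), fun j => x (Fin.natAdd m j)))
      (Measure.pi fun _ => ν) ((Measure.pi fun _ => ν).prod (Measure.pi fun _ => ν)) := by
  have hm : Measurable (fun x : Fin (m + n) → X =>
      ((fun i => x (Fin.castAdd n i)), fun j => x (Fin.natAdd m j))) := by fun_prop
  refine ⟨hm, ?_⟩
  rw [← (measurePreserving_append ν m n).map_eq, Measure.map_map hm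
    (measurePreserving_append ν m n).measurable]
  convert Measure.map_id
  ext p j <;> simp

/-- The joint law of the `m` centres and the `N` further sample points. -/
def sampleLaw (m N : ℕ) : Measure ((Fin m → ℝ) × (Fin N → ℝ)) :=
  (Measure.pi fun _ => uniform01).prod (Measure.pi fun _ => uniform01)

instance isProbabilityMeasure_sampleLaw (m N : ℕ) : IsProbabilityMeasure (sampleLaw m N) := by
  unfold sampleLaw; infer_instance

theorem probAtLeast_of_failure_le {R : Type v} [MeasurableSpace R] (ρ : Measure R)
    [IsProbabilityMeasure ρ] {m N : ℕ} {S : Set (R × (Fin (m + N) → ℝ))}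
    {F : Set ((Fin m → ℝ) × (Fin N → ℝ))} (hF : MeasurableSet F)
    (hF3 : sampleLaw m N F ≤ 1 / 3)
    (hS : ∀ r x, ((fun i => x (Fin.castAdd N i)), fun j => x (Fin.natAdd m j)) ∉ F → (r, x) ∈ S) :
    ProbAtLeast (ρ.prod (Measure.pi fun _ : Fin (m + N) => uniform01)) (2 / 3) S := by
  have hsp := measurePreserving_split uniform01 m N
  refine ⟨univ ×ˢ ((fun x : Fin (m + N) → ℝ =>
      ((fun i => x (Fin.castAdd N i)), fun j => x (Fin.natAdd m j))) ⁻¹' Fᶜ), ?_,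
    MeasurableSet.univ.prod (hsp.measurable hF.compl), ?_⟩
  · rintro ⟨r, x⟩ ⟨-, hx⟩
    exact hS r x hx
  · rw [Measure.prod_prod, measure_univ, one_mul,
      hsp.measure_preimage hF.compl.nullMeasurableSet]
    change 2 / 3 ≤ sampleLaw m N Fᶜ
    rw [prob_compl_eq_one_sub hF]
    calc (2 / 3 : ℝ≥0∞) = 1 - 1 / 3 := by
          refine ENNReal.eq_sub_of_add_eq (by simp) ?_
          rw [← ENNReal.add_div, show (2 : ℝ≥0∞) + 1 = 3 by norm_num]
          exact ENNReal.div_self (by simp) (by simp)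
      _ ≤ _ := tsub_le_tsub_left hF3 1

theorem lintegral_onFirstNear_center_le {m N l : ℕ} (hl : 0 < l) (δ : ℝ)
    {g : ℝ × (Fin l → ℝ) → ℝ≥0∞} (hg : Measurable g) {b : ℝ → ℝ≥0∞} (hb : Measurable b)
    (hgb : ∀ c ∈ Icc (0 : ℝ) 1, ∫⁻ z, g (c, z) ∂(Measure.pi fun _ => nearLaw δ c) ≤ b c)
    (i : Fin m) :
    ∫⁻ p, onFirstNear δ g (p.1 i, p.2) ∂(sampleLaw m N) ≤ ∫⁻ c, b c ∂uniform01 := by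
  have hae : ∀ᵐ c ∂uniform01, c ∈ Icc (0 : ℝ) 1 := ae_restrict_mem measurableSet_Icc
  have hev := measurePreserving_eval (fun _ : Fin m => uniform01) i
  have hm : Measurable fun p : (Fin m → ℝ) × (Fin N → ℝ) => onFirstNear δ g (p.1 i, p.2) :=
    (measurable_onFirstNear δ hg).comp (by fun_prop)
  rw [sampleLaw, lintegral_prod _ hm.aemeasurable, ← hev.lintegral_comp hb]
  refine lintegral_mono_ae ?_
  filter_upwards [hev.quasiMeasurePreserving.ae hae] with c hc
  exact (lintegral_onFirstNear_le hl δ (c i) hg).trans (hgb _ hc)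

theorem measurableSet_card_nearIndices_lt {m N l : ℕ} (δ : ℝ) (i : Fin m) :
    MeasurableSet {p : (Fin m → ℝ) × (Fin N → ℝ) | (nearIndices δ (p.1 i) p.2).card < l} := by
  have : {p : (Fin m → ℝ) × (Fin N → ℝ) | (nearIndices δ (p.1 i) p.2).card < l} =
      ⋃ S ∈ {S : Finset (Fin N) | S.card < l},
        {p : (Fin m → ℝ) × (Fin N → ℝ) | nearIndices δ (p.1 i) p.2 = S} := by
    ext p; simp
  rw [this]
  refine MeasurableSet.biUnion (Set.to_countable _) fun S _ => ?_
  exact (measurableSet_nearIndices_eq δ S).preimage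
    (f := fun p : (Fin m → ℝ) × (Fin N → ℝ) => (p.1 i, p.2)) (by fun_prop)

/-- The event that some centre has fewer than `l` further sample points nearby. -/
def fewNear (m N l : ℕ) (δ : ℝ) : Set ((Fin m → ℝ) × (Fin N → ℝ)) :=
  {p | ∃ i, (nearIndices δ (p.1 i) p.2).card < l}

theorem measurableSet_fewNear (m N l : ℕ) (δ : ℝ) : MeasurableSet (fewNear m N l δ) := by
  simp only [fewNear, ofPred_exists]
  exact MeasurableSet.iUnion fun i => measurableSet_card_nearIndices_lt δ i

theorem sampleLaw_fewNear_le {m N l : ℕ} {δ : ℝ} (hδ0 : 0 < δ) (hδ : δ ≤ 1 / 2)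
    (hN : 2 * (l : ℝ) ≤ N * δ) :
    sampleLaw m N (fewNear m N l δ) ≤ ENNReal.ofReal (m * Real.exp (-(N * δ / 8))) := by
  have hae : ∀ᵐ c ∂uniform01, c ∈ Icc (0 : ℝ) 1 := ae_restrict_mem measurableSet_Icc
  have h1 : ∀ i : Fin m, sampleLaw m N {p | (nearIndices δ (p.1 i) p.2).card < l}
      ≤ ENNReal.ofReal (Real.exp (-(N * δ / 8))) := by
    intro i
    have hev := measurePreserving_eval (fun _ : Fin m => uniform01) i
    rw [sampleLaw, Measure.prod_apply (measurableSet_card_nearIndices_lt δ i)]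
    calc _ ≤ ∫⁻ c : Fin m → ℝ, ENNReal.ofReal (Real.exp (-(N * δ / 8)))
          ∂(Measure.pi fun _ => uniform01) := by
          refine lintegral_mono_ae ?_
          filter_upwards [hev.quasiMeasurePreserving.ae hae] with c hc
          exact measure_card_nearIndices_lt_le hδ0 hδ hc hN
      _ = _ := by rw [lintegral_const, measure_univ, mul_one]
  simp only [fewNear, ofPred_exists]
  refine (measure_iUnion_fintype_le _ _).trans ((Finset.sum_le_sum fun i _ => h1 i).trans ?_)
  rw [Finset.sum_const, Finset.card_univ, Fintype.card_fin, nsmul_eq_mul,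
    ENNReal.ofReal_mul (by positivity), ENNReal.ofReal_natCast]

theorem sampleLaw_average_sub_ge_le {m N : ℕ} (hm : 0 < m) {g : ℝ → ℝ} (hg : Measurable g)
    (h0 : ∀ x, 0 ≤ g x) (h1 : ∀ x, g x ≤ 1) {κ : ℝ} (hκ : 0 < κ) :
    sampleLaw m N {p | κ ≤ |(1 / (m : ℝ)) * ∑ i, g (p.1 i) - ∫ x, g x ∂uniform01|}
      ≤ ENNReal.ofReal ((∫ x, g x ∂uniform01) / (m * κ ^ 2)) := by
  have hS : MeasurableSet
      {c : Fin m → ℝ | κ ≤ |(1 / (m : ℝ)) * ∑ i, g (c i) - ∫ x, g x ∂uniform01|} := by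
    apply measurableSet_le measurable_const
    fun_prop
  refine le_trans (le_of_eq ?_) (pi_average_sub_ge_le uniform01 hg h0 h1 hm hκ)
  exact (measurePreserving_fst (μ := Measure.pi fun _ : Fin m => uniform01)
    (ν := Measure.pi fun _ : Fin N => uniform01)).measure_preimage hS.nullMeasurableSet

theorem measurableSet_average_sub_ge {m N : ℕ} {g : ℝ → ℝ} (hg : Measurable g) (κ : ℝ) :
    MeasurableSet {p : (Fin m → ℝ) × (Fin N → ℝ) |
      κ ≤ |(1 / (m : ℝ)) * ∑ i, g (p.1 i) - ∫ x, g x ∂uniform01|} := by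
  apply measurableSet_le measurable_const
  fun_prop

theorem onFirstNear_of_le {N l : ℕ} {δ : ℝ} (g : ℝ × (Fin l → ℝ) → ℝ≥0∞) {c : ℝ} {y : Fin N → ℝ}
    (h : l ≤ (nearIndices δ c y).card) : onFirstNear δ g (c, y) = g (c, firstNear δ c y h) := by
  rw [onFirstNear, dif_pos h]; rfl

/-! ### Numerical constants. -/

theorem nearSample_size_bounds {d l : ℕ} {ε : ℝ} (hd : 0 < d) (hε0 : 0 < ε) (hε : ε < 1 / 2)
    (hl : l = ⌈(120000000 : ℝ) * d / ε ^ 4 * Real.log (10000000000 / ε)⌉₊) :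
    1 ≤ Real.log (10000000000 / ε) ∧
      120000000 * d * Real.log (10000000000 / ε) ≤ ε ^ 4 * l ∧
      ε ^ 4 * l ≤ 240000000 * d * Real.log (10000000000 / ε) := by
  have hd1 : (1 : ℝ) ≤ d := by exact_mod_cast hd
  have hL : 1 ≤ Real.log (10000000000 / ε) := by
    rw [Real.le_log_iff_exp_le (by positivity)]
    have := Real.exp_one_lt_d9
    rw [le_div_iff₀ hε0]
    nlinarith
  set L := Real.log (10000000000 / ε)
  have hε4 : ε ^ 4 ≤ 1 := pow_le_one₀ hε0.le (by linarith)
  have hpos : 0 < (120000000 : ℝ) * d / ε ^ 4 * L := by positivity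
  have h1 := Nat.le_ceil ((120000000 : ℝ) * d / ε ^ 4 * L)
  have h2 := (Nat.ceil_lt_add_one hpos.le).le
  rw [← hl] at h1 h2
  have e : ε ^ 4 * ((120000000 : ℝ) * d / ε ^ 4 * L) = 120000000 * d * L := by field_simp
  have h4 : (0 : ℝ) < ε ^ 4 := by positivity
  refine ⟨hL, ?_, ?_⟩
  · have := mul_le_mul_of_nonneg_left h1 h4.le
    rwa [e] at this
  · have := mul_le_mul_of_nonneg_left h2 h4.le
    rw [mul_add, e] at this
    nlinarith

/-- Everything is compared with powers of X = 10^10/ε. The exponential is at most X^(-11d), because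
120000000/(200·3000·18) > 11; the growth function is at most (1.44·10^9·X^5)^d, and m ≤ 5·10^7·X^4.
A factor X^(-2) remains, with X ≥ 2·10^10. -/
theorem growth_mul_exp_le {d l m : ℕ} {ε : ℝ} (hd : 0 < d) (hε0 : 0 < ε) (hε : ε < 1 / 2)
    (hm : m = ⌈(40000000 : ℝ) / ε ^ 4⌉₊)
    (hl : l = ⌈(120000000 : ℝ) * d / ε ^ 4 * Real.log (10000000000 / ε)⌉₊) :
    m * (2 * ((∑ i ∈ Finset.Iic d, (l + l).choose i : ℕ) *
      Real.exp (-(ε / 200 * (ε ^ 3 / 3000) * l / 18)))) ≤ 1 / 12 := by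
  obtain ⟨hL, hl1, hl2⟩ := nearSample_size_bounds hd hε0 hε hl
  have hd1 : (1 : ℝ) ≤ d := by exact_mod_cast hd
  have hε4 : ε ^ 4 ≤ 1 := pow_le_one₀ hε0.le (by linarith)
  have hε4' : (0 : ℝ) < ε ^ 4 := by positivity
  set X := 10000000000 / ε with hX
  set L := Real.log X with hLdef
  have hX1 : 20000000000 ≤ X := by rw [hX, le_div_iff₀ hε0]; linarith
  have hX0 : 0 < X := by linarith
  have hLX : L ≤ X := (Real.log_le_sub_one_of_pos hX0).trans (by linarith)
  have hεX : 1 / ε ≤ X := by rw [hX]; gcongr; norm_num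
  have hεX4 : 1 / ε ^ 4 ≤ X ^ 4 := by
    rw [← one_div_pow]; exact pow_le_pow_left₀ (by positivity) hεX 4
  have hdl : (d : ℝ) ≤ l := by
    have h1 : ε ^ 4 * l ≤ 1 * l := by gcongr
    nlinarith
  have hsum := sum_choose_le_pow (n := l + l) hd (by
    have : d ≤ l := by exact_mod_cast hdl
    omega)
  have hbase : Real.exp 1 * ((l + l : ℕ) : ℝ) / d ≤ 1440000000 * X ^ 5 := by
    have he : Real.exp 1 ≤ 3 := by have := Real.exp_one_lt_d9; linarith
    rw [div_le_iff₀ (by positivity)]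
    have h1 : (l : ℝ) ≤ 240000000 * d * L * (1 / ε ^ 4) := by
      rw [mul_one_div, le_div_iff₀ hε4']; linarith
    have h2 : 240000000 * d * L * (1 / ε ^ 4) ≤ 240000000 * d * X * X ^ 4 := by gcongr
    push_cast
    calc Real.exp 1 * (l + l) ≤ 3 * (240000000 * d * X * X ^ 4 + 240000000 * d * X * X ^ 4) := by
          gcongr <;> linarith
      _ = _ := by ring
  have hexp : Real.exp (-(ε / 200 * (ε ^ 3 / 3000) * l / 18)) ≤ ((X ^ 11)⁻¹) ^ d := by
    have : ((X ^ 11)⁻¹) ^ d = Real.exp (-(11 * d * L)) := by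
      have e : X ^ 11 = Real.exp (11 * L) := by
        rw [show (11 : ℝ) * L = (11 : ℕ) * L by norm_num, Real.exp_nat_mul, Real.exp_log hX0]
      rw [e, ← Real.exp_neg, ← Real.exp_nat_mul]
      congr 1; ring
    rw [this, Real.exp_le_exp]
    have : ε / 200 * (ε ^ 3 / 3000) * l / 18 = ε ^ 4 * l / 10800000 := by ring
    rw [this]
    have : 0 ≤ (d : ℝ) * L := by positivity
    linarith
  have hZ : (1440000000 * X ^ 5) * (X ^ 11)⁻¹ = 1440000000 / X ^ 6 := by field_simp
  have hZ1 : 1440000000 / X ^ 6 ≤ 1 := by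
    rw [div_le_one (by positivity)]
    calc (1440000000 : ℝ) ≤ X := by linarith
      _ = X ^ 1 := by ring
      _ ≤ X ^ 6 := pow_le_pow_right₀ (by linarith) (by norm_num)
  have hprod : ((∑ i ∈ Finset.Iic d, (l + l).choose i : ℕ) : ℝ) *
      Real.exp (-(ε / 200 * (ε ^ 3 / 3000) * l / 18)) ≤ 1440000000 / X ^ 6 := by
    calc _ ≤ (1440000000 * X ^ 5) ^ d * ((X ^ 11)⁻¹) ^ d := by
          refine mul_le_mul (hsum.trans ?_) hexp (Real.exp_pos _).le (by positivity)
          exact pow_le_pow_left₀ (by positivity) hbase d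
      _ = (1440000000 / X ^ 6) ^ d := by rw [← mul_pow, hZ]
      _ ≤ _ := pow_le_of_le_one (by positivity) hZ1 hd.ne'
  have hmX : (m : ℝ) ≤ 50000000 * X ^ 4 := by
    have h1 := (Nat.ceil_lt_add_one (show 0 ≤ (40000000 : ℝ) / ε ^ 4 by positivity)).le
    rw [← hm] at h1
    have h2 : (40000000 : ℝ) / ε ^ 4 ≤ 40000000 * X ^ 4 := by
      rw [div_eq_mul_one_div]; gcongr
    have h3 : (1 : ℝ) ≤ X ^ 4 := one_le_pow₀ (by linarith)
    linarith
  calc _ ≤ (50000000 * X ^ 4) * (2 * (1440000000 / X ^ 6)) := by gcongr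
    _ = 144000000000000000 / X ^ 2 := by field_simp; norm_num
    _ ≤ 1 / 12 := by
      rw [div_le_div_iff₀ (by positivity) (by norm_num)]
      nlinarith

theorem fewNear_bound_arith {m l N : ℕ} {δ : ℝ} (hδ : 0 < δ) (hm : 0 < m)
    (hN : N = ⌈max (2 * l / δ) (8 / δ * Real.log (12 * m))⌉₊) :
    2 * (l : ℝ) ≤ N * δ ∧ m * Real.exp (-(N * δ / 8)) ≤ 1 / 12 := by
  have hm' : (0 : ℝ) < m := by exact_mod_cast hm
  have h := Nat.le_ceil (max (2 * l / δ) (8 / δ * Real.log (12 * m)))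
  rw [← hN] at h
  have h1 := (le_max_left _ _).trans h
  have h2 := (le_max_right _ _).trans h
  constructor
  · rwa [div_le_iff₀ hδ] at h1
  · have h3 : Real.log (12 * m) ≤ N * δ / 8 := by
      rw [div_mul_eq_mul_div, div_le_iff₀ hδ] at h2
      linarith
    have h4 : Real.exp (-(N * δ / 8)) ≤ (12 * (m : ℝ))⁻¹ := by
      rw [Real.exp_neg]
      gcongr
      rwa [← Real.log_le_iff_le_exp (by positivity)]
    calc _ ≤ m * (12 * (m : ℝ))⁻¹ := by gcongr
      _ = 1 / 12 := by field_simp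

/-- From kε ≥ 80 follows δ ≤ ε³/2560, so the end loss 2δ and the sampling error ε³/2000 fit into the
slack (k-1)(δ/2)ε/8, which is close to ε³/512. -/
theorem accept_threshold_arith {ε δ k : ℝ} (hε : ε < 1 / 2) (hδ : 0 < δ)
    (hk : 80 ≤ k * ε) (hδk : δ * k = ε ^ 2 / 32) :
    (k - 1) * (δ / 2) + 2 * δ ≤ ε ^ 2 / 60 ∧
      (k - 1) * (δ / 2) + 2 * δ + ε ^ 3 / 2000 ≤ (k - 1) * (δ / 2) * (1 + ε / 8) := by
  have h1 : δ * 80 ≤ ε ^ 3 / 32 := by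
    calc δ * 80 ≤ δ * (k * ε) := by gcongr
      _ = ε ^ 3 / 32 := by rw [← mul_assoc, hδk]; ring
  have h2 : ε ^ 3 ≤ ε ^ 2 / 2 := by nlinarith [sq_nonneg ε]
  have h3 : δ * ε ≤ δ / 2 := by nlinarith
  constructor
  · nlinarith
  · have e : (k - 1) * (δ / 2) * (1 + ε / 8)
        = (k - 1) * (δ / 2) + (δ * k) * ε / 16 - δ * ε / 16 := by ring
    rw [e, hδk]
    nlinarith

/-- The gap between 1+ε/8 and 1+ε/6 pays for a relative loss ε/200 at the centres, another in the
local samples, and the additive ε³/3000. -/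
theorem reject_threshold_arith {ε δ k μ : ℝ} (hε0 : 0 < ε) (hε : ε < 1 / 2) (hδ : 0 < δ)
    (hk : 80 ≤ k * ε) (hδk : δ * k = ε ^ 2 / 32) (hμ : (k - 1) * (δ / 2) * (1 + ε / 6) < μ) :
    ε ^ 2 / 65 ≤ μ ∧ (k - 1) * (δ / 2) * (1 + ε / 8) <
      (1 - ε / 200) * ((1 - ε / 200) * μ) - ε ^ 3 / 3000 := by
  have h1 : δ * 80 ≤ ε ^ 3 / 32 := by
    calc δ * 80 ≤ δ * (k * ε) := by gcongr
      _ = ε ^ 3 / 32 := by rw [← mul_assoc, hδk]; ring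
  have h2 : ε ^ 3 ≤ ε ^ 2 / 2 := by nlinarith [sq_nonneg ε]
  set P := (k - 1) * (δ / 2) with hP
  have hP1 : ε ^ 2 / 65 ≤ P := by
    have : P = (δ * k) / 2 - δ / 2 := by rw [hP]; ring
    rw [this, hδk]; linarith
  have hP0 : 0 < P := lt_of_lt_of_le (by positivity) hP1
  have hPε : 0 < P * ε := by positivity
  refine ⟨by nlinarith, ?_⟩
  have h3 : (1 - ε / 100) * μ ≤ (1 - ε / 200) * ((1 - ε / 200) * μ) := by
    have hμ0 : 0 < μ := lt_trans (by positivity) hμ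
    nlinarith [mul_pos (mul_pos hε0 hε0) hμ0]
  have h4 : (1 - ε / 100) * (P * (1 + ε / 6)) < (1 - ε / 100) * μ :=
    mul_lt_mul_of_pos_left hμ (by linarith)
  have h5 : ε ^ 3 / 65 ≤ P * ε := by nlinarith
  have h6 : P * ε * ε ≤ P * ε / 2 := by nlinarith
  have e : (1 - ε / 100) * (P * (1 + ε / 6))
      = P + P * ε / 6 - P * ε / 100 - P * ε * ε / 600 := by ring
  have e2 : P * (1 + ε / 8) = P + P * ε / 8 := by ring
  rw [e2]
  nlinarith

/-! ### Acceptance of piecewise targets. -/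

/-- The squared deviation of the empirical frequency of other pieces from its mean. -/
def pieceDeviationSq {n l : ℕ} (t : Fin n → ℝ) (δ : ℝ) (q : ℝ × (Fin l → ℝ)) : ℝ :=
  ((1 / (l : ℝ)) * ∑ j, {r : ℝ × ℝ | pieceIndex t r.2 ≠ pieceIndex t r.1}.indicator 1 (q.1, q.2 j)
    - otherPieceProb t δ q.1) ^ 2

theorem measurable_pieceDeviationSq {n l : ℕ} (t : Fin n → ℝ) (δ : ℝ) :
    Measurable (pieceDeviationSq (l := l) t δ) := by
  have h1 := measurable_otherPieceProb t δ
  have h2 : Measurable ({r : ℝ × ℝ | pieceIndex t r.2 ≠ pieceIndex t r.1}.indicator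
      (1 : ℝ × ℝ → ℝ)) := measurable_one.indicator (measurableSet_ne_pieceIndex t)
  unfold pieceDeviationSq
  refine Measurable.pow_const (Measurable.sub (Measurable.const_mul
    (Finset.measurable_fun_sum _ fun j _ => h2.comp (by fun_prop)) _) (h1.comp measurable_fst)) 2

theorem pieceDeviationSq_nonneg {n l : ℕ} (t : Fin n → ℝ) (δ : ℝ) (q : ℝ × (Fin l → ℝ)) :
    0 ≤ pieceDeviationSq t δ q :=
  sq_nonneg _

theorem otherPieceProb_nonneg {n : ℕ} (t : Fin n → ℝ) (δ x : ℝ) : 0 ≤ otherPieceProb t δ x :=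
  measureReal_nonneg

theorem otherPieceProb_le_one {n : ℕ} (t : Fin n → ℝ) (δ x : ℝ) : otherPieceProb t δ x ≤ 1 := by
  unfold otherPieceProb nearLaw
  exact measureReal_le_one

theorem lintegral_pieceDeviationSq_le {n l : ℕ} (hl : 0 < l) (t : Fin n → ℝ) {δ c : ℝ}
    (hδ0 : 0 < δ) (hδ : δ ≤ 1 / 2) (hc : c ∈ Icc (0 : ℝ) 1) :
    ∫⁻ z : Fin l → ℝ, ENNReal.ofReal (pieceDeviationSq t δ (c, z))
      ∂(Measure.pi fun _ => nearLaw δ c) ≤ ENNReal.ofReal (otherPieceProb t δ c / l) := by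
  have := isProbabilityMeasure_nearLaw hδ0 hδ hc
  have hm : MeasurableSet {w | pieceIndex t w ≠ pieceIndex t c} :=
    (measurableSet_ne_pieceIndex t).preimage measurable_prodMk_left
  have h := lintegral_sq_average_sub_le (nearLaw δ c)
    (g := {w | pieceIndex t w ≠ pieceIndex t c}.indicator 1) (measurable_one.indicator hm)
    (fun x => indicator_nonneg (by simp) _) (fun x => indicator_le_self' (by simp) x) hl
  rw [integral_indicator_one hm] at h
  exact h

/-- The failure event for a piecewise target. -/
def acceptFailure {n : ℕ} (m N l : ℕ) (t : Fin n → ℝ) (δ γ : ℝ) :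
    Set ((Fin m → ℝ) × (Fin N → ℝ)) :=
  fewNear m N l δ ∪
    {p | γ ≤ |(1 / (m : ℝ)) * ∑ i, otherPieceProb t δ (p.1 i)
      - ∫ x, otherPieceProb t δ x ∂uniform01|} ∪
    {p | ENNReal.ofReal (m * γ ^ 2) ≤ ∑ i, onFirstNear δ
      (fun q : ℝ × (Fin l → ℝ) => ENNReal.ofReal (pieceDeviationSq t δ q)) (p.1 i, p.2)}

theorem measurable_onFirstNear_center {m N l : ℕ} (δ : ℝ) {g : ℝ × (Fin l → ℝ) → ℝ≥0∞}
    (hg : Measurable g) (i : Fin m) :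
    Measurable fun p : (Fin m → ℝ) × (Fin N → ℝ) => onFirstNear δ g (p.1 i, p.2) :=
  (measurable_onFirstNear δ hg).comp (by fun_prop)

theorem measurable_sum_onFirstNear {m N l : ℕ} (δ : ℝ) {g : ℝ × (Fin l → ℝ) → ℝ≥0∞}
    (hg : Measurable g) : Measurable fun p : (Fin m → ℝ) × (Fin N → ℝ) =>
      ∑ i, onFirstNear δ g (p.1 i, p.2) :=
  Finset.measurable_fun_sum _ fun i _ => measurable_onFirstNear_center δ hg i

theorem lintegral_sum_onFirstNear_le {m N l : ℕ} (hl : 0 < l) (δ : ℝ)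
    {g : ℝ × (Fin l → ℝ) → ℝ≥0∞} (hg : Measurable g) {b : ℝ → ℝ≥0∞} (hb : Measurable b)
    (hgb : ∀ c ∈ Icc (0 : ℝ) 1, ∫⁻ z, g (c, z) ∂(Measure.pi fun _ => nearLaw δ c) ≤ b c) :
    ∫⁻ p, ∑ i, onFirstNear δ g (p.1 i, p.2) ∂(sampleLaw m N) ≤ m * ∫⁻ c, b c ∂uniform01 := by
  rw [lintegral_finsetSum _ fun i _ => measurable_onFirstNear_center δ hg i]
  refine (Finset.sum_le_sum fun i _ => lintegral_onFirstNear_center_le hl δ hg hb hgb i).trans ?_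
  simp

theorem measurableSet_acceptFailure {n : ℕ} (m N l : ℕ) (t : Fin n → ℝ) (δ γ : ℝ) :
    MeasurableSet (acceptFailure m N l t δ γ) := by
  refine ((measurableSet_fewNear m N l δ).union
    (measurableSet_average_sub_ge (measurable_otherPieceProb t δ) γ)).union ?_
  exact measurableSet_le measurable_const
    (measurable_sum_onFirstNear δ (measurable_pieceDeviationSq t δ).ennreal_ofReal)

theorem sampleLaw_acceptFailure_le {n m N l : ℕ} (hm : 0 < m) (hl : 0 < l) (t : Fin n → ℝ)
    {δ γ b : ℝ} (hδ0 : 0 < δ) (hδ : δ ≤ 1 / 2) (hγ : 0 < γ) (hN : 2 * (l : ℝ) ≤ N * δ)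
    (hb : ∫ x, otherPieceProb t δ x ∂uniform01 ≤ b) :
    sampleLaw m N (acceptFailure m N l t δ γ) ≤
      ENNReal.ofReal (m * Real.exp (-(N * δ / 8)) + b / (m * γ ^ 2) + b / (l * γ ^ 2)) := by
  have hm' : (0 : ℝ) < m := by exact_mod_cast hm
  have hl' : (0 : ℝ) < l := by exact_mod_cast hl
  have hp0 : 0 ≤ ∫ x, otherPieceProb t δ x ∂uniform01 :=
    integral_nonneg fun x => otherPieceProb_nonneg t δ x
  have hb0 : 0 ≤ b := hp0.trans hb
  have hpm := measurable_otherPieceProb t δ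
  have hpi : Integrable (otherPieceProb t δ) uniform01 := Integrable.of_bound
    hpm.aestronglyMeasurable 1 (Filter.Eventually.of_forall fun x => by
      rw [Real.norm_of_nonneg (otherPieceProb_nonneg t δ x)]; exact otherPieceProb_le_one t δ x)
  rw [ENNReal.ofReal_add (by positivity) (by positivity),
    ENNReal.ofReal_add (by positivity) (by positivity)]
  refine (measure_union_le _ _).trans (add_le_add ((measure_union_le _ _).trans
    (add_le_add (sampleLaw_fewNear_le hδ0 hδ hN) ?_)) ?_)
  · refine (sampleLaw_average_sub_ge_le hm hpm (otherPieceProb_nonneg t δ)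
      (otherPieceProb_le_one t δ) hγ).trans (ENNReal.ofReal_le_ofReal ?_)
    gcongr
  · have hg := (measurable_pieceDeviationSq (l := l) t δ).ennreal_ofReal
    refine (meas_ge_le_lintegral_div (measurable_sum_onFirstNear δ hg).aemeasurable
      (ENNReal.ofReal_pos.2 (by positivity)).ne' ENNReal.ofReal_ne_top).trans ?_
    have hsum : ∫⁻ p, ∑ i, onFirstNear δ
        (fun q : ℝ × (Fin l → ℝ) => ENNReal.ofReal (pieceDeviationSq t δ q)) (p.1 i, p.2)
        ∂(sampleLaw m N) ≤ ENNReal.ofReal (m * (b / l)) := by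
      refine (lintegral_sum_onFirstNear_le hl δ hg
        (b := fun c => ENNReal.ofReal (otherPieceProb t δ c / l)) (hpm.div_const _).ennreal_ofReal
        (fun c hc => lintegral_pieceDeviationSq_le hl t hδ0 hδ hc)).trans ?_
      rw [← ofReal_integral_eq_lintegral_ofReal (hpi.div_const _)
        (Filter.Eventually.of_forall fun x => div_nonneg (otherPieceProb_nonneg t δ x) hl'.le),
        integral_div, ENNReal.ofReal_mul hm'.le, ENNReal.ofReal_natCast]
      gcongr
    refine (ENNReal.div_le_div_right hsum _).trans ?_
    rw [← ENNReal.ofReal_div_of_pos (by positivity)]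
    apply ENNReal.ofReal_le_ofReal
    apply le_of_eq
    field_simp

theorem empirical_le_of_notMem_acceptFailure {Y : Type u} {H : Set (ℝ → Y)} {k m N l : ℕ}
    (hm : 0 < m) {f : ℝ → Y} (hk : 0 < k) {h : Fin k → ℝ → Y} {t : Fin (k - 1) → ℝ}
    (hh : ∀ i, h i ∈ H)
    (hf : ∀ x, f x = h ⟨pieceIndex t x, (pieceIndex_le t x).trans_lt (by omega)⟩ x)
    {δ γ : ℝ} (hγ : 0 < γ) {c : Fin m → ℝ} {y : Fin N → ℝ}
    (hF : (c, y) ∉ acceptFailure m N l t δ γ)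
    (hy : ∀ i, l ≤ (nearIndices δ (c i) y).card) :
    (1 / (m : ℝ)) * ∑ i, empNSAt H (c i) (f (c i)) (firstNear δ (c i) y (hy i))
        (fun j => f (firstNear δ (c i) y (hy i) j)) ≤
      ∫ x, otherPieceProb t δ x ∂uniform01 + 2 * γ := by
  have hm' : (0 : ℝ) < m := by exact_mod_cast hm
  simp only [acceptFailure, mem_union, not_or, mem_ofPred_eq, not_le] at hF
  obtain ⟨⟨-, h2⟩, h3⟩ := hF
  simp_rw [fun i => onFirstNear_of_le (fun q : ℝ × (Fin l → ℝ) =>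
    ENNReal.ofReal (pieceDeviationSq t δ q)) (hy i)] at h3
  rw [← ENNReal.ofReal_sum_of_nonneg fun i _ => pieceDeviationSq_nonneg t δ _,
    ENNReal.ofReal_lt_ofReal_iff (by positivity)] at h3
  have h4 := (abs_lt.1 h2).2
  have hW : ∀ i, empNSAt H (c i) (f (c i)) (firstNear δ (c i) y (hy i))
      (fun j => f (firstNear δ (c i) y (hy i) j)) ≤ otherPieceProb t δ (c i) + γ / 2 +
        pieceDeviationSq t δ (c i, firstNear δ (c i) y (hy i)) / (2 * γ) := by
    intro i
    refine (empNSAt_le (hh _) (hf (c i))).trans ?_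
    set W := (1 / (l : ℝ)) * ∑ j, {r : ℝ × ℝ | pieceIndex t r.2 ≠ pieceIndex t r.1}.indicator
      (1 : ℝ × ℝ → ℝ) (c i, firstNear δ (c i) y (hy i) j) with hWdef
    have h5 : (1 / (l : ℝ)) * ∑ j, {w | h ⟨pieceIndex t (c i), (pieceIndex_le t _).trans_lt
        (by omega)⟩ w ≠ f w}.indicator (1 : ℝ → ℝ) (firstNear δ (c i) y (hy i) j) ≤ W := by
      rw [hWdef]
      gcongr with j
      set v := firstNear δ (c i) y (hy i) j
      by_cases hv : pieceIndex t v = pieceIndex t (c i)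
      · rw [indicator_of_notMem]
        · exact indicator_nonneg (by simp) _
        · rw [mem_ofPred_eq, not_not, hf v]
          simp only [hv]
      · rw [indicator_of_mem (a := (c i, v)) hv]
        exact indicator_le_self' (by simp) v
    refine h5.trans ?_
    have h6 : pieceDeviationSq t δ (c i, firstNear δ (c i) y (hy i))
        = (W - otherPieceProb t δ (c i)) ^ 2 := rfl
    rw [h6]
    -- Linearizing the deviation against its square means that only the sum of squares over the
    -- centres must be controlled, with no union bound over centres.
    have h9 : W - otherPieceProb t δ (c i) - γ / 2 ≤ (W - otherPieceProb t δ (c i)) ^ 2 / (2 * γ) := by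
      rw [le_div_iff₀ (by positivity)]
      nlinarith [sq_nonneg (W - otherPieceProb t δ (c i) - γ)]
    linarith
  have hsum := Finset.sum_le_sum fun i (_ : i ∈ Finset.univ) => hW i
  rw [Finset.sum_add_distrib, Finset.sum_add_distrib, ← Finset.sum_div _ _ (2 * γ)] at hsum
  simp only [Finset.sum_const, Finset.card_univ, Fintype.card_fin, nsmul_eq_mul] at hsum
  have h7 : (∑ i, pieceDeviationSq t δ (c i, firstNear δ (c i) y (hy i))) / (2 * γ) ≤ m * (γ / 2) := by
    rw [div_le_iff₀ (by positivity)]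
    nlinarith
  have h8 : ∑ i, empNSAt H (c i) (f (c i)) (firstNear δ (c i) y (hy i))
        (fun j => f (firstNear δ (c i) y (hy i) j)) ≤ ∑ i, otherPieceProb t δ (c i) + m * γ := by
    linarith
  calc _ ≤ 1 / (m : ℝ) * (∑ i, otherPieceProb t δ (c i) + m * γ) := by gcongr
    _ = 1 / (m : ℝ) * ∑ i, otherPieceProb t δ (c i) + γ := by field_simp
    _ ≤ _ := by linarith

/-! ### Rejection of distant targets. -/

/-- The failure event for a target far from piecewise. -/
def rejectFailure {Y : Type u} (G : Set (ℝ → Y)) (f : ℝ → Y) (m N : ℕ) {l : ℕ} (δ a : ℝ)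
    (E : Set (ℝ × (Fin l → ℝ))) : Set ((Fin m → ℝ) × (Fin N → ℝ)) :=
  fewNear m N l δ ∪
    {p | a * ∫ x, lowerNS G f δ x ∂uniform01 ≤ |(1 / (m : ℝ)) * ∑ i, lowerNS G f δ (p.1 i)
      - ∫ x, lowerNS G f δ x ∂uniform01|} ∪
    {p | 1 ≤ ∑ i, onFirstNear δ (E.indicator 1) (p.1 i, p.2)} ∪
    {p | ∃ i, p.1 i ∉ Icc (0 : ℝ) 1}

theorem measurableSet_exists_notMem_Icc (m N : ℕ) :
    MeasurableSet {p : (Fin m → ℝ) × (Fin N → ℝ) | ∃ i, p.1 i ∉ Icc (0 : ℝ) 1} := by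
  simp only [ofPred_exists]
  refine MeasurableSet.iUnion fun i => ?_
  exact (measurableSet_Icc (a := (0 : ℝ)) (b := 1)).compl.preimage
    (f := fun p : (Fin m → ℝ) × (Fin N → ℝ) => p.1 i) (by fun_prop)

/-- This null event is added to the failures because the exceptional set is controlled only for
centres in the unit interval. -/
theorem sampleLaw_exists_notMem_Icc (m N : ℕ) :
    sampleLaw m N {p | ∃ i, p.1 i ∉ Icc (0 : ℝ) 1} = 0 := by
  simp only [ofPred_exists]
  refine measure_iUnion_null fun i => ?_
  have hae : ∀ᵐ c ∂uniform01, c ∈ Icc (0 : ℝ) 1 := ae_restrict_mem measurableSet_Icc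
  have hp : MeasurePreserving (fun p : (Fin m → ℝ) × (Fin N → ℝ) => p.1 i) (sampleLaw m N)
      uniform01 := (measurePreserving_eval (fun _ : Fin m => uniform01) i).comp
        measurePreserving_fst
  exact hp.quasiMeasurePreserving.ae hae

theorem measurableSet_rejectFailure {Y : Type u} {G : Set (ℝ → Y)} {f : ℝ → Y} (m N : ℕ)
    {l : ℕ} {δ : ℝ} (a : ℝ) {E : Set (ℝ × (Fin l → ℝ))} (hN : Measurable (lowerNS G f δ))
    (hE : MeasurableSet E) : MeasurableSet (rejectFailure G f m N δ a E) := by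
  refine ((((measurableSet_fewNear m N l δ).union
    (measurableSet_average_sub_ge hN _)).union ?_).union (measurableSet_exists_notMem_Icc m N))
  exact measurableSet_le measurable_const
    (measurable_sum_onFirstNear δ (measurable_one.indicator hE))

theorem sampleLaw_rejectFailure_le {Y : Type u} {G : Set (ℝ → Y)} (hG : G.Nonempty) {f : ℝ → Y}
    {m N l : ℕ} (hm : 0 < m) (hl : 0 < l) {δ a b η : ℝ} (hδ0 : 0 < δ) (hδ : δ ≤ 1 / 2) (ha : 0 < a)
    (hNδ : 2 * (l : ℝ) ≤ N * δ) {E : Set (ℝ × (Fin l → ℝ))} (hN : Measurable (lowerNS G f δ))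
    (hE : MeasurableSet E) (hη : 0 ≤ η)
    (hEη : ∀ x ∈ Icc (0 : ℝ) 1, (Measure.pi fun _ => nearLaw δ x) {y | (x, y) ∈ E} ≤
      ENNReal.ofReal η) (hb0 : 0 < b) (hb : b ≤ ∫ x, lowerNS G f δ x ∂uniform01) :
    sampleLaw m N (rejectFailure G f m N δ a E) ≤
      ENNReal.ofReal (m * Real.exp (-(N * δ / 8)) + 1 / (m * a ^ 2 * b) + m * η) := by
  have hm' : (0 : ℝ) < m := by exact_mod_cast hm
  have hμ0 := hb0.trans_le hb
  rw [ENNReal.ofReal_add (by positivity) (by positivity),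
    ENNReal.ofReal_add (by positivity) (by positivity)]
  refine (measure_union_le _ _).trans ?_
  rw [sampleLaw_exists_notMem_Icc, add_zero]
  refine (measure_union_le _ _).trans (add_le_add ((measure_union_le _ _).trans
    (add_le_add (sampleLaw_fewNear_le hδ0 hδ hNδ) ?_)) ?_)
  · refine (sampleLaw_average_sub_ge_le hm hN (lowerNS_nonneg G f hδ0)
      (lowerNS_le_one hG f hδ0) (mul_pos ha hμ0)).trans (ENNReal.ofReal_le_ofReal ?_)
    set μ := ∫ x, lowerNS G f δ x ∂uniform01
    -- The deviation is measured relative to the mean, so the bound decreases in μ and a lower bound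
    -- on μ is enough.
    calc μ / (m * (a * μ) ^ 2) = 1 / (m * a ^ 2 * μ) := by field_simp
      _ ≤ _ := by gcongr
  · have hg : Measurable (E.indicator (1 : ℝ × (Fin l → ℝ) → ℝ≥0∞)) := measurable_one.indicator hE
    have hM := mul_meas_ge_le_lintegral (μ := sampleLaw m N)
      (measurable_sum_onFirstNear (m := m) (N := N) δ hg) 1
    rw [one_mul] at hM
    refine hM.trans ?_
    refine (lintegral_sum_onFirstNear_le hl δ hg (b := fun _ => ENNReal.ofReal η)
      measurable_const fun c hc => ?_).trans (le_of_eq ?_)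
    · refine le_trans (le_of_eq ?_) (hEη c hc)
      exact lintegral_indicator_one (hE.preimage measurable_prodMk_left)
    · rw [lintegral_const, measure_univ, mul_one, ENNReal.ofReal_mul hm'.le,
        ENNReal.ofReal_natCast]

theorem le_empirical_of_notMem_rejectFailure {Y : Type u} [MeasurableSpace Y] [MeasurableEq Y]
    {H G : Set (ℝ → Y)} (hHm : ∀ h ∈ H, Measurable h) (hG : G.Nonempty) {f : ℝ → Y}
    (hf : Measurable f) (hGH : ∀ h ∈ H, h ∉ G → uniform01 (agreeSet f h) = 0) {m N l : ℕ}
    (hm : 0 < m) {δ a α β : ℝ} (hδ0 : 0 < δ) (hδ : δ ≤ 1 / 2) (hα0 : 0 ≤ α) (hα : α ≤ 1)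
    (hβ : 0 ≤ β) {E : Set (ℝ × (Fin l → ℝ))}
    (hE : ∀ x ∈ Icc (0 : ℝ) 1, ∀ y, (x, y) ∉ E → ∀ h ∈ H,
        (1 - α) * (nearLaw δ x).real {w | h w ≠ f w} - β ≤
          (1 / (l : ℝ)) * ∑ j, {w | h w ≠ f w}.indicator (1 : ℝ → ℝ) (y j))
    {c : Fin m → ℝ} {y : Fin N → ℝ} (hF : (c, y) ∉ rejectFailure G f m N δ a E)
    (hy : ∀ i, l ≤ (nearIndices δ (c i) y).card) :
    (1 - α) * ((1 - a) * ∫ x, lowerNS G f δ x ∂uniform01) - β ≤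
      (1 / (m : ℝ)) * ∑ i, empNSAt H (c i) (f (c i)) (firstNear δ (c i) y (hy i))
        (fun j => f (firstNear δ (c i) y (hy i) j)) := by
  have hm' : (0 : ℝ) < m := by exact_mod_cast hm
  simp only [rejectFailure, mem_union, not_or, mem_ofPred_eq, not_le, not_exists, not_not] at hF
  obtain ⟨⟨⟨-, h2⟩, h3⟩, h01⟩ := hF
  simp_rw [fun i => onFirstNear_of_le (E.indicator 1) (hy i)] at h3
  have hnE : ∀ i, (c i, firstNear δ (c i) y (hy i)) ∉ E := by
    intro i hi
    refine absurd h3 (not_lt.2 (le_trans ?_ (Finset.single_le_sum (fun _ _ => zero_le)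
      (Finset.mem_univ i))))
    rw [indicator_of_mem hi, Pi.one_apply]
  have h4 := (abs_lt.1 h2).1
  have hi : ∀ i, (1 - α) * lowerNS G f δ (c i) - β ≤ empNSAt H (c i) (f (c i))
      (firstNear δ (c i) y (hy i)) (fun j => f (firstNear δ (c i) y (hy i) j)) := by
    intro i
    refine le_empNSAt ?_ fun h hh hfx => ?_
    · have h5 := lowerNS_le_one hG f hδ0 (c i)
      have h6 := lowerNS_nonneg G f hδ0 (c i)
      nlinarith
    · refine le_trans ?_ (hE (c i) (h01 i) _ (hnE i) h hh)
      have := lowerNS_le_nearLaw hHm hG hf hGH hδ0 hδ (h01 i) hh hfx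
      gcongr
  have hsum := Finset.sum_le_sum fun i (_ : i ∈ Finset.univ) => hi i
  rw [Finset.sum_sub_distrib, ← Finset.mul_sum] at hsum
  simp only [Finset.sum_const, Finset.card_univ, Fintype.card_fin, nsmul_eq_mul] at hsum
  calc _ ≤ (1 - α) * (1 / (m : ℝ) * ∑ i, lowerNS G f δ (c i)) - β := by
        refine sub_le_sub_right (mul_le_mul_of_nonneg_left ?_ (by linarith)) β
        linarith
    _ = 1 / (m : ℝ) * ((1 - α) * ∑ i, lowerNS G f δ (c i) - m * β) := by field_simp
    _ ≤ _ := by gcongr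

/-! ### Assembly of the tester guarantees. -/

theorem ofReal_le_one_third {r : ℝ} (h : r ≤ 1 / 3) : ENNReal.ofReal r ≤ 1 / 3 := by
  refine (ENNReal.ofReal_le_ofReal h).trans (le_of_eq ?_)
  rw [ENNReal.ofReal_div_of_pos (by norm_num)]
  simp

theorem near_scale_facts {ε δ : ℝ} {k : ℕ} (hε0 : 0 < ε) (hε : ε < 1 / 2) (hk : 80 / ε ≤ k)
    (hδ : δ = ε ^ 2 / (32 * k)) :
    0 < k ∧ 80 ≤ k * ε ∧ 0 < δ ∧ δ ≤ 1 / 2 ∧ δ * k = ε ^ 2 / 32 := by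
  have hk' : (0 : ℝ) < k := lt_of_lt_of_le (by positivity) hk
  have hk1 : (1 : ℝ) ≤ k := by
    have : 0 < k := by exact_mod_cast hk'
    exact_mod_cast this
  have hδ0 : 0 < δ := by rw [hδ]; positivity
  have hδk : δ * k = ε ^ 2 / 32 := by rw [hδ]; field_simp
  refine ⟨by exact_mod_cast hk', by rwa [div_le_iff₀ hε0] at hk, hδ0, ?_, hδk⟩
  nlinarith

theorem nsTester_accepts {Y : Type u} {H : Set (ℝ → Y)} {d : ℕ} (hd : 0 < d) {ε : ℝ}
    (hε0 : 0 < ε) (hε : ε < 1 / 2) {k : ℕ} (hk : 80 / ε ≤ (k : ℝ)) {δ : ℝ} {m l N : ℕ}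
    (hδ : δ = ε ^ 2 / (32 * k)) (hm : m = ⌈(40000000 : ℝ) / ε ^ 4⌉₊)
    (hl : l = ⌈(120000000 : ℝ) * d / ε ^ 4 * Real.log (10000000000 / ε)⌉₊)
    (hN : N = ⌈max (2 * l / δ) (8 / δ * Real.log (12 * m))⌉₊) {R : Type v} [MeasurableSpace R]
    (ρ : Measure R) [IsProbabilityMeasure ρ] (fail : R → (Fin (m + N) → ℝ) → Bool) {f : ℝ → Y}
    (hfF : f ∈ piecewiseClass k H) :
    ProbAtLeast (ρ.prod (Measure.pi fun _ : Fin (m + N) => uniform01)) (2 / 3)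
      {ω | (nsTester H m l N δ (((k : ℝ) - 1) * (δ / 2) * (1 + ε / 8)) (fail ω.1 ω.2) ω.2).run
        (fun i => f (ω.2 i)) = true} := by
  obtain ⟨hk0, hkε, hδ0, hδ1, hδk⟩ := near_scale_facts hε0 hε hk hδ
  have hε4 : (0 : ℝ) < ε ^ 4 := by positivity
  have hmle : (40000000 : ℝ) ≤ m * ε ^ 4 := by
    have := Nat.le_ceil ((40000000 : ℝ) / ε ^ 4)
    rwa [← hm, div_le_iff₀ hε4] at this
  have hm0 : 0 < m := by
    rcases Nat.eq_zero_or_pos m with h | h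
    · rw [h] at hmle; norm_num at hmle
    · exact h
  obtain ⟨hL, hl1, -⟩ := nearSample_size_bounds hd hε0 hε hl
  have hd1 : (1 : ℝ) ≤ d := by exact_mod_cast hd
  have hlle : (120000000 : ℝ) ≤ l * ε ^ 4 := by nlinarith
  have hl0 : 0 < l := by
    rcases Nat.eq_zero_or_pos l with h | h
    · rw [h] at hlle; norm_num at hlle
    · exact h
  obtain ⟨hNδ, hexp⟩ := fewNear_bound_arith hδ0 hm0 hN
  obtain ⟨h, t, hh, ht, hf⟩ := (mem_piecewiseClass_iff hk0).1 hfF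
  have hint := integral_otherPieceProb_le t hδ0 hδ1
  rw [Nat.cast_sub hk0, Nat.cast_one] at hint
  obtain ⟨ha1, ha2⟩ := accept_threshold_arith hε hδ0 hkε hδk
  have hm' : (0 : ℝ) < m := by exact_mod_cast hm0
  have hl' : (0 : ℝ) < l := by exact_mod_cast hl0
  refine probAtLeast_of_failure_le ρ (measurableSet_acceptFailure m N l t δ (ε ^ 3 / 4000))
    ((sampleLaw_acceptFailure_le hm0 hl0 t hδ0 hδ1 (by positivity) hNδ (hint.trans ha1)).trans
      (ofReal_le_one_third ?_)) fun r x hx => ?_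
  · have e : ∀ n : ℝ, 0 < n → 40000000 ≤ n * ε ^ 4 →
        ε ^ 2 / 60 / (n * (ε ^ 3 / 4000) ^ 2) ≤ 1 / 12 := by
      intro n hn hle
      rw [div_le_div_iff₀ (by positivity) (by norm_num)]
      have : n * (ε ^ 3 / 4000) ^ 2 = (n * ε ^ 4) * (ε ^ 2 / 16000000) := by ring
      rw [this]
      nlinarith [mul_le_mul_of_nonneg_right hle (show 0 ≤ ε ^ 2 / 16000000 by positivity)]
    have e1 := e m hm' hmle
    have e2 := e l hl' (by linarith)
    linarith
  -- Having too few nearby points is part of the failure event, so the arbitrary response `fail`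
  -- plays no role outside it.
  · have hy : ∀ i, l ≤ (nearIndices δ (x (Fin.castAdd N i)) fun j => x (Fin.natAdd m j)).card := by
      intro i
      by_contra hlt
      exact hx (Or.inl (Or.inl ⟨i, not_le.1 hlt⟩))
    change QueryAlg.run _ _ = true
    rw [run_nsTester H rfl rfl hy, decide_eq_true_iff]
    refine (empirical_le_of_notMem_acceptFailure hm0 hk0 hh hf (by positivity) hx hy).trans ?_
    linarith

theorem nsTester_rejects {Y : Type u} [MeasurableSpace Y] [MeasurableEq Y] {H : Set (ℝ → Y)}
    (hH : H.Nonempty) (hHm : ∀ h ∈ H, Measurable h) (hemp : EmpiricallyMeasurable H)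
    (hcross : ZeroMeasureCrossings H) {d : ℕ} (hd : 0 < d) (hdim : graphDim H = (d : ℕ∞)) {ε : ℝ}
    (hε0 : 0 < ε) (hε : ε < 1 / 2) {k : ℕ} (hk : 80 / ε ≤ (k : ℝ)) {δ : ℝ} {m l N : ℕ}
    (hδ : δ = ε ^ 2 / (32 * k)) (hm : m = ⌈(40000000 : ℝ) / ε ^ 4⌉₊)
    (hl : l = ⌈(120000000 : ℝ) * d / ε ^ 4 * Real.log (10000000000 / ε)⌉₊)
    (hN : N = ⌈max (2 * l / δ) (8 / δ * Real.log (12 * m))⌉₊) {R : Type v} [MeasurableSpace R]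
    (ρ : Measure R) [IsProbabilityMeasure ρ] (fail : R → (Fin (m + N) → ℝ) → Bool) {f : ℝ → Y}
    (hf : Measurable f) (hdist : ENNReal.ofReal ε ≤ distToClass uniform01 f (piecewiseClass k H)) :
    ProbAtLeast (ρ.prod (Measure.pi fun _ : Fin (m + N) => uniform01)) (2 / 3)
      {ω | (nsTester H m l N δ (((k : ℝ) - 1) * (δ / 2) * (1 + ε / 8)) (fail ω.1 ω.2) ω.2).run
        (fun i => f (ω.2 i)) = false} := by
  obtain ⟨hk0, hkε, hδ0, hδ1, hδk⟩ := near_scale_facts hε0 hε hk hδ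
  have hε4 : (0 : ℝ) < ε ^ 4 := by positivity
  have hmle : (40000000 : ℝ) ≤ m * ε ^ 4 := by
    have := Nat.le_ceil ((40000000 : ℝ) / ε ^ 4)
    rwa [← hm, div_le_iff₀ hε4] at this
  have hm0 : 0 < m := by
    rcases Nat.eq_zero_or_pos m with h | h
    · rw [h] at hmle; norm_num at hmle
    · exact h
  have hm' : (0 : ℝ) < m := by exact_mod_cast hm0
  obtain ⟨hL, hl1, -⟩ := nearSample_size_bounds hd hε0 hε hl
  have hd1 : (1 : ℝ) ≤ d := by exact_mod_cast hd
  have hlle : (120000000 : ℝ) ≤ l * ε ^ 4 := by nlinarith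
  have hl0 : 0 < l := by
    rcases Nat.eq_zero_or_pos l with h | h
    · rw [h] at hlle; norm_num at hlle
    · exact h
  obtain ⟨hNδ, hexp⟩ := fewNear_bound_arith hδ0 hm0 hN
  obtain ⟨G, hGH, hGc, hG, hGnull⟩ := exists_countable_subset_agree hH hHm hcross hf
  have hμ : ((k : ℝ) - 1) * (δ / 2) * (1 + ε / 6) < ∫ x, lowerNS G f δ x ∂uniform01 := by
    by_contra hle
    obtain ⟨g, hg, hgd⟩ := exists_close_of_integral_lowerNS_le hHm hcross hGH hG hGc hf hε0 hε hk
      hδ (not_lt.1 hle)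
    exact absurd (hdist.trans (iInf₂_le g hg)) (not_le.2 hgd)
  obtain ⟨hr1, hr2⟩ := reject_threshold_arith hε0 hε hδ0 hkε hδk hμ
  obtain ⟨E, hEm, hEgood, hEη⟩ := exists_exceptionalSet (l := l) (α := ε / 200)
    (β := ε ^ 3 / 3000) hHm hemp hf hdim hδ0 hδ1 (by positivity) (by linarith) (by positivity)
    (by
      have : ε / 200 * (ε ^ 3 / 3000) * l = l * ε ^ 4 / 600000 := by ring
      rw [this]; linarith)
  have hNm : Measurable (lowerNS G f δ) :=
    measurable_lowerNS (fun h hh => hHm h (hGH hh)) hGc hf hδ0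
  have hgrow := growth_mul_exp_le hd hε0 hε hm hl
  refine probAtLeast_of_failure_le ρ (measurableSet_rejectFailure m N (ε / 200) hNm hEm)
    ((sampleLaw_rejectFailure_le hG hm0 hl0 hδ0 hδ1 (by positivity) hNδ hNm hEm (by positivity)
      hEη (b := ε ^ 2 / 65) (by positivity) hr1).trans
      (ofReal_le_one_third ?_)) fun r x hx => ?_
  -- Here 200²·65 = 2600000, and twelve times this is below 40000000; this estimate governs the size
  -- of the constant c.
  · have e : 1 / (m * (ε / 200) ^ 2 * (ε ^ 2 / 65)) ≤ 1 / 12 := by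
      rw [div_le_div_iff₀ (by positivity) (by norm_num)]
      have : m * (ε / 200) ^ 2 * (ε ^ 2 / 65) = m * ε ^ 4 / 2600000 := by ring
      rw [this]
      linarith
    linarith
  · have hy : ∀ i, l ≤ (nearIndices δ (x (Fin.castAdd N i)) fun j => x (Fin.natAdd m j)).card := by
      intro i
      by_contra hlt
      exact hx (Or.inl (Or.inl (Or.inl ⟨i, not_le.1 hlt⟩)))
    change QueryAlg.run _ _ = false
    rw [run_nsTester H rfl rfl hy, decide_eq_false_iff_not, not_le]
    exact hr2.trans_le (le_empirical_of_notMem_rejectFailure hHm hG hf hGnull hm0 hδ0 hδ1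
      (by positivity) (by linarith) (by positivity) hEgood hx hy)

end

theorem theorem3 :
    ∃ c c' c'' : ℝ, 1 ≤ c ∧ 1 ≤ c' ∧ 1 ≤ c'' ∧
      ∀ (Y : Type u) [MeasurableSpace Y] [MeasurableEq Y] (H : Set (ℝ → Y)),
        H.Nonempty → (∀ h ∈ H, Measurable h) → EmpiricallyMeasurable H →
        ZeroMeasureCrossings H →
      ∀ d : ℕ, 0 < d → graphDim H = (d : ℕ∞) →
      ∀ ε : ℝ, 0 < ε → ε < 1 / 2 →
      ∀ k : ℕ, 80 / ε ≤ (k : ℝ) →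
      ∀ (δ : ℝ) (m l N : ℕ),
        δ = ε ^ 2 / (32 * k) →
        m = ⌈c / ε ^ 4⌉₊ →
        l = ⌈c' * d / ε ^ 4 * Real.log (c'' / ε)⌉₊ →
        N = ⌈max (2 * l / δ) (8 / δ * Real.log (12 * m))⌉₊ →
      ∀ (R : Type v) [MeasurableSpace R] (ρ : Measure R) [IsProbabilityMeasure ρ]
        (fail : R → (Fin (m + N) → ℝ) → Bool),
        IsTester uniform01 (piecewiseClass k H) ε (m + N) (m * (l + 1)) ρ
          (fun r x => nsTester H m l N δ (((k : ℝ) - 1) * (δ / 2) * (1 + ε / 8)) (fail r x) x) := by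
  refine ⟨40000000, 120000000, 10000000000, by norm_num, by norm_num, by norm_num, ?_⟩
  intro Y _ _ H hH hHm hemp hcross d hd hdim ε hε0 hε k hk δ m l N hδ hm hl hN R _ ρ _ fail
  exact ⟨fun r x a => numQueries_nsTester_le H m l N δ _ _ x a,
    fun f _ hfF => nsTester_accepts hd hε0 hε hk hδ hm hl hN ρ fail hfF,
    fun f hf hdist => nsTester_rejects hH hHm hemp hcross hd hdim hε0 hε hk hδ hm hl hN ρ fail hf
      hdist⟩
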